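/- **Notation.** Write $\mathfrak e(z)=\exp(2\pi i z)$, $q^n=\mathfrak e(n\tau)$, and let $\mathfrak H$ be the upper half plane. For an integer vector $\mathbf p$ let $s(\mathbf p)$ be the sum of its components, and for $\mathbf p\in\mathbb Z_{\ge0}^{\mathfrak n}$ put $\mathbf p!=\prod_l p_l!$. Let $V$ be a real vector space of dimension $\mathfrak n$, $\mathcal V=\mathbb C\otimes_{\mathbb R}V$, let $\mathcal W$ be a finite-dimensional complex vector space, and let $B$ be a positive definite symmetric bilinear form on $V$, also extended $\mathbb C$-bilinearly to $\mathcal V$; $Q(x)=\tfrac12B(x,x)$. Let $L\subset V$ be the $\mathbb Z$-span of an $\mathbb R$-basis of $V$ with $B(L,L)\subseteq\mathbb Z$ (even or odd), and $L^\sharp=\{x\in V: B(x,L)\subseteq\mathbb Z\}$. **Groups.** $\widetilde{\mathrm{SL}_2(\mathbb Z)}$ is the group of pairs $(\gamma,f)$ with $\gamma=\left(\begin{smallmatrix}a&b\\c&d\end{smallmatrix}\right)\in\mathrm{SL}_2(\mathbb Z)$ and $f:\mathfrak H\to\mathbb C$ continuous with $f(\tau)^2=c\tau+d$, with product $(\gamma_1,f_1)(\gamma_2,f_2)=(\gamma_1\gamma_2,f_1(\gamma_2\tau)f_2(\tau))$;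 $\widetilde G$ is the preimage of a subgroup $G$ of $\mathrm{SL}_2(\mathbb Z)$. $H(L,1)$ is the group of elements $([v,w],\xi)$, $v,w\in L$, $\xi=\pm1$, with product $([v_1,w_1],\xi_1)([v_2,w_2],\xi_2)=([v_1+v_2,w_1+w_2],\xi_1\xi_2e^{\pi i(B(v_1,w_2)-B(v_2,w_1))})$. The group $\widetilde G\ltimes H(L,1)$ has product $(\gamma_1,h_1)(\gamma_2,h_2)=(\gamma_1\gamma_2,(h_1\cdot\gamma_2)h_2)$, where $([v,w],\xi)\cdot\gamma=([av+cw,bv+dw],\xi)$. For $k\in\frac12\mathbb Z$, $x=((\gamma,f),[v,w],\xi)$ and $\phi:\mathfrak H\times\mathcal V\to\mathcal W$ put $$(\phi|_{k,B}x)(\tau,z)=f(\tau)^{-2k}\,\xi\,\mathfrak e\!\left(-\tfrac{c}{c\tau+d}Q(z+\tau v+w)+\tau Q(v)+B(v,z)+\tfrac12B(v,w)\right)\phi\!\left(\gamma\tau,\tfrac{z+\tau v+w}{c\tau+d}\right),$$ and for $h:\mathfrak H\to\mathcal W$ put $(h|_k(\gamma,f))(\tau)=f(\tau)^{-2k}h(\gamma\tau)$.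 **Forms.** Let $G\le\mathrm{SL}_2(\mathbb Z)$ have finite index and let $\rho:\widetilde G\ltimes H(L,1)\to\mathrm{GL}(\mathcal W)$ be a representation whose kernel has finite index, with $\rho([0,0],-1)=-\mathrm{id}$. A weakly holomorphic Jacobi form of weight $k$, in $J^!_{k,L}(G,\rho)$, is a holomorphic $\phi:\mathfrak H\times\mathcal V\to\mathcal W$ with $\phi|_{k,B}x=\rho(x)\circ\phi$ for all $x\in\widetilde G\ltimes H(L,1)$ such that for each $x\in\widetilde{\mathrm{SL}_2(\mathbb Z)}\ltimes H(L,1)$ there is a Fourier expansion $\phi|_{k,B}x=\sum_{n,t}c(n,t)q^n\mathfrak e(B(t,z))$ over $n\in\frac1N\mathbb Z$, $t\in\frac1NL^\sharp$ (for some positive integer $N$) with $c(n,t)=0$ unless $n\ge N_0$, for some $N_0\in\mathbb Q$ depending on $x$. It is a weak Jacobi form, in $J^{w}_{k,L}(G,\rho)$, if for every $x$ one can take $N_0=0$. Holomorphic $\phi$ with the same transformation law form the space $J_{k,L}(G,\rho)$ of Jacobi forms if for every $x$ there is such an expansion with $c(n,t)=0$ unless $n-Q(t)\ge0$. For a representation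 $\sigma$ of $\widetilde G$ on $\mathcal W$, $M^!_k(G,\sigma)$, $M_k(G,\sigma)$, $S_k(G,\sigma)$ are the spaces of holomorphic $h:\mathfrak H\to\mathcal W$ with $h|_k\gamma=\sigma(\gamma)\circ h$ for $\gamma\in\widetilde G$ such that for each $\gamma\in\widetilde{\mathrm{SL}_2(\mathbb Z)}$ there is an expansion $h|_k\gamma=\sum_{n\in\frac1N\mathbb Z}c(n)q^n$ with, respectively, $c(n)=0$ unless $n\ge N_0$ for some $N_0$; $c(n)=0$ unless $n\ge0$; $c(n)=0$ unless $n>0$. **Operators.** Fix an $\mathbb R$-basis $\mathfrak B=(e_1,\dots,e_{\mathfrak n})$ of $V$, with coordinates $z_1,\dots,z_{\mathfrak n}$ on $\mathcal V$ and $\partial^{\mathbf p}=\partial^{s(\mathbf p)}/\partial z_1^{p_1}\cdots\partial z_{\mathfrak n}^{p_{\mathfrak n}}$; write $a_{ij}=B(e_i,e_j)$ and let $\mathbf e_1,\dots,\mathbf e_{\mathfrak n}$ be the standard unit vectors of $\mathbb Z^{\mathfrak n}$. On formal series $\sum_{\mathbf j\in\mathbb Z^{\mathfrak n}}h_{\mathbf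 j}(\tau)T^{\mathbf j}$ let $\mathcal T^{\mathbf p}$ be multiplication by $T^{\mathbf p}$, and let $\mathcal L_k$ send $\sum h_{\mathbf j}T^{\mathbf j}$ to the series with $\mathbf p$-th coefficient $$s(\mathbf p)(s(\mathbf p)+2k-2)h_{\mathbf p}-4\pi i\sum_{i,j}a_{ij}\,\tfrac{d}{d\tau}h_{\mathbf p-\mathbf e_i-\mathbf e_j}.$$ For $\mathbf p\in\mathbb Z_{\ge0}^{\mathfrak n}$ and $\lambda=\lfloor s(\mathbf p)/2\rfloor$ define $\mathcal D_{k,\mathbf p}$ as follows: $\mathcal D_{k,\mathbf p}=\mathcal T^{-\mathbf p}$ if $s(\mathbf p)\le1$; $\mathcal D_{k,\mathbf p}=\mathcal T^{-\mathbf p_{\lambda-1}}\mathcal L_{k+2(\lambda-1)}\cdots\mathcal T^{-\mathbf p_0}\mathcal L_k$ with $\mathbf p=\sum_i\mathbf p_i$, $\mathbf p_i\in\mathbb Z^{\mathfrak n}$, $s(\mathbf p_i)=2$, if $s(\mathbf p)\ge2$ is even; and $\mathcal D_{k,\mathbf p}=\mathcal T^{-\mathbf p_{\lambda-1}}\mathcal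 L_{k+1+2(\lambda-1)}\cdots\mathcal T^{-\mathbf p_0}\mathcal L_{k+1}\mathcal T^{-\mathbf p_{-1}}$ with $\mathbf p=\mathbf p_{-1}+\sum_{i\ge0}\mathbf p_i$, $s(\mathbf p_{-1})=1$, $s(\mathbf p_i)=2$, if $s(\mathbf p)\ge3$ is odd (the choice of the $\mathbf p_i$ does not matter). For holomorphic $\phi$ with Taylor expansion $\phi(\tau,\sum z_ie_i)=\sum_{\mathbf j\ge0}h_{\mathbf j}(\tau)z^{\mathbf j}$, that is, $h_{\mathbf j}(\tau)=\partial^{\mathbf j}\phi(\tau,0)/\mathbf j!$, let $D_{k,\mathbf p}\phi$ be the constant term of $\mathcal D_{k,\mathbf p}\bigl(\sum_{s(\mathbf j)\equiv s(\mathbf p)\,(2)}h_{\mathbf j}T^{\mathbf j}\bigr)$. For $\mathcal P\subseteq\mathbb Z_{\ge0}^{\mathfrak n}$ let $\widehat{\mathcal P}$ be the set of all $\mathbf p\in\mathbb Z_{\ge0}^{\mathfrak n}$ for which there is $\mathbf p'\in\mathcal P$ with $\mathbf p'-\mathbf p\in\mathbb Z_{\ge0}^{\mathfrak n}$ and $s(\mathbf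 p)\equiv s(\mathbf p')\pmod 2$. For $t\in L^\sharp$ let $\vartheta_{L,t}(\tau,z)=\sum_{v\in t+L}\mathfrak e(\tau Q(v)+B(v,z))$. **Theorem.** Let $k\in\frac12\mathbb Z$ with $k\ne0,-1,-2,\dots$, let $G$ and $\rho$ be as above, and suppose $\rho([v,0],1)=\rho([0,v],1)=\mathrm{id}_{\mathcal W}$ for all $v\in L$. Let $d=|L^\sharp/L|$, let $\mathcal P_0=\{\mathbf p_1,\dots,\mathbf p_d\}\subset\mathbb Z_{\ge0}^{\mathfrak n}$ have $d$ elements, and let $L^\sharp/L=\{t_1+L,\dots,t_d+L\}$. Suppose that $$\mathcal F_{L,\mathcal P_0}(\tau)=\det\left(\frac1{(2\pi i)^{s(\mathbf p_i)}}\,\partial^{\mathbf p_i}\vartheta_{L,t_j}\big|_{z=0}(\tau)\right)_{1\le i,j\le d}$$ is not identically zero on $\mathfrak H$. Then $\phi\mapsto(D_{k,\mathbf p}\phi)_{\mathbf p\in\widehat{\mathcal P_0}}$ is an injective $\mathbb C$-linear map $$J^!_{k,L}(G,\rho)\to\prod_{\mathbf p\in\widehat{\mathcal P_0}}M^!_{k+s(\mathbf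 p)}(G,\rho|_{\widetilde G}),$$ and it restricts to injective $\mathbb C$-linear maps $$J^{w}_{k,L}(G,\rho)\to\prod_{\mathbf p\in\widehat{\mathcal P_0}}M_{k+s(\mathbf p)}(G,\rho|_{\widetilde G})$$ and, if $\mathbf 0\in\widehat{\mathcal P_0}$, $$J_{k,L}(G,\rho)\to M_k(G,\rho|_{\widetilde G})\times\prod_{\mathbf 0\ne\mathbf p\in\widehat{\mathcal P_0}}S_{k+s(\mathbf p)}(G,\rho|_{\widetilde G}).$$ -/

import Mathlib

open scoped TensorProduct UpperHalfPlane MatrixGroups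
open Module

noncomputable section

/-! ### Lattices -/

/-- An integral positive definite lattice `(L, B)` in the real vector space `V`: a positive definite
symmetric bilinear form `B` on `V`, and the `ℤ`-span `L` of an `ℝ`-basis of `V`, with
`B (L, L) ⊆ ℤ`. The lattice may be even or odd. -/
structure IntegralLattice (V : Type*) [AddCommGroup V] [Module ℝ V] where
  form : LinearMap.BilinForm ℝ V
  symm : ∀ x y, form x y = form y x
  posDef : ∀ x, x ≠ 0 → 0 < form x x
  lattice : Submodule ℤ V
  exists_basis : ∃ (n : ℕ) (b : Basis (Fin n) ℝ V), lattice = Submodule.span ℤ (Set.range b)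
  integral : ∀ x ∈ lattice, ∀ y ∈ lattice, ∃ m : ℤ, form x y = m

/-- The complexification `V ⊕ iV` of a real vector space. -/
abbrev Cplx (V : Type*) [AddCommGroup V] [Module ℝ V] : Type _ := ℂ ⊗[ℝ] V

/-- `e(z) = exp (2πiz)`. -/
def eexp (z : ℂ) : ℂ := Complex.exp (2 * Real.pi * Complex.I * z)

namespace IntegralLattice

variable {V : Type*} [AddCommGroup V] [Module ℝ V] (Λ : IntegralLattice V)

/-- The dual lattice `L♯ = {x ∈ V | B (x, L) ⊆ ℤ}`. -/
def dual : Submodule ℤ V := Λ.form.dualSubmodule Λ.lattice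

/-- The discriminant group `L♯ / L`. -/
abbrev Discriminant : Type _ := Λ.dual ⧸ Λ.lattice.comap Λ.dual.subtype

/-- The `ℂ`-bilinear extension of `B`. -/
def formC : LinearMap.BilinForm ℂ (Cplx V) := Λ.form.baseChange ℂ

/-- `Q (x) = B (x, x) / 2` on `V`. -/
def Q (x : V) : ℝ := Λ.form x x / 2

/-- `Q (z) = B (z, z) / 2` on the complexification. -/
def QC (z : Cplx V) : ℂ := Λ.formC z z / 2

end IntegralLattice

/-! ### The metaplectic double cover of `SL₂(ℤ)` -/

/-- The automorphy factor `j (γ, τ) = cτ + d`. -/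
def jfac (γ : SL(2, ℤ)) (τ : ℍ) : ℂ := ((γ 1 0 : ℤ) : ℂ) * τ + ((γ 1 1 : ℤ) : ℂ)

theorem jfac_ne_zero (γ : SL(2, ℤ)) (τ : ℍ) : jfac γ τ ≠ 0 :=
  UpperHalfPlane.denom_ne_zero (γ : GL (Fin 2) ℝ) τ

theorem jfac_one (τ : ℍ) : jfac 1 τ = 1 := by
  simp [jfac]

theorem jfac_mul (γ δ : SL(2, ℤ)) (τ : ℍ) : jfac (γ * δ) τ = jfac γ (δ • τ) * jfac δ τ := by
  have h := jfac_ne_zero δ τ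
  have hs : ((δ • τ : ℍ) : ℂ)
      = (((δ 0 0 : ℤ) : ℂ) * τ + ((δ 0 1 : ℤ) : ℂ)) / jfac δ τ := by
    rw [UpperHalfPlane.coe_specialLinearGroup_apply]
    simp [jfac]
  have hj : jfac γ (δ • τ) = ((γ 1 0 : ℤ) : ℂ) * ((δ • τ : ℍ) : ℂ) + ((γ 1 1 : ℤ) : ℂ) := rfl
  rw [hj, hs]
  field_simp
  simp only [jfac, Matrix.SpecialLinearGroup.coe_mul, Matrix.mul_apply, Fin.sum_univ_two]
  push_cast
  ring

/-- The double cover of `SL₂(ℤ)`: pairs of a matrix and a continuous square root of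
`τ ↦ cτ + d` on the (connected) upper half plane. Such a root is `±1` times the principal
branch of `(cτ + d) ^ (1/2)`. -/
@[ext]
structure Mp2Z where
  mat : SL(2, ℤ)
  root : ℍ → ℂ
  continuous_root : Continuous root
  root_sq : ∀ τ, root τ ^ 2 = jfac mat τ

namespace Mp2Z

theorem root_ne_zero (x : Mp2Z) (τ : ℍ) : x.root τ ≠ 0 := by
  intro h
  have := x.root_sq τ
  rw [h] at this
  exact jfac_ne_zero x.mat τ (by rw [← this]; simp)

theorem continuous_smul (γ : SL(2, ℤ)) : Continuous fun τ : ℍ => γ • τ :=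
  continuous_const_smul (γ : GL (Fin 2) ℝ)

/-- `(γ₁, f₁(τ)) (γ₂, f₂(τ)) = (γ₁ γ₂, f₁(γ₂ τ) f₂(τ))`. -/
instance : Mul Mp2Z where
  mul x y :=
    { mat := x.mat * y.mat
      root := fun τ => x.root (y.mat • τ) * y.root τ
      continuous_root := (x.continuous_root.comp (continuous_smul y.mat)).mul y.continuous_root
      root_sq := fun τ => by rw [mul_pow, x.root_sq, y.root_sq, jfac_mul] }

instance : One Mp2Z where
  one := { mat := 1, root := fun _ => 1, continuous_root := continuous_const,
           root_sq := fun τ => by rw [jfac_one]; simp }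

instance : Inv Mp2Z where
  inv x :=
    { mat := x.mat⁻¹
      root := fun τ => (x.root (x.mat⁻¹ • τ))⁻¹
      continuous_root := (x.continuous_root.comp (continuous_smul x.mat⁻¹)).inv₀
        (fun _ => x.root_ne_zero _)
      root_sq := fun τ => by
        rw [inv_pow, x.root_sq]
        refine inv_eq_of_mul_eq_one_right ?_
        rw [← jfac_mul, mul_inv_cancel, jfac_one] }

@[simp] theorem mul_mat (x y : Mp2Z) : (x * y).mat = x.mat * y.mat := rfl
@[simp] theorem mul_root (x y : Mp2Z) (τ : ℍ) :
    (x * y).root τ = x.root (y.mat • τ) * y.root τ := rfl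
@[simp] theorem one_mat : (1 : Mp2Z).mat = 1 := rfl
@[simp] theorem one_root (τ : ℍ) : (1 : Mp2Z).root τ = 1 := rfl
@[simp] theorem inv_mat (x : Mp2Z) : x⁻¹.mat = x.mat⁻¹ := rfl
@[simp] theorem inv_root (x : Mp2Z) (τ : ℍ) : x⁻¹.root τ = (x.root (x.mat⁻¹ • τ))⁻¹ := rfl

instance : Group Mp2Z where
  mul_assoc x y z := by
    ext1
    · simp [mul_assoc]
    · funext τ; simp [mul_assoc, mul_smul]
  one_mul x := by
    ext1
    · simp
    · funext τ; simp
  mul_one x := by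
    ext1
    · simp
    · funext τ; simp
  inv_mul_cancel x := by
    ext1
    · simp
    · funext τ; simp [x.root_ne_zero]

/-- The projection to `SL₂(ℤ)`. -/
def proj : Mp2Z →* SL(2, ℤ) where
  toFun := mat
  map_one' := rfl
  map_mul' _ _ := rfl

/-- The preimage `G~` in the double cover of a subgroup `G` of `SL₂(ℤ)`. -/
def cover (G : Subgroup SL(2, ℤ)) : Subgroup Mp2Z := G.comap proj

end Mp2Z

/-! ### The Heisenberg group and the Jacobi group -/

section JacobiGroup

variable {V : Type*} [AddCommGroup V] [Module ℝ V]

/-- The Heisenberg group of `V`: triples `([v, w], ξ)` with `ξ` on the unit circle. -/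
@[ext]
structure Heisenberg (Λ : IntegralLattice V) where
  v : V
  w : V
  phase : Circle

namespace Heisenberg

variable {Λ : IntegralLattice V}

/-- The alternating form `A ([v₁, w₁], [v₂, w₂]) = B (v₁, w₂) - B (v₂, w₁)`. -/
def alt (x y : Heisenberg Λ) : ℝ := Λ.form x.v y.w - Λ.form y.v x.w

instance : Mul (Heisenberg Λ) where
  mul x y := ⟨x.v + y.v, x.w + y.w, x.phase * y.phase * Circle.exp (Real.pi * alt x y)⟩

instance : One (Heisenberg Λ) where
  one := ⟨0, 0, 1⟩

instance : Inv (Heisenberg Λ) where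
  inv x := ⟨-x.v, -x.w, x.phase⁻¹⟩

@[simp] theorem mul_v (x y : Heisenberg Λ) : (x * y).v = x.v + y.v := rfl
@[simp] theorem mul_w (x y : Heisenberg Λ) : (x * y).w = x.w + y.w := rfl
@[simp] theorem mul_phase (x y : Heisenberg Λ) :
    (x * y).phase = x.phase * y.phase * Circle.exp (Real.pi * alt x y) := rfl
@[simp] theorem one_v : (1 : Heisenberg Λ).v = 0 := rfl
@[simp] theorem one_w : (1 : Heisenberg Λ).w = 0 := rfl
@[simp] theorem one_phase : (1 : Heisenberg Λ).phase = 1 := rfl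
@[simp] theorem inv_v (x : Heisenberg Λ) : x⁻¹.v = -x.v := rfl
@[simp] theorem inv_w (x : Heisenberg Λ) : x⁻¹.w = -x.w := rfl
@[simp] theorem inv_phase (x : Heisenberg Λ) : x⁻¹.phase = x.phase⁻¹ := rfl

instance : Group (Heisenberg Λ) where
  mul_assoc x y z := by
    ext1
    · simp [add_assoc]
    · simp [add_assoc]
    · have h : Circle.exp (Real.pi * alt x y) * Circle.exp (Real.pi * alt (x * y) z)
          = Circle.exp (Real.pi * alt y z) * Circle.exp (Real.pi * alt x (y * z)) := by
        rw [← Circle.exp_add, ← Circle.exp_add]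
        congr 1
        simp [alt]
        ring
      simp only [mul_phase]
      calc _ = x.phase * y.phase * z.phase *
              (Circle.exp (Real.pi * alt x y) * Circle.exp (Real.pi * alt (x * y) z)) := by
              simp only [mul_assoc, mul_left_comm, mul_comm]
        _ = _ := by rw [h]; simp only [mul_assoc, mul_left_comm, mul_comm]
  one_mul x := by ext1 <;> simp [alt]
  mul_one x := by ext1 <;> simp [alt]
  inv_mul_cancel x := by ext1 <;> simp [alt]

/-- The right action `([v, w], ξ) ↦ ([v, w] γ, ξ)` of `SL₂(ℤ)`, where
`[v, w] γ = [av + cw, bv + dw]`. -/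
def act (x : Heisenberg Λ) (γ : SL(2, ℤ)) : Heisenberg Λ :=
  ⟨γ 0 0 • x.v + γ 1 0 • x.w, γ 0 1 • x.v + γ 1 1 • x.w, x.phase⟩

theorem act_one (x : Heisenberg Λ) : x.act 1 = x := by
  ext1 <;> simp [act]

theorem one_act (γ : SL(2, ℤ)) : (1 : Heisenberg Λ).act γ = 1 := by
  ext1 <;> simp [act]

theorem act_act (x : Heisenberg Λ) (γ δ : SL(2, ℤ)) : x.act (γ * δ) = (x.act γ).act δ := by
  ext1
  · simp only [act, Matrix.SpecialLinearGroup.coe_mul, Matrix.mul_apply, Fin.sum_univ_two]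
    module
  · simp only [act, Matrix.SpecialLinearGroup.coe_mul, Matrix.mul_apply, Fin.sum_univ_two]
    module
  · rfl

theorem alt_act (x y : Heisenberg Λ) (γ : SL(2, ℤ)) : alt (x.act γ) (y.act γ) = alt x y := by
  have hdet : ((γ 0 0 : ℤ) : ℝ) * ((γ 1 1 : ℤ) : ℝ) - ((γ 0 1 : ℤ) : ℝ) * ((γ 1 0 : ℤ) : ℝ) = 1 := by
    have := Matrix.det_fin_two γ.1
    rw [γ.2] at this
    exact_mod_cast this.symm
  simp only [alt, act, map_add, map_zsmul, LinearMap.add_apply, LinearMap.smul_apply,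
    zsmul_eq_mul]
  rw [Λ.symm y.v x.v, Λ.symm y.w x.w, Λ.symm y.w x.v, Λ.symm y.v x.w]
  linear_combination (Λ.form x.v y.w - Λ.form x.w y.v) * hdet

theorem mul_act (x y : Heisenberg Λ) (γ : SL(2, ℤ)) : (x * y).act γ = x.act γ * y.act γ := by
  ext1
  · simp only [act, mul_v, mul_w, smul_add]; abel
  · simp only [act, mul_v, mul_w, smul_add]; abel
  · rw [mul_phase, alt_act]; rfl

end Heisenberg

/-- The semidirect product of the double cover of `SL₂(ℤ)` and the Heisenberg group of `V`. -/
@[ext]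
structure JacobiGroup (Λ : IntegralLattice V) where
  mp : Mp2Z
  heis : Heisenberg Λ

namespace JacobiGroup

variable {Λ : IntegralLattice V}

/-- `(γ₁, h₁) (γ₂, h₂) = (γ₁ γ₂, (h₁ γ₂) h₂)`. -/
instance : Mul (JacobiGroup Λ) where
  mul x y := ⟨x.mp * y.mp, x.heis.act y.mp.mat * y.heis⟩

instance : One (JacobiGroup Λ) where
  one := ⟨1, 1⟩

instance : Inv (JacobiGroup Λ) where
  inv x := ⟨x.mp⁻¹, (x.heis⁻¹).act x.mp.mat⁻¹⟩

@[simp] theorem mul_mp (x y : JacobiGroup Λ) : (x * y).mp = x.mp * y.mp := rfl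
@[simp] theorem mul_heis (x y : JacobiGroup Λ) :
    (x * y).heis = x.heis.act y.mp.mat * y.heis := rfl
@[simp] theorem one_mp : (1 : JacobiGroup Λ).mp = 1 := rfl
@[simp] theorem one_heis : (1 : JacobiGroup Λ).heis = 1 := rfl
@[simp] theorem inv_mp (x : JacobiGroup Λ) : x⁻¹.mp = x.mp⁻¹ := rfl
@[simp] theorem inv_heis (x : JacobiGroup Λ) : x⁻¹.heis = (x.heis⁻¹).act x.mp.mat⁻¹ := rfl

instance : Group (JacobiGroup Λ) where
  mul_assoc x y z := by
    ext1
    · simp [mul_assoc]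
    · simp [mul_assoc, Heisenberg.mul_act, Heisenberg.act_act]
  one_mul x := by
    ext1
    · simp
    · simp [Heisenberg.one_act]
  mul_one x := by
    ext1
    · simp
    · simp [Heisenberg.act_one]
  inv_mul_cancel x := by
    ext1
    · simp
    · simp [← Heisenberg.act_act, Heisenberg.act_one]

theorem zsmul_add_zsmul_mem {x y : V} (hx : x ∈ Λ.lattice) (hy : y ∈ Λ.lattice) (a c : ℤ) :
    a • x + c • y ∈ Λ.lattice :=
  Λ.lattice.add_mem (Λ.lattice.smul_mem a hx) (Λ.lattice.smul_mem c hy)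

theorem exp_alt_sq {x y : Heisenberg Λ} (hx : x.v ∈ Λ.lattice ∧ x.w ∈ Λ.lattice)
    (hy : y.v ∈ Λ.lattice ∧ y.w ∈ Λ.lattice) :
    Circle.exp (Real.pi * Heisenberg.alt x y) ^ 2 = 1 := by
  obtain ⟨m, hm⟩ := Λ.integral _ hx.1 _ hy.2
  obtain ⟨l, hl⟩ := Λ.integral _ hy.1 _ hx.2
  have h : (2 : ℝ) * (Real.pi * Heisenberg.alt x y) = ((m - l : ℤ) : ℝ) * (2 * Real.pi) := by
    rw [Heisenberg.alt, hm, hl]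
    push_cast
    ring
  have h2 := Circle.exp_natCast_mul (Real.pi * Heisenberg.alt x y) 2
  rw [← h2]
  push_cast
  rw [h, Circle.exp_intCast_mul, Circle.exp_two_pi, one_zpow]

/-- The subgroup `G~ ⋉ H(L, 1)` of the elements `(γ, [v, w], ξ)` with `γ` over `G`, `v, w ∈ L` and
`ξ = ±1`. -/
def sub (Λ : IntegralLattice V) (G : Subgroup SL(2, ℤ)) : Subgroup (JacobiGroup Λ) where
  carrier := {x | x.mp ∈ Mp2Z.cover G ∧ (x.heis.v ∈ Λ.lattice ∧ x.heis.w ∈ Λ.lattice) ∧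
    x.heis.phase ^ 2 = 1}
  mul_mem' := by
    rintro x y ⟨hx, hx', hx''⟩ ⟨hy, hy', hy''⟩
    have hz : (x.heis.act y.mp.mat).v ∈ Λ.lattice ∧ (x.heis.act y.mp.mat).w ∈ Λ.lattice :=
      ⟨zsmul_add_zsmul_mem hx'.1 hx'.2 _ _, zsmul_add_zsmul_mem hx'.1 hx'.2 _ _⟩
    refine ⟨mul_mem hx hy, ⟨Λ.lattice.add_mem hz.1 hy'.1, Λ.lattice.add_mem hz.2 hy'.2⟩, ?_⟩
    rw [mul_heis, Heisenberg.mul_phase, mul_pow, mul_pow, exp_alt_sq hz hy', hy'']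
    simpa [Heisenberg.act] using hx''
  one_mem' := ⟨one_mem _, ⟨Λ.lattice.zero_mem, Λ.lattice.zero_mem⟩, by simp⟩
  inv_mem' := by
    rintro x ⟨hx, hx', hx''⟩
    have hv := Λ.lattice.neg_mem hx'.1
    have hw := Λ.lattice.neg_mem hx'.2
    refine ⟨inv_mem hx, ⟨zsmul_add_zsmul_mem hv hw _ _, zsmul_add_zsmul_mem hv hw _ _⟩, ?_⟩
    simp [Heisenberg.act, hx'']

/-- The element `([v, w], ξ)` of `G~ ⋉ H(L, 1)`. -/
def ofHeis (G : Subgroup SL(2, ℤ)) (v w : Λ.lattice) (ξ : Circle) (hξ : ξ ^ 2 = 1) : sub Λ G :=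
  ⟨⟨1, ⟨v, w, ξ⟩⟩, one_mem _, ⟨v.2, w.2⟩, hξ⟩

/-- The inclusion of `G~` in `G~ ⋉ H(L, 1)`. -/
def ofCover (Λ : IntegralLattice V) (G : Subgroup SL(2, ℤ)) : Mp2Z.cover G →* sub Λ G where
  toFun γ := ⟨⟨γ, 1⟩, γ.2, ⟨Λ.lattice.zero_mem, Λ.lattice.zero_mem⟩, by simp⟩
  map_one' := rfl
  map_mul' γ δ := by
    refine Subtype.ext (JacobiGroup.ext rfl ?_)
    simp [Heisenberg.one_act]

end JacobiGroup

end JacobiGroup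

/-! ### Slash operators and Jacobi forms

Weights are half-integral: throughout, the integer `κ` is `2k`, where `k` is the weight. -/

section JacobiForms

variable {V : Type*} [AddCommGroup V] [Module ℝ V]
variable {W : Type*} [NormedAddCommGroup W] [NormedSpace ℂ W]

/-- The point `z + τv + w` of the complexification. -/
def heisTranslate (x : V × V) (τ : ℍ) (z : Cplx V) : Cplx V :=
  z + (τ : ℂ) ⊗ₜ[ℝ] x.1 + (1 : ℂ) ⊗ₜ[ℝ] x.2

/-- The automorphy factor `J_B`. -/
def jacobiFactor {Λ : IntegralLattice V} (x : JacobiGroup Λ) (τ : ℍ) (z : Cplx V) : ℂ :=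
  (x.heis.phase : ℂ) *
    eexp (-(((x.mp.mat 1 0 : ℤ) : ℂ) / jfac x.mp.mat τ) *
          Λ.QC (heisTranslate (x.heis.v, x.heis.w) τ z)
        + τ * (Λ.Q x.heis.v : ℂ) + Λ.formC ((1 : ℂ) ⊗ₜ[ℝ] x.heis.v) z
        + (Λ.form x.heis.v x.heis.w : ℂ) / 2)

/-- The slash operator `f |_{k,B} x` of weight `k = κ / 2` and form `B`. -/
def jacobiSlash {Λ : IntegralLattice V} (κ : ℤ) (x : JacobiGroup Λ) (f : ℍ → Cplx V → W) :
    ℍ → Cplx V → W :=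
  fun τ z => (x.mp.root τ ^ (-κ) * jacobiFactor x τ z) •
    f (x.mp.mat • τ) ((jfac x.mp.mat τ)⁻¹ • heisTranslate (x.heis.v, x.heis.w) τ z)

/-- The slash operator `h |_k γ` of weight `k = κ / 2` on functions on the upper half plane. -/
def modSlash (κ : ℤ) (γ : Mp2Z) (h : ℍ → W) : ℍ → W :=
  fun τ => γ.root τ ^ (-κ) • h (γ.mat • τ)

/-- Holomorphy of `φ` on `ℍ × (V ⊕ iV)`, expressed in linear coordinates. -/
def IsHolJacobi (φ : ℍ → Cplx V → W) : Prop :=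
  ∀ (n : ℕ) (b : Basis (Fin n) ℝ V),
    DifferentiableOn ℂ
      (fun x : ℂ × (Fin n → ℂ) =>
        φ (UpperHalfPlane.ofComplex x.1) (∑ i, x.2 i ⊗ₜ[ℝ] b i))
      {x | 0 < x.1.im}

/-- Holomorphy of `h` on the upper half plane. -/
def IsHolMod (h : ℍ → W) : Prop :=
  DifferentiableOn ℂ (fun z : ℂ => h (UpperHalfPlane.ofComplex z)) {z | 0 < z.im}

/-- `f` has a Fourier expansion `f(τ, z) = ∑ c(n, t) q ^ n e(B(t, z))`, over `n ∈ (1/N)ℤ` and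
`t ∈ (1/N)L♯` for some positive integer `N`, in which only terms with `P n t` occur. The sum
converges unconditionally at every point. -/
def HasJacobiExpansion (Λ : IntegralLattice V) (P : ℚ → V → Prop) (f : ℍ → Cplx V → W) : Prop :=
  ∃ c : ℚ → V → W,
    (∃ N : ℕ, 0 < N ∧ ∀ n t, c n t ≠ 0 → (∃ m : ℤ, (N : ℚ) * n = m) ∧ N • t ∈ Λ.dual) ∧
    (∀ n t, c n t ≠ 0 → P n t) ∧
    ∀ (τ : ℍ) (z : Cplx V), HasSum (fun x : ℚ × V =>
      eexp ((x.1 : ℂ) * τ + Λ.formC ((1 : ℂ) ⊗ₜ[ℝ] x.2) z) • c x.1 x.2) (f τ z)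

/-- `h` has a Fourier expansion `h(τ) = ∑ c(n) q ^ n`, over `n ∈ (1/N)ℤ` for some positive
integer `N`, in which only terms with `P n` occur. -/
def HasModExpansion (P : ℚ → Prop) (h : ℍ → W) : Prop :=
  ∃ c : ℚ → W,
    (∃ N : ℕ, 0 < N ∧ ∀ n, c n ≠ 0 → ∃ m : ℤ, (N : ℚ) * n = m) ∧
    (∀ n, c n ≠ 0 → P n) ∧
    ∀ τ : ℍ, HasSum (fun n : ℚ => eexp ((n : ℂ) * τ) • c n) (h τ)

theorem HasJacobiExpansion.zero {Λ : IntegralLattice V} {P : ℚ → V → Prop} :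
    HasJacobiExpansion Λ P (0 : ℍ → Cplx V → W) :=
  ⟨0, ⟨1, one_pos, fun _ _ h => absurd rfl h⟩, fun _ _ h => absurd rfl h,
    fun τ z => by simp [hasSum_zero]⟩

theorem HasJacobiExpansion.add {Λ : IntegralLattice V} {P P₁ P₂ : ℚ → V → Prop}
    {f g : ℍ → Cplx V → W}
    (h₁ : ∀ n t, P₁ n t → P n t) (h₂ : ∀ n t, P₂ n t → P n t)
    (hf : HasJacobiExpansion Λ P₁ f) (hg : HasJacobiExpansion Λ P₂ g) :
    HasJacobiExpansion Λ P (f + g) := by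
  obtain ⟨c, ⟨N, hN, hc⟩, hcP, hcs⟩ := hf
  obtain ⟨d, ⟨M, hM, hd⟩, hdP, hds⟩ := hg
  have key : ∀ n t, (c + d) n t ≠ 0 → c n t ≠ 0 ∨ d n t ≠ 0 := by
    intro n t h
    by_contra! hh
    exact h (by simp [hh.1, hh.2])
  refine ⟨c + d, ⟨N * M, Nat.mul_pos hN hM, fun n t h => ?_⟩, fun n t h => ?_, fun τ z => ?_⟩
  · rcases key n t h with h | h
    · obtain ⟨⟨m, hm⟩, ht⟩ := hc n t h
      refine ⟨⟨M * m, ?_⟩, ?_⟩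
      · push_cast; rw [← hm]; ring
      · rw [mul_comm, mul_smul]; exact nsmul_mem ht M
    · obtain ⟨⟨m, hm⟩, ht⟩ := hd n t h
      refine ⟨⟨N * m, ?_⟩, ?_⟩
      · push_cast; rw [← hm]; ring
      · rw [mul_smul]; exact nsmul_mem ht N
  · rcases key n t h with h | h
    · exact h₁ _ _ (hcP n t h)
    · exact h₂ _ _ (hdP n t h)
  · simpa [smul_add] using (hcs τ z).add (hds τ z)

theorem HasJacobiExpansion.smul {Λ : IntegralLattice V} {P : ℚ → V → Prop}
    {f : ℍ → Cplx V → W} (a : ℂ) (hf : HasJacobiExpansion Λ P f) :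
    HasJacobiExpansion Λ P (a • f) := by
  obtain ⟨c, ⟨N, hN, hc⟩, hcP, hcs⟩ := hf
  have key : ∀ n t, (a • c) n t ≠ 0 → c n t ≠ 0 := fun n t h h' => h (by simp [h'])
  refine ⟨a • c, ⟨N, hN, fun n t h => hc n t (key n t h)⟩, fun n t h => hcP n t (key n t h),
    fun τ z => ?_⟩
  have := (hcs τ z).const_smul a
  simpa [smul_comm a] using this

theorem HasModExpansion.zero {P : ℚ → Prop} : HasModExpansion P (0 : ℍ → W) :=
  ⟨0, ⟨1, one_pos, fun _ h => absurd rfl h⟩, fun _ h => absurd rfl h,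
    fun τ => by simp [hasSum_zero]⟩

theorem HasModExpansion.add {P P₁ P₂ : ℚ → Prop} {f g : ℍ → W}
    (h₁ : ∀ n, P₁ n → P n) (h₂ : ∀ n, P₂ n → P n)
    (hf : HasModExpansion P₁ f) (hg : HasModExpansion P₂ g) :
    HasModExpansion P (f + g) := by
  obtain ⟨c, ⟨N, hN, hc⟩, hcP, hcs⟩ := hf
  obtain ⟨d, ⟨M, hM, hd⟩, hdP, hds⟩ := hg
  have key : ∀ n, (c + d) n ≠ 0 → c n ≠ 0 ∨ d n ≠ 0 := by
    intro n h
    by_contra! hh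
    exact h (by simp [hh.1, hh.2])
  refine ⟨c + d, ⟨N * M, Nat.mul_pos hN hM, fun n h => ?_⟩, fun n h => ?_, fun τ => ?_⟩
  · rcases key n h with h | h
    · obtain ⟨m, hm⟩ := hc n h
      exact ⟨M * m, by push_cast; rw [← hm]; ring⟩
    · obtain ⟨m, hm⟩ := hd n h
      exact ⟨N * m, by push_cast; rw [← hm]; ring⟩
  · rcases key n h with h | h
    · exact h₁ _ (hcP n h)
    · exact h₂ _ (hdP n h)
  · simpa [smul_add] using (hcs τ).add (hds τ)

theorem HasModExpansion.smul {P : ℚ → Prop} {f : ℍ → W} (a : ℂ) (hf : HasModExpansion P f) :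
    HasModExpansion P (a • f) := by
  obtain ⟨c, ⟨N, hN, hc⟩, hcP, hcs⟩ := hf
  have key : ∀ n, (a • c) n ≠ 0 → c n ≠ 0 := fun n h h' => h (by simp [h'])
  refine ⟨a • c, ⟨N, hN, fun n h => hc n (key n h)⟩, fun n h => hcP n (key n h), fun τ => ?_⟩
  have := (hcs τ).const_smul a
  simpa [smul_comm a] using this

theorem jacobiSlash_zero {Λ : IntegralLattice V} (κ : ℤ) (x : JacobiGroup Λ) :
    jacobiSlash κ x (0 : ℍ → Cplx V → W) = 0 := by
  funext τ z; simp [jacobiSlash]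

theorem jacobiSlash_add {Λ : IntegralLattice V} (κ : ℤ) (x : JacobiGroup Λ)
    (f g : ℍ → Cplx V → W) :
    jacobiSlash κ x (f + g) = jacobiSlash κ x f + jacobiSlash κ x g := by
  funext τ z; simp [jacobiSlash]

theorem jacobiSlash_smul {Λ : IntegralLattice V} (κ : ℤ) (x : JacobiGroup Λ) (a : ℂ)
    (f : ℍ → Cplx V → W) : jacobiSlash κ x (a • f) = a • jacobiSlash κ x f := by
  funext τ z; simp only [jacobiSlash, Pi.smul_apply]; rw [smul_comm]

theorem modSlash_zero (κ : ℤ) (γ : Mp2Z) : modSlash κ γ (0 : ℍ → W) = 0 := by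
  funext τ; simp [modSlash]

theorem modSlash_add (κ : ℤ) (γ : Mp2Z) (f g : ℍ → W) :
    modSlash κ γ (f + g) = modSlash κ γ f + modSlash κ γ g := by
  funext τ; simp [modSlash]

theorem modSlash_smul (κ : ℤ) (γ : Mp2Z) (a : ℂ) (f : ℍ → W) :
    modSlash κ γ (a • f) = a • modSlash κ γ f := by
  funext τ; simp only [modSlash, Pi.smul_apply]; rw [smul_comm]

/-- Holomorphic functions that transform like Jacobi forms of weight `k = κ / 2` and index
`(L, B)` under `G~ ⋉ H(L, 1)`, with the representation `ρ`. -/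
def jacobiHol (κ : ℤ) (Λ : IntegralLattice V) (G : Subgroup SL(2, ℤ))
    (ρ : JacobiGroup.sub Λ G →* (W ≃ₗ[ℂ] W)) : Submodule ℂ (ℍ → Cplx V → W) where
  carrier := {φ | IsHolJacobi φ ∧
    ∀ x : JacobiGroup.sub Λ G, jacobiSlash κ x.1 φ = fun τ z => ρ x (φ τ z)}
  zero_mem' := ⟨fun _ _ => differentiableOn_const _, fun x => by
    rw [jacobiSlash_zero]; funext τ z; simp⟩
  add_mem' := by
    rintro f g ⟨hf, hf'⟩ ⟨hg, hg'⟩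
    refine ⟨fun n b => (hf n b).add (hg n b), fun x => ?_⟩
    rw [jacobiSlash_add, hf', hg']; funext τ z; simp
  smul_mem' := by
    rintro a f ⟨hf, hf'⟩
    refine ⟨fun n b => (hf n b).const_smul a, fun x => ?_⟩
    rw [jacobiSlash_smul, hf']; funext τ z; simp

/-- Weakly holomorphic Jacobi forms: for every `x` in `SL₂(ℤ)~ ⋉ H(L, 1)`, there is an `N₀` such
that the Fourier expansion of `φ | x` has only terms with `n ≥ N₀`. -/
def jacobiWHol (κ : ℤ) (Λ : IntegralLattice V) (G : Subgroup SL(2, ℤ))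
    (ρ : JacobiGroup.sub Λ G →* (W ≃ₗ[ℂ] W)) : Submodule ℂ (ℍ → Cplx V → W) where
  carrier := {φ | φ ∈ jacobiHol κ Λ G ρ ∧ ∀ x ∈ JacobiGroup.sub Λ ⊤,
    ∃ N₀ : ℚ, HasJacobiExpansion Λ (fun n _ => N₀ ≤ n) (jacobiSlash κ x φ)}
  zero_mem' := ⟨zero_mem _, fun x _ => ⟨0, by rw [jacobiSlash_zero]; exact .zero⟩⟩
  add_mem' := by
    rintro f g ⟨hf, hf'⟩ ⟨hg, hg'⟩
    refine ⟨add_mem hf hg, fun x hx => ?_⟩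
    obtain ⟨N, hN⟩ := hf' x hx
    obtain ⟨M, hM⟩ := hg' x hx
    refine ⟨min N M, ?_⟩
    rw [jacobiSlash_add]
    exact .add (fun _ _ h => (min_le_left _ _).trans h) (fun _ _ h => (min_le_right _ _).trans h)
      hN hM
  smul_mem' := by
    rintro a f ⟨hf, hf'⟩
    refine ⟨Submodule.smul_mem _ a hf, fun x hx => ?_⟩
    obtain ⟨N, hN⟩ := hf' x hx
    exact ⟨N, by rw [jacobiSlash_smul]; exact hN.smul a⟩

/-- Forms for which the Fourier expansion of `φ | x` has only terms with `P n t`, for every `x` in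
`SL₂(ℤ)~ ⋉ H(L, 1)`. -/
def jacobiWith (P : ℚ → V → Prop) (κ : ℤ) (Λ : IntegralLattice V) (G : Subgroup SL(2, ℤ))
    (ρ : JacobiGroup.sub Λ G →* (W ≃ₗ[ℂ] W)) : Submodule ℂ (ℍ → Cplx V → W) where
  carrier := {φ | φ ∈ jacobiHol κ Λ G ρ ∧ ∀ x ∈ JacobiGroup.sub Λ ⊤,
    HasJacobiExpansion Λ P (jacobiSlash κ x φ)}
  zero_mem' := ⟨zero_mem _, fun x _ => by rw [jacobiSlash_zero]; exact .zero⟩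
  add_mem' := by
    rintro f g ⟨hf, hf'⟩ ⟨hg, hg'⟩
    refine ⟨add_mem hf hg, fun x hx => ?_⟩
    rw [jacobiSlash_add]
    exact .add (fun _ _ h => h) (fun _ _ h => h) (hf' x hx) (hg' x hx)
  smul_mem' := by
    rintro a f ⟨hf, hf'⟩
    refine ⟨Submodule.smul_mem _ a hf, fun x hx => ?_⟩
    rw [jacobiSlash_smul]; exact (hf' x hx).smul a

/-- Weak Jacobi forms: only terms with `n ≥ 0` occur. -/
def jacobiWeak (κ : ℤ) (Λ : IntegralLattice V) (G : Subgroup SL(2, ℤ))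
    (ρ : JacobiGroup.sub Λ G →* (W ≃ₗ[ℂ] W)) : Submodule ℂ (ℍ → Cplx V → W) :=
  jacobiWith (fun n _ => 0 ≤ n) κ Λ G ρ

/-- (Holomorphic) Jacobi forms: only terms with `n - Q(t) ≥ 0` occur. -/
def jacobiForm (κ : ℤ) (Λ : IntegralLattice V) (G : Subgroup SL(2, ℤ))
    (ρ : JacobiGroup.sub Λ G →* (W ≃ₗ[ℂ] W)) : Submodule ℂ (ℍ → Cplx V → W) :=
  jacobiWith (fun n t => 0 ≤ (n : ℝ) - Λ.Q t) κ Λ G ρ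

/-! ### Modular forms -/

/-- Holomorphic functions on the upper half plane that transform like modular forms of weight
`k = κ / 2` under `G~` with the representation `σ`. -/
def modHol (κ : ℤ) (G : Subgroup SL(2, ℤ)) (σ : Mp2Z.cover G →* (W ≃ₗ[ℂ] W)) :
    Submodule ℂ (ℍ → W) where
  carrier := {h | IsHolMod h ∧
    ∀ γ : Mp2Z.cover G, modSlash κ γ.1 h = fun τ => σ γ (h τ)}
  zero_mem' := ⟨differentiableOn_const _, fun γ => by
    rw [modSlash_zero]; funext τ; simp⟩
  add_mem' := by
    rintro f g ⟨hf, hf'⟩ ⟨hg, hg'⟩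
    refine ⟨hf.add hg, fun γ => ?_⟩
    rw [modSlash_add, hf', hg']; funext τ; simp
  smul_mem' := by
    rintro a f ⟨hf, hf'⟩
    refine ⟨hf.const_smul a, fun γ => ?_⟩
    rw [modSlash_smul, hf']; funext τ; simp

/-- Weakly holomorphic modular forms: meromorphic at all cusps. -/
def modWHol (κ : ℤ) (G : Subgroup SL(2, ℤ)) (σ : Mp2Z.cover G →* (W ≃ₗ[ℂ] W)) :
    Submodule ℂ (ℍ → W) where
  carrier := {h | h ∈ modHol κ G σ ∧ ∀ γ : Mp2Z,
    ∃ N₀ : ℚ, HasModExpansion (fun n => N₀ ≤ n) (modSlash κ γ h)}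
  zero_mem' := ⟨zero_mem _, fun γ => ⟨0, by rw [modSlash_zero]; exact .zero⟩⟩
  add_mem' := by
    rintro f g ⟨hf, hf'⟩ ⟨hg, hg'⟩
    refine ⟨add_mem hf hg, fun γ => ?_⟩
    obtain ⟨N, hN⟩ := hf' γ
    obtain ⟨M, hM⟩ := hg' γ
    refine ⟨min N M, ?_⟩
    rw [modSlash_add]
    exact .add (fun _ h => (min_le_left _ _).trans h) (fun _ h => (min_le_right _ _).trans h)
      hN hM
  smul_mem' := by
    rintro a f ⟨hf, hf'⟩
    refine ⟨Submodule.smul_mem _ a hf, fun γ => ?_⟩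
    obtain ⟨N, hN⟩ := hf' γ
    exact ⟨N, by rw [modSlash_smul]; exact hN.smul a⟩

/-- Forms for which the Fourier expansion of `h | γ` has only terms with `P n`, for every `γ` in
the double cover of `SL₂(ℤ)`. -/
def modWith (P : ℚ → Prop) (κ : ℤ) (G : Subgroup SL(2, ℤ))
    (σ : Mp2Z.cover G →* (W ≃ₗ[ℂ] W)) : Submodule ℂ (ℍ → W) where
  carrier := {h | h ∈ modHol κ G σ ∧ ∀ γ : Mp2Z, HasModExpansion P (modSlash κ γ h)}
  zero_mem' := ⟨zero_mem _, fun γ => by rw [modSlash_zero]; exact .zero⟩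
  add_mem' := by
    rintro f g ⟨hf, hf'⟩ ⟨hg, hg'⟩
    refine ⟨add_mem hf hg, fun γ => ?_⟩
    rw [modSlash_add]
    exact .add (fun _ h => h) (fun _ h => h) (hf' γ) (hg' γ)
  smul_mem' := by
    rintro a f ⟨hf, hf'⟩
    refine ⟨Submodule.smul_mem _ a hf, fun γ => ?_⟩
    rw [modSlash_smul]; exact (hf' γ).smul a

/-- Modular forms: holomorphic at all cusps. -/
def modForm (κ : ℤ) (G : Subgroup SL(2, ℤ)) (σ : Mp2Z.cover G →* (W ≃ₗ[ℂ] W)) :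
    Submodule ℂ (ℍ → W) :=
  modWith (fun n => 0 ≤ n) κ G σ

/-- Cusp forms: vanishing at all cusps. -/
def cuspForm (κ : ℤ) (G : Subgroup SL(2, ℤ)) (σ : Mp2Z.cover G →* (W ≃ₗ[ℂ] W)) :
    Submodule ℂ (ℍ → W) :=
  modWith (fun n => 0 < n) κ G σ

end JacobiForms

/-! ### Taylor coefficients, formal series and the operators `D_{k,p}` -/

section Taylor

variable {V : Type*} [AddCommGroup V] [Module ℝ V]
variable {W : Type*} [NormedAddCommGroup W] [NormedSpace ℂ W] {n : ℕ}

/-- The partial derivative `∂/∂z_i` in the coordinates given by the basis `b`. -/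
def partialZ (b : Basis (Fin n) ℝ V) (i : Fin n) (f : Cplx V → W) : Cplx V → W :=
  fun z => deriv (fun s : ℂ => f (z + s ⊗ₜ[ℝ] b i)) 0

/-- `∂^p = ∂^{s(p)} / (∂z_1^{p_1} ⋯ ∂z_n^{p_n})`. -/
def partialPow (b : Basis (Fin n) ℝ V) (p : Fin n → ℕ) (f : Cplx V → W) : Cplx V → W :=
  (List.finRange n).foldr (fun i g => (partialZ b i)^[p i] g) f

/-- Formal Laurent series `∑ h_j T^j`, `j ∈ ℤⁿ`, whose coefficients are functions on the upper half
plane, given by the family of their coefficients. -/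
abbrev FormalSeries (n : ℕ) (W : Type*) : Type _ := (Fin n → ℤ) → ℍ → W

/-- The derivative `d/dτ`. -/
def derivTau (h : ℍ → W) : ℍ → W :=
  fun τ => deriv (fun z : ℂ => h (UpperHalfPlane.ofComplex z)) τ

/-- The formal series of the Taylor expansion of `z ↦ φ(τ, z)` about `z = 0` in the coordinates
given by `b`; its `j`-th coefficient is `∂^j φ(τ, 0) / j!` for `j ≥ 0`, and zero otherwise. -/
def taylorSeries (b : Basis (Fin n) ℝ V) (φ : ℍ → Cplx V → W) : FormalSeries n W :=
  fun j τ => if ∀ i, 0 ≤ j i then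
    ((∏ i, (j i).toNat.factorial : ℕ) : ℂ)⁻¹ • partialPow b (fun i => (j i).toNat) (φ τ) 0
  else 0

namespace FormalSeries

/-- Multiplication by `T^p`. -/
def shift (p : Fin n → ℤ) (h : FormalSeries n W) : FormalSeries n W := fun j => h (j - p)

/-- The modified heat operator `L_k`, `k = κ / 2`, for the Gram matrix `A`: its `p`-th coefficient
is `s(p) (s(p) + 2k - 2) h_p - 4πi ∑_{i,j} a_{ij} d/dτ h_{p - e_i - e_j}`. -/
def heat (A : Matrix (Fin n) (Fin n) ℝ) (κ : ℤ) (h : FormalSeries n W) : FormalSeries n W :=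
  fun p τ => (((∑ i, p i) * ((∑ i, p i) + κ - 2) : ℤ) : ℂ) • h p τ
    - (4 * Real.pi * Complex.I : ℂ) •
      ∑ i, ∑ j, (A i j : ℂ) • derivTau (h (p - Pi.single i 1 - Pi.single j 1)) τ

/-- The composition `T^{-p_{l-1}} ∘ L_{k+2(l-1)} ∘ ⋯ ∘ T^{-p_1} ∘ L_{k+2} ∘ T^{-p_0} ∘ L_k` for
a list `[p_0, …, p_{l-1}]`. -/
def raise (A : Matrix (Fin n) (Fin n) ℝ) :
    ℤ → List (Fin n → ℤ) → FormalSeries n W → FormalSeries n W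
  | _, [], h => h
  | κ, p :: ps, h => raise A (κ + 4) ps (shift (-p) (heat A κ h))

/-- The part of the series with `s(j) ≡ s (mod 2)`. -/
def parityPart (s : ℤ) (h : FormalSeries n W) : FormalSeries n W :=
  fun j => if (∑ i, j i) ≡ s [ZMOD 2] then h j else 0

/-- The vector `(1, 0, …, 0)`. -/
def firstVec (n : ℕ) : Fin n → ℤ := fun i => if i.val = 0 then 1 else 0

/-- A list `[p_0, …, p_{l-1}]` with sum `p` and length `l ≥ 1`, such that `s(p_i) = 2` for all `i`
if `s(p) = 2l` (and `n ≥ 1`). -/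
def splitting (p : Fin n → ℤ) (l : ℕ) : List (Fin n → ℤ) :=
  (p - (2 * (l - 1 : ℤ)) • firstVec n) :: List.replicate (l - 1) ((2 : ℤ) • firstVec n)

/-- The composition in `raise`, preceded by `T^{-a}`, depends only on `s(a)` and the sum of all
vectors, as long as all vectors of the list have `s(p_i) = 2`. -/
theorem raise_shift_congr (A : Matrix (Fin n) (Fin n) ℝ) :
    ∀ (ps ps' : List (Fin n → ℤ)) (κ : ℤ) (a a' : Fin n → ℤ) (h : FormalSeries n W),
      (∀ q ∈ ps, ∑ i, q i = 2) → (∀ q ∈ ps', ∑ i, q i = 2) → ∑ i, a i = ∑ i, a' i →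
      a + ps.sum = a' + ps'.sum →
      raise A κ ps (shift (-a) h) = raise A κ ps' (shift (-a') h) := by
  have comm : ∀ (κ : ℤ) (a p : Fin n → ℤ) (h : FormalSeries n W),
      shift (-p) (heat A κ (shift (-a) h)) = shift (-(a + p)) (fun q τ =>
        ((((∑ i, q i) - ∑ i, a i) * ((∑ i, q i) - (∑ i, a i) + κ - 2) : ℤ) : ℂ) • h q τ
        - (4 * Real.pi * Complex.I : ℂ) •
          ∑ i, ∑ j, (A i j : ℂ) • derivTau (h (q - Pi.single i 1 - Pi.single j 1)) τ) := by
    intro κ a p h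
    funext q τ
    have h1 : q - -p - -a = q - -(a + p) := by abel
    have h2 : ∀ i j : Fin n, q - -p - Pi.single i 1 - Pi.single j 1 - -a
        = q - -(a + p) - Pi.single i 1 - Pi.single j 1 := fun i j => by abel
    have h3 : (∑ i, (q - -p) i) = (∑ i, (q - -(a + p)) i) - ∑ i, a i := by
      simp [Finset.sum_add_distrib]
      ring
    simp only [shift, heat, h1, h2, h3]
  have nonpos : ∀ (ps : List (Fin n → ℤ)), (∀ q ∈ ps, ∑ i, q i = 2) →
      ∑ i, ps.sum i = 2 * ps.length := by
    intro ps
    induction ps with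
    | nil => intro _; simp
    | cons p ps ih =>
      intro hps
      have h1 := hps p (by simp)
      have h2 := ih fun q hq => hps q (by simp [hq])
      simp only [List.sum_cons, Pi.add_apply, Finset.sum_add_distrib, List.length_cons, h1, h2]
      push_cast
      ring
  intro ps
  induction ps with
  | nil =>
    intro ps' κ a a' h _ hps' ha hsum
    have h1 := congrArg (fun x : Fin n → ℤ => ∑ i, x i) hsum
    simp only [List.sum_nil, Pi.add_apply, Pi.zero_apply, Finset.sum_const_zero, Finset.sum_add_distrib, nonpos ps' hps',
      ha] at h1
    have h2 : ps' = [] := List.eq_nil_of_length_eq_zero (by omega)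
    subst h2
    simp only [List.sum_nil, add_zero] at hsum
    rw [hsum]
  | cons p ps ih =>
    intro ps' κ a a' h hps hps' ha hsum
    cases ps' with
    | nil =>
      have h1 := congrArg (fun x : Fin n → ℤ => ∑ i, x i) hsum
      simp only [List.sum_nil, Pi.add_apply, Pi.zero_apply, Finset.sum_const_zero, Finset.sum_add_distrib, nonpos _ hps,
        ha, List.length_cons] at h1
      omega
    | cons p' ps' =>
      simp only [raise]
      rw [comm, comm, ha]
      refine ih ps' _ _ _ _ (fun q hq => hps q (by simp [hq]))
        (fun q hq => hps' q (by simp [hq])) ?_ ?_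
      · simp only [Pi.add_apply, Finset.sum_add_distrib, ha, hps p (by simp),
          hps' p' (by simp)]
      · simpa [add_assoc] using hsum

theorem sum_firstVec (hn : 0 < n) : ∑ i, firstVec n i = 1 := by
  rw [Finset.sum_eq_single (⟨0, hn⟩ : Fin n)]
  · simp [firstVec]
  · intro i _ hi
    have : i.val ≠ 0 := fun h => hi (Fin.ext h)
    simp [firstVec, this]
  · simp

theorem splitting_sum (p : Fin n → ℤ) {l : ℕ} (hl : 1 ≤ l) : (splitting p l).sum = p := by
  obtain ⟨m, rfl⟩ : ∃ m, l = m + 1 := ⟨l - 1, by omega⟩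
  simp only [splitting, List.sum_cons, List.sum_replicate, Nat.add_sub_cancel]
  funext i
  simp
  ring

theorem splitting_mem (hn : 0 < n) (p : Fin n → ℤ) {l : ℕ} (_ : 1 ≤ l)
    (hp : ∑ i, p i = 2 * l) : ∀ q ∈ splitting p l, ∑ i, q i = 2 := by
  intro q hq
  simp only [splitting, List.mem_cons, List.mem_replicate] at hq
  rcases hq with rfl | ⟨_, rfl⟩
  · simp only [Pi.sub_apply, Pi.smul_apply, smul_eq_mul, Finset.sum_sub_distrib,
      ← Finset.mul_sum, sum_firstVec hn, hp]
    ring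
  · simp only [Pi.smul_apply, smul_eq_mul, ← Finset.mul_sum, sum_firstVec hn]
    ring

/-- The operator `𝒟_{k,p}`, `k = κ / 2`, on formal series. If `s(p) ≤ 1` it is `T^{-p}`; if
`s(p) = 2l ≥ 2` it is `T^{-p_{l-1}} L_{k+2(l-1)} ⋯ T^{-p_0} L_k` where `p = ∑ p_i` with
`s(p_i) = 2`; if `s(p) = 2l + 1 ≥ 3` it is `T^{-p_{l-1}} L_{k+1+2(l-1)} ⋯ T^{-p_0} L_{k+1} T^{-p'}`
where `p = p' + ∑ p_i` with `s(p') = 1` and `s(p_i) = 2`. The result does not depend on the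
choice of the vectors, see `raise_shift_congr`. -/
def raiseOp (A : Matrix (Fin n) (Fin n) ℝ) (κ : ℤ) (p : Fin n → ℕ) (h : FormalSeries n W) :
    FormalSeries n W :=
  let q : Fin n → ℤ := fun i => (p i : ℤ)
  let s : ℕ := ∑ i, p i
  if s ≤ 1 then shift (-q) h
  else if Even s then raise A κ (splitting q (s / 2)) h
  else raise A (κ + 2) (splitting (q - firstVec n) (s / 2)) (shift (-firstVec n) h)

end FormalSeries

/-- The operator `D_{k,p}`, `k = κ / 2`, on functions on `ℍ × (V ⊕ iV)`: the constant term of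
`𝒟_{k,p}` applied to the part of the Taylor series with `s(j) ≡ s(p) (mod 2)`. -/
def taylorD (Λ : IntegralLattice V) (b : Basis (Fin n) ℝ V) (κ : ℤ) (p : Fin n → ℕ)
    (φ : ℍ → Cplx V → W) : ℍ → W :=
  (FormalSeries.raiseOp (Matrix.of fun i j => Λ.form (b i) (b j)) κ p
    (FormalSeries.parityPart (∑ i, (p i : ℤ)) (taylorSeries b φ))) 0

end Taylor

/-! ### Theta series and the determinant -/

section Theta

variable {V : Type*} [AddCommGroup V] [Module ℝ V] {n d : ℕ}

/-- The Jacobi theta series `ϑ_{L,t}(τ, z) = ∑_{v ∈ t + L} e(τ Q(v) + B(v, z))`. -/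
def latticeTheta (Λ : IntegralLattice V) (t : V) (τ : ℍ) (z : Cplx V) : ℂ :=
  ∑' v : Λ.lattice, eexp (τ * (Λ.Q (t + v) : ℂ) + Λ.formC ((1 : ℂ) ⊗ₜ[ℝ] (t + v)) z)

/-- The determinant of the matrix with entries `(2πi)^{-s(p_i)} ∂^{p_i} ϑ_{L,t_j}(τ, 0)`. -/
def thetaDet (Λ : IntegralLattice V) (b : Basis (Fin n) ℝ V) (p : Fin d → Fin n → ℕ)
    (t : Fin d → Λ.dual) (τ : ℍ) : ℂ :=
  Matrix.det (Matrix.of fun i j : Fin d =>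
    ((2 * Real.pi * Complex.I : ℂ) ^ (∑ l, p i l))⁻¹ *
      partialPow b (p i) (latticeTheta Λ (t j) τ) 0)

/-- The closure of `P` under `≼`, where `p ≼ p'` means that `p ≤ p'` in each component and
`s(p) ≡ s(p') (mod 2)`. -/
def precClosure (P : Set (Fin n → ℕ)) : Set (Fin n → ℕ) :=
  {p | ∃ p' ∈ P, p ≤ p' ∧ (∑ i, p i) ≡ (∑ i, p' i) [MOD 2]}

end Theta

end

noncomputable section

/-! ### Sums of exponentials -/

/-! Modularity. For γ over (a, b; c, d), slashing φ by γ replaces z by z/(cτ+d) in its Taylor series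
and multiplies by exp(-πi c/(cτ+d) ∑ a_{ij} z_i z_j), so the Taylor coefficients mix with those of
lower degree. `FormalSeries.fslash` is this action on formal series, and `taylorSeries_jacobiSlash`
identifies it. The heat operator commutes with the action in its own weight
(`FormalSeries.heat_fslash`). Multiplication by T^{-r} raises the weight by s(r), provided that no
terms of negative degree appear (`FormalSeries.shift_fslash`). The degree 0 part of L_k h vanishes
because of the factor s(p), so dividing by T^r with s(r) = 2 after each L_k keeps an even series in
degrees ≥ 0. On the constant term of such a series the action is the ordinary slash operator. Hence
D_{k,p}(φ|γ) = (D_{k,p}φ)|γ in weight k + s(p) (`JacobiSum.taylorD_jacobiSlash`).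

Cusps. Fourier expansions with real frequencies may be differentiated term by term, so D_{k,p} sends
e(nτ + B(t,z)) to a constant times q^n (`JacobiSum.tauSum_taylorD`), and bounds on n survive. For a
Jacobi form n ≥ Q(t) ≥ 0, so n = 0 forces t = 0; there φ contributes a constant, which D_{k,p}
annihilates for p ≠ 0 (`taylorDCoeff_zero`). This gives cusp forms.

Injectivity. D_{k,p}φ is a multiple of h_p plus derivatives of h_q with q strictly below p of the
same parity. The multiple is a product of numbers s(s+2k-2), nonzero as k is not 0, -1, -2, …. If
all D_{k,p}φ with p in the closure of the index set vanish, then so do all these h_p, by induction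
on s(p) (`taylorSeries_eq_zero_of_taylorD`). For fixed τ, invariance under the lattice translations
gives φ(τ,·) = ∑ β_j ϑ_{L,t_j}(τ,·) (`ZSum.exists_periodic`, `hasSum_cosets`). Applying ∂^{p_i} at z
= 0 gives a linear system for β whose determinant is `thetaDet`; where it is nonzero, φ(τ,·) = 0.
These τ form a nonempty open set, and the identity theorem in τ finishes the proof
(`eq_zero_of_taylorD_eq_zero`). -/

theorem eexp_add (z w : ℂ) : eexp (z + w) = eexp z * eexp w := by
  simp [eexp, mul_add, Complex.exp_add]

@[simp] theorem eexp_zero : eexp 0 = 1 := by simp [eexp]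

theorem eexp_ne_zero (z : ℂ) : eexp z ≠ 0 := Complex.exp_ne_zero _

theorem eexp_sum {ι : Type*} (s : Finset ι) (f : ι → ℂ) :
    eexp (∑ i ∈ s, f i) = ∏ i ∈ s, eexp (f i) := by
  simp [eexp, Finset.mul_sum, Complex.exp_sum]

theorem norm_eexp (z : ℂ) : ‖eexp z‖ = Real.exp (-(2 * Real.pi * z.im)) := by
  rw [eexp, Complex.norm_exp]
  congr 1
  simp [Complex.mul_re, Complex.mul_im]

theorem eexp_eq_one_iff (r : ℝ) : eexp r = 1 ↔ ∃ m : ℤ, r = m := by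
  rw [eexp, Complex.exp_eq_one_iff]
  have h : (2 * Real.pi * Complex.I : ℂ) ≠ 0 := Complex.two_pi_I_ne_zero
  constructor
  · rintro ⟨m, hm⟩
    refine ⟨m, ?_⟩
    rw [mul_comm] at hm
    exact_mod_cast mul_right_cancel₀ h hm
  · rintro ⟨m, rfl⟩
    exact ⟨m, by push_cast; ring⟩

theorem hasDerivAt_eexp_mul (r z : ℂ) :
    HasDerivAt (fun s : ℂ => eexp (r * s)) (2 * Real.pi * Complex.I * r * eexp (r * z)) z := by
  have h := ((hasDerivAt_id z).const_mul (2 * Real.pi * Complex.I * r : ℂ)).cexp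
  simp only [id, mul_one, mul_assoc] at h
  simpa only [eexp, mul_assoc, mul_comm, mul_left_comm] using h

section ExpSum

variable {W : Type*} [NormedAddCommGroup W] [NormedSpace ℂ W] [FiniteDimensional ℂ W]

/-- In finite dimension unconditional convergence is absolute convergence. The Fourier expansions
are given only as `HasSum`, and this supplies the majorants for differentiating and rearranging
them. -/
theorem Summable.norm_of_finiteDimensional {X : Type*} {f : X → W} (h : Summable f) :
    Summable fun x => ‖f x‖ := by
  let : NormedSpace ℝ W := NormedSpace.restrictScalars ℝ ℂ W
  have : IsScalarTower ℝ ℂ W := by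
    exact RestrictScalars.isScalarTower ℝ ℂ W
  have : FiniteDimensional ℝ W := Module.Finite.trans ℂ W
  exact summable_norm_iff.2 h

/-- A sum of exponentials with real frequencies can be differentiated term by term. -/
theorem hasDerivAt_of_hasSum_eexp {X : Type*} {r : X → ℝ} {a : X → W} {f : ℂ → W} {δ : ℝ}
    (hδ : 0 < δ)
    (h : ∀ s : ℂ, ‖s‖ ≤ δ → HasSum (fun x => eexp (r x * s) • a x) (f s)) :
    HasSum (fun x => (2 * Real.pi * Complex.I * r x : ℂ) • a x) (deriv f 0) ∧
      DifferentiableAt ℂ f 0 := by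
  have := FiniteDimensional.complete ℂ W
  have h1 : Summable fun x => ‖eexp (r x * (δ * Complex.I)) • a x‖ :=
    (h (δ * Complex.I) (by simp [abs_of_pos hδ])).summable.norm_of_finiteDimensional
  have h2 : Summable fun x => ‖eexp (r x * (-δ * Complex.I)) • a x‖ :=
    (h (-δ * Complex.I) (by simp [abs_of_pos hδ])).summable.norm_of_finiteDimensional
  have hd : ∀ x, DifferentiableOn ℂ (fun s : ℂ => eexp (r x * s) • a x) (Metric.ball 0 δ) :=
    fun x s _ => (((hasDerivAt_eexp_mul (r x) s).smul_const
      (a x)).differentiableAt).differentiableWithinAt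
  -- Since the frequency r is real, |e(rs)| depends only on Im s and is monotone in it. On the disc
  -- it is at most the sum of its values at ±iδ, so convergence at these two points gives a uniform
  -- majorant.
  have hb : ∀ x, ∀ s ∈ Metric.ball (0 : ℂ) δ, ‖eexp (r x * s) • a x‖ ≤
      ‖eexp (r x * (δ * Complex.I)) • a x‖ + ‖eexp (r x * (-δ * Complex.I)) • a x‖ := by
    intro x s hs
    simp only [norm_smul, ← add_mul]
    refine mul_le_mul_of_nonneg_right ?_ (norm_nonneg _)
    have hs' : |s.im| ≤ δ := (Complex.abs_im_le_norm s).trans (by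
      simpa using (Metric.mem_ball.1 hs).le)
    have hs1 := abs_le.1 hs'
    simp only [norm_eexp, Complex.mul_im, Complex.ofReal_re, Complex.ofReal_im, zero_mul, add_zero,
      Complex.I_im, Complex.I_re, mul_one, mul_zero, Complex.neg_re]
    have hpi := Real.pi_pos
    rcases le_total 0 (r x) with hr | hr
    · refine le_add_of_nonneg_of_le (Real.exp_nonneg _) (Real.exp_le_exp.2 ?_)
      nlinarith [mul_nonneg hpi.le (mul_nonneg hr (by linarith : 0 ≤ s.im + δ))]
    · refine le_add_of_le_of_nonneg (Real.exp_le_exp.2 ?_) (Real.exp_nonneg _)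
      nlinarith [mul_nonneg hpi.le (mul_nonneg (neg_nonneg.2 hr) (by linarith : 0 ≤ δ - s.im))]
  have h0 : (0 : ℂ) ∈ Metric.ball (0 : ℂ) δ := by simpa using hδ
  have hev : f =ᶠ[nhds 0] fun s => ∑' x, eexp (r x * s) • a x := by
    filter_upwards [Metric.ball_mem_nhds (0 : ℂ) hδ] with s hs
    exact (h s (by simpa using (Metric.mem_ball.1 hs).le)).tsum_eq.symm
  refine ⟨?_, ?_⟩
  · have := Complex.hasSum_deriv_of_summable_norm (h1.add h2) hd Metric.isOpen_ball hb h0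
    rw [hev.deriv_eq]
    convert this using 2 with x
    rw [((hasDerivAt_eexp_mul (r x) 0).smul_const (a x)).deriv]
    simp
  · have := Complex.differentiableOn_tsum_of_summable_norm (h1.add h2) hd Metric.isOpen_ball hb
    exact (this.differentiableAt (Metric.isOpen_ball.mem_nhds h0)).congr_of_eventuallyEq hev

/-- `h(τ) = ∑ a_x e(ν_x τ)`. -/
def TauSum {X : Type*} (ν : X → ℝ) (a : X → W) (h : ℍ → W) : Prop :=
  ∀ τ : ℍ, HasSum (fun x => eexp (ν x * τ) • a x) (h τ)

theorem ofComplex_add_of_norm_le (τ : ℍ) {s : ℂ} (hs : ‖s‖ ≤ τ.im / 2) :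
    ((UpperHalfPlane.ofComplex ((τ : ℂ) + s) : ℍ) : ℂ) = τ + s := by
  have h1 := (Complex.abs_im_le_norm s).trans hs
  have h2 := τ.im_pos
  have h3 := (abs_le.1 h1).1
  have h4 : 0 < ((τ : ℂ) + s).im := by
    rw [Complex.add_im]
    change 0 < τ.im + s.im
    linarith
  rw [UpperHalfPlane.ofComplex_apply_of_im_pos h4]

/-- Holomorphy in τ comes from the convergent expansion itself: absorbing e(ντ) into the
coefficients reduces to differentiation at 0 in the displacement s. -/
theorem TauSum.hasSum_derivTau {X : Type*} {ν : X → ℝ} {a : X → W} {h : ℍ → W}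
    (H : TauSum ν a h) :
    TauSum ν (fun x => (2 * Real.pi * Complex.I * ν x : ℂ) • a x) (derivTau h) ∧ IsHolMod h := by
  have key : ∀ τ : ℍ,
      HasSum (fun x => (2 * Real.pi * Complex.I * ν x : ℂ) • (eexp (ν x * τ) • a x))
        (deriv (fun s : ℂ => h (UpperHalfPlane.ofComplex ((τ : ℂ) + s))) 0) ∧
      DifferentiableAt ℂ (fun s : ℂ => h (UpperHalfPlane.ofComplex ((τ : ℂ) + s))) 0 := by
    intro τ
    -- The radius Im(τ)/2 keeps τ + s inside the upper half plane, where `ofComplex` is the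
    -- identity.
    refine hasDerivAt_of_hasSum_eexp (half_pos τ.im_pos) fun s hs => ?_
    have := H (UpperHalfPlane.ofComplex ((τ : ℂ) + s))
    rw [ofComplex_add_of_norm_le τ hs] at this
    convert this using 2 with x
    rw [smul_smul, mul_add, eexp_add, mul_comm]
  refine ⟨fun τ => ?_, fun z hz => ?_⟩
  · have h1 := (key τ).1
    rw [derivTau]
    have h2 := deriv_comp_const_add (fun z => h (UpperHalfPlane.ofComplex z)) (τ : ℂ) 0
    rw [add_zero] at h2
    rw [← h2]
    convert h1 using 2 with x
    rw [smul_smul, smul_smul, mul_comm]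
  · have h1 := (key ⟨z, hz⟩).2
    have h2 : DifferentiableAt ℂ (fun w : ℂ => h (UpperHalfPlane.ofComplex w)) z := by
      have h3 : DifferentiableAt ℂ (fun w : ℂ => w - z) z := by fun_prop
      have h4 := DifferentiableAt.comp (g := fun s : ℂ => h (UpperHalfPlane.ofComplex (z + s))) z
        (by simpa using h1) h3
      have h5 : (fun w : ℂ => h (UpperHalfPlane.ofComplex w)) =
          (fun s : ℂ => h (UpperHalfPlane.ofComplex (z + s))) ∘ fun w => w - z := by
        funext w
        simp
      rwa [h5]
    exact h2.differentiableWithinAt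

theorem TauSum.derivTau {X : Type*} {ν : X → ℝ} {a : X → W} {h : ℍ → W} (H : TauSum ν a h) :
    TauSum ν (fun x => (2 * Real.pi * Complex.I * ν x : ℂ) • a x) (derivTau h) :=
  H.hasSum_derivTau.1

theorem TauSum.isHolMod {X : Type*} {ν : X → ℝ} {a : X → W} {h : ℍ → W} (H : TauSum ν a h) :
    IsHolMod h :=
  H.hasSum_derivTau.2

variable {V : Type*} [AddCommGroup V] [Module ℝ V] {n : ℕ} (Λ : IntegralLattice V)

/-- `f(z) = ∑ a_x e(B(t_x, z))`. -/
def ZSum {X : Type*} (t : X → V) (a : X → W) (f : Cplx V → W) : Prop :=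
  ∀ z : Cplx V, HasSum (fun x => eexp (Λ.formC ((1 : ℂ) ⊗ₜ[ℝ] t x) z) • a x) (f z)

variable {Λ}

@[simp] theorem formC_tmul (x y : V) (c d : ℂ) :
    Λ.formC (c ⊗ₜ[ℝ] x) (d ⊗ₜ[ℝ] y) = c * d * (Λ.form x y : ℂ) := by
  simp [IntegralLattice.formC, LinearMap.BilinForm.baseChange_tmul, mul_comm]

theorem ZSum.partialZ {X : Type*} {t : X → V} {a : X → W} {f : Cplx V → W} (H : ZSum Λ t a f)
    (b : Basis (Fin n) ℝ V) (i : Fin n) :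
    ZSum Λ t (fun x => (2 * Real.pi * Complex.I * Λ.form (t x) (b i) : ℂ) • a x)
      (partialZ b i f) := by
  intro z
  have h := (hasDerivAt_of_hasSum_eexp (r := fun x => Λ.form (t x) (b i))
    (a := fun x => eexp (Λ.formC ((1 : ℂ) ⊗ₜ[ℝ] t x) z) • a x)
    (f := fun s : ℂ => f (z + s ⊗ₜ[ℝ] b i)) one_pos fun s _ => by
      have := H (z + s ⊗ₜ[ℝ] b i)
      simp only [map_add, formC_tmul, one_mul, eexp_add] at this
      convert this using 2 with x
      rw [smul_smul]
      congr 1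
      ring_nf).1
  simpa only [smul_smul, mul_comm, _root_.partialZ] using h

theorem ZSum.iterate_partialZ {X : Type*} {t : X → V} {a : X → W} {f : Cplx V → W}
    (H : ZSum Λ t a f) (b : Basis (Fin n) ℝ V) (i : Fin n) (m : ℕ) :
    ZSum Λ t (fun x => (2 * Real.pi * Complex.I * Λ.form (t x) (b i) : ℂ) ^ m • a x)
      ((_root_.partialZ b i)^[m] f) := by
  induction m with
  | zero => simpa using H
  | succ m ih =>
    rw [Function.iterate_succ_apply']
    simpa only [smul_smul, pow_succ'] using ih.partialZ b i

theorem ZSum.partialPow {X : Type*} {t : X → V} {a : X → W} {f : Cplx V → W}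
    (H : ZSum Λ t a f) (b : Basis (Fin n) ℝ V) (p : Fin n → ℕ) :
    ZSum Λ t (fun x => (∏ i, (2 * Real.pi * Complex.I * Λ.form (t x) (b i) : ℂ) ^ p i) • a x)
      (partialPow b p f) := by
  have key : ∀ l : List (Fin n),
      ZSum Λ t (fun x =>
        (l.map fun i => (2 * Real.pi * Complex.I * Λ.form (t x) (b i) : ℂ) ^ p i).prod • a x)
        (l.foldr (fun i g => (_root_.partialZ b i)^[p i] g) f) := by
    intro l
    induction l with
    | nil => simpa using H
    | cons i l ih =>
      simpa only [List.map_cons, List.prod_cons, List.foldr_cons, smul_smul] using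
        ih.iterate_partialZ b i (p i)
  have := key (List.finRange n)
  simp only [← List.ofFn_eq_map, List.prod_ofFn] at this
  exact this

theorem ZSum.partialPow_zero {X : Type*} {t : X → V} {a : X → W} {f : Cplx V → W}
    (H : ZSum Λ t a f) (b : Basis (Fin n) ℝ V) (p : Fin n → ℕ) :
    HasSum (fun x => (∏ i, (2 * Real.pi * Complex.I * Λ.form (t x) (b i) : ℂ) ^ p i) • a x)
      (_root_.partialPow b p f 0) := by
  simpa using H.partialPow b p 0

end ExpSum

/-! ### Uniqueness of Fourier coefficients -/

theorem mFourier_coe_eq_prod_eexp {n : ℕ} (m : Fin n → ℤ) (y : Fin n → ℝ) :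
    UnitAddTorus.mFourier m (fun i => (y i : UnitAddCircle)) = ∏ i, eexp (m i * y i) := by
  simp only [UnitAddTorus.mFourier, ContinuousMap.coe_mk]
  refine Finset.prod_congr rfl fun i _ => ?_
  rw [fourier_coe_apply, eexp]
  congr 1
  push_cast
  ring

/-- At y = 0 the coefficients are seen to be absolutely summable, so the series converges uniformly
on the torus, hence in L². Pairing with the orthonormal monomials isolates each coefficient. -/
theorem eq_zero_of_hasSum_prod_eexp_complex {X : Type*} {n : ℕ} {m : X → Fin n → ℤ}
    (hm : Function.Injective m) {a : X → ℂ}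
    (h : ∀ y : Fin n → ℝ, HasSum (fun x => (∏ i, eexp (m x i * y i)) * a x) 0) : a = 0 := by
  let _ : MeasureTheory.MeasureSpace UnitAddCircle := ⟨AddCircle.haarAddCircle⟩
  have : MeasureTheory.IsProbabilityMeasure (MeasureTheory.volume : MeasureTheory.Measure UnitAddCircle) :=
    inferInstanceAs (MeasureTheory.IsProbabilityMeasure AddCircle.haarAddCircle)
  have hs : Summable fun x => ‖a x‖ := by
    have := (h 0).summable.norm_of_finiteDimensional
    simpa using this
  have hs' : Summable fun x => a x • UnitAddTorus.mFourier (m x) :=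
    Summable.of_norm (by simpa [norm_smul, UnitAddTorus.mFourier_norm] using hs)
  have h0 : ∑' x, a x • UnitAddTorus.mFourier (m x) = 0 := by
    ext θ
    obtain ⟨y, hy⟩ : ∃ y : Fin n → ℝ, (fun i => (y i : UnitAddCircle)) = θ := by
      choose y hy using fun i => QuotientAddGroup.mk_surjective (θ i)
      exact ⟨y, funext hy⟩
    have h1 := (ContinuousMap.evalCLM ℂ θ).hasSum hs'.hasSum
    have h2 := h y
    simp only [← mFourier_coe_eq_prod_eexp, hy] at h2
    refine h1.unique ?_
    simpa [mul_comm] using h2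
  have hsum : HasSum (fun x => a x • UnitAddTorus.mFourier (m x)) 0 := h0 ▸ hs'.hasSum
  have hL := (ContinuousMap.toLp (E := ℂ) 2 MeasureTheory.volume ℂ).hasSum hsum
  simp only [map_zero] at hL
  have ho := (UnitAddTorus.orthonormal_mFourier (d := Fin n)).comp m hm
  funext x
  have hi := hL.mapL (innerSL ℂ (UnitAddTorus.mFourierLp 2 (m x)))
  simp only [map_zero] at hi
  have h3 := hi.unique (hasSum_single x fun y hy => ?_)
  · have h4 := ho.1 x
    have h5 : (ContinuousMap.toLp (E := ℂ) 2 MeasureTheory.volume ℂ) (a x • UnitAddTorus.mFourier (m x))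
      = a x • UnitAddTorus.mFourierLp 2 (m x) := by
      rw [map_smul]
    simp only [Function.comp] at h3 h4
    rw [h5, innerSL_apply_apply, inner_smul_right, inner_self_eq_norm_sq_to_K, h4] at h3
    simpa using h3.symm
  · have h5 : (ContinuousMap.toLp (E := ℂ) 2 MeasureTheory.volume ℂ) (a y • UnitAddTorus.mFourier (m y))
      = a y • UnitAddTorus.mFourierLp 2 (m y) := by
      rw [map_smul]
    rw [h5, innerSL_apply_apply, inner_smul_right]
    have := ho.2 hy.symm
    simp only [Function.comp] at this
    rw [this, mul_zero]

theorem eq_zero_of_hasSum_prod_eexp {W : Type*} [NormedAddCommGroup W] [NormedSpace ℂ W]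
    {X : Type*} {n : ℕ} {m : X → Fin n → ℤ}
    (hm : Function.Injective m) {a : X → W}
    (h : ∀ y : Fin n → ℝ, HasSum (fun x => (∏ i, eexp (m x i * y i)) • a x) 0) : a = 0 := by
  funext x
  refine SeparatingDual.eq_zero_of_forall_dual_eq_zero (R := ℂ) fun ℓ => ?_
  refine congrFun (eq_zero_of_hasSum_prod_eexp_complex hm (a := fun x => ℓ (a x)) fun y => ?_) x
  simpa using ℓ.hasSum (h y)

variable {V : Type*} [AddCommGroup V] [Module ℝ V] {Λ : IntegralLattice V}

theorem mem_dual_iff {x : V} : x ∈ Λ.dual ↔ ∀ y ∈ Λ.lattice, ∃ m : ℤ, Λ.form x y = m := by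
  simp only [IntegralLattice.dual, LinearMap.BilinForm.mem_dualSubmodule, Submodule.mem_one,
    eq_intCast]
  exact ⟨fun h y hy => (h y hy).imp fun _ h => h.symm, fun h y hy => (h y hy).imp fun _ h => h.symm⟩

theorem form_eq_zero_iff {x : V} : Λ.form x x = 0 ↔ x = 0 :=
  ⟨fun h => by_contra fun hx => (Λ.posDef x hx).ne' h, fun h => by simp [h]⟩

/-- Along the real span of a basis of L, rescaled by N, the exponentials become characters of a
torus. Distinct t give distinct characters because B is nondegenerate, so uniqueness of Fourier
coefficients applies. -/
theorem eq_zero_of_zsum_zero {W : Type*} [NormedAddCommGroup W] [NormedSpace ℂ W]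
    {X : Type*} {N : ℕ} (hN : 0 < N) {t : X → V} (ht : Function.Injective t) {a : X → W}
    (hd : ∀ x, a x ≠ 0 → N • t x ∈ Λ.dual)
    (h : ZSum Λ t a 0) : a = 0 := by
  obtain ⟨n, v, hv⟩ := Λ.exists_basis
  have hvm : ∀ i, v i ∈ Λ.lattice := fun i => hv ▸ Submodule.subset_span ⟨i, rfl⟩
  -- The frequencies are known to be integral only where the coefficient is nonzero, so the sum is
  -- restricted to its support.
  let S := {x // a x ≠ 0}
  choose m hm using fun (x : S) (i : Fin n) => mem_dual_iff.1 (hd x.1 x.2) (v i) (hvm i)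
  have hinj : Function.Injective m := by
    intro x y hxy
    refine Subtype.ext (ht ?_)
    have h1 : ∀ i, Λ.form (N • t x.1 - N • t y.1) (v i) = 0 := fun i => by
      rw [map_sub, LinearMap.sub_apply, hm, hm, hxy, sub_self]
    have h2 : Λ.form (N • t x.1 - N • t y.1) = 0 := v.ext fun i => by simpa using h1 i
    have h3 : N • t x.1 - N • t y.1 = 0 := form_eq_zero_iff.1 (by rw [h2]; rfl)
    rw [← smul_sub, ← Nat.cast_smul_eq_nsmul ℝ] at h3
    rcases smul_eq_zero.1 h3 with h4 | h4
    · exact absurd h4 (by exact_mod_cast hN.ne')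
    · exact sub_eq_zero.1 h4
  have h0 : (fun x : S => a x.1) = 0 := by
    refine eq_zero_of_hasSum_prod_eexp hinj fun y => ?_
    have h1 := h ((N : ℂ) • ∑ i, (y i : ℂ) ⊗ₜ[ℝ] v i)
    have h2 : Function.support (fun x => eexp (Λ.formC ((1 : ℂ) ⊗ₜ[ℝ] t x)
        ((N : ℂ) • ∑ i, (y i : ℂ) ⊗ₜ[ℝ] v i)) • a x) ⊆ {x | a x ≠ 0} := by
      intro x hx
      rw [Function.mem_support] at hx
      exact fun h => hx (by rw [h, smul_zero])
    rw [← hasSum_subtype_iff_of_support_subset h2] at h1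
    refine h1.congr_fun fun x => ?_
    simp only [Function.comp]
    rw [← eexp_sum]
    congr 2
    rw [map_smul, map_sum, smul_eq_mul, Finset.mul_sum]
    refine Finset.sum_congr rfl fun i _ => ?_
    have h3 := hm x i
    rw [map_nsmul, LinearMap.smul_apply, nsmul_eq_mul] at h3
    rw [formC_tmul, one_mul]
    have h4 : ((m x i : ℤ) : ℂ) = N * (Λ.form (t x.1) (v i) : ℂ) := by exact_mod_cast h3.symm
    rw [h4]
    ring
  funext x
  by_contra hx
  exact hx (congrFun h0 ⟨x, hx⟩)

/-! ### Derivatives of automorphy factors -/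

section Deriv

theorem eventually_ofComplex_coe (τ : ℍ) :
    ∀ᶠ z : ℂ in nhds (τ : ℂ), ((UpperHalfPlane.ofComplex z : ℍ) : ℂ) = z := by
  filter_upwards [UpperHalfPlane.isOpen_upperHalfPlaneSet.mem_nhds τ.im_pos] with z hz
  rw [UpperHalfPlane.ofComplex_apply_of_im_pos hz]

theorem hasDerivAt_jfac (γ : SL(2, ℤ)) (τ : ℍ) :
    HasDerivAt (fun z : ℂ => jfac γ (UpperHalfPlane.ofComplex z)) ((γ 1 0 : ℤ) : ℂ) τ := by
  have h : HasDerivAt (fun z : ℂ => ((γ 1 0 : ℤ) : ℂ) * z + ((γ 1 1 : ℤ) : ℂ))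
      ((γ 1 0 : ℤ) : ℂ) (τ : ℂ) := by
    simpa using ((hasDerivAt_id (τ : ℂ)).const_mul ((γ 1 0 : ℤ) : ℂ)).add_const ((γ 1 1 : ℤ) : ℂ)
  refine h.congr_of_eventuallyEq ?_
  filter_upwards [eventually_ofComplex_coe τ] with z hz
  rw [jfac, hz]

theorem continuousAt_ofComplex (τ : ℍ) :
    ContinuousAt (fun z : ℂ => (UpperHalfPlane.ofComplex z : ℍ)) (τ : ℂ) :=
  (UpperHalfPlane.contMDiffAt_ofComplex (n := 0) τ.im_pos).continuousAt

/-- The root is assumed only continuous. Differentiability follows by writing its slope as the slope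
of its square cτ+d divided by f(z) + f(τ), which tends to 2f(τ) ≠ 0. -/
theorem hasDerivAt_root (γ : Mp2Z) (τ : ℍ) :
    HasDerivAt (fun z : ℂ => γ.root (UpperHalfPlane.ofComplex z))
      (((γ.mat 1 0 : ℤ) : ℂ) / (2 * γ.root τ)) τ := by
  rw [hasDerivAt_iff_tendsto_slope]
  have hc : ContinuousAt (fun z : ℂ => γ.root (UpperHalfPlane.ofComplex z)) (τ : ℂ) :=
    γ.continuous_root.continuousAt.comp (continuousAt_ofComplex τ)
  have h0 : γ.root τ + γ.root τ ≠ 0 := by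
    rw [← two_mul]; exact mul_ne_zero two_ne_zero (γ.root_ne_zero τ)
  have hadd : ContinuousAt (fun z : ℂ => γ.root (UpperHalfPlane.ofComplex z) + γ.root τ) (τ : ℂ) :=
    hc.add continuousAt_const
  have hj := hasDerivAt_iff_tendsto_slope.1 (hasDerivAt_jfac γ.mat τ)
  have hlim := hj.div (hadd.tendsto.mono_left nhdsWithin_le_nhds)
    (by rw [UpperHalfPlane.ofComplex_apply]; exact h0)
  rw [UpperHalfPlane.ofComplex_apply, ← two_mul] at hlim
  refine hlim.congr' ?_
  have hne : ∀ᶠ z : ℂ in nhdsWithin (τ : ℂ) {(τ : ℂ)}ᶜ,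
      γ.root (UpperHalfPlane.ofComplex z) + γ.root τ ≠ 0 := by
    refine (hadd.eventually_ne ?_).filter_mono nhdsWithin_le_nhds
    rw [UpperHalfPlane.ofComplex_apply]; exact h0
  filter_upwards [hne] with z hz
  simp only [slope, vsub_eq_sub, smul_eq_mul, Pi.div_apply, UpperHalfPlane.ofComplex_apply]
  rw [← γ.root_sq, ← γ.root_sq, mul_div_assoc]
  congr 1
  rw [div_eq_iff hz]
  ring

theorem hasDerivAt_smul_coe (γ : SL(2, ℤ)) (τ : ℍ) :
    HasDerivAt (fun z : ℂ => ((γ • UpperHalfPlane.ofComplex z : ℍ) : ℂ))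
      (jfac γ τ ^ (-2 : ℤ)) τ := by
  have hj := hasDerivAt_jfac γ τ
  have hnum : HasDerivAt (fun z : ℂ => ((γ 0 0 : ℤ) : ℂ) * z + ((γ 0 1 : ℤ) : ℂ))
      ((γ 0 0 : ℤ) : ℂ) (τ : ℂ) := by
    simpa using ((hasDerivAt_id (τ : ℂ)).const_mul ((γ 0 0 : ℤ) : ℂ)).add_const ((γ 0 1 : ℤ) : ℂ)
  have h0 := jfac_ne_zero γ τ
  have h := hnum.div hj (by rwa [UpperHalfPlane.ofComplex_apply])
  rw [UpperHalfPlane.ofComplex_apply] at h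
  have hdet : ((γ 0 0 : ℤ) : ℂ) * ((γ 1 1 : ℤ) : ℂ) - ((γ 0 1 : ℤ) : ℂ) * ((γ 1 0 : ℤ) : ℂ) = 1 := by
    have := Matrix.det_fin_two γ.1
    rw [γ.2] at this
    exact_mod_cast this.symm
  refine (h.congr_of_eventuallyEq ?_).congr_deriv ?_
  · filter_upwards [eventually_ofComplex_coe τ] with z hz
    rw [UpperHalfPlane.coe_specialLinearGroup_apply]
    simp [jfac, hz]
  · rw [zpow_neg, eq_comm, zpow_ofNat, inv_eq_one_div]
    congr 1
    rw [jfac]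
    linear_combination -hdet

variable {W : Type*} [NormedAddCommGroup W] [NormedSpace ℂ W]

theorem IsHolMod.hasDerivAt {g : ℍ → W} (hg : IsHolMod g) (τ : ℍ) :
    HasDerivAt (fun z : ℂ => g (UpperHalfPlane.ofComplex z)) (derivTau g τ) τ :=
  ((hg.differentiableAt (UpperHalfPlane.isOpen_upperHalfPlaneSet.mem_nhds τ.im_pos))).hasDerivAt

/-- The term with m - κ/2 comes from the automorphy factors, which amount to (cτ+d)^{m-κ/2}; the
other comes from dγ(τ)/dτ = (cτ+d)^{-2}. -/
theorem hasDerivAt_modSlash (κ m : ℤ) (γ : Mp2Z) {g : ℍ → W} (hg : IsHolMod g) (τ : ℍ) :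
    HasDerivAt (fun z : ℂ => (γ.root (UpperHalfPlane.ofComplex z) ^ (-κ) *
        jfac γ.mat (UpperHalfPlane.ofComplex z) ^ m) • g (γ.mat • UpperHalfPlane.ofComplex z))
      (γ.root τ ^ (-κ) • (((m - κ / 2 : ℂ) * ((γ.mat 1 0 : ℤ) : ℂ) * jfac γ.mat τ ^ (m - 1)) •
        g (γ.mat • τ) + jfac γ.mat τ ^ (m - 2) • derivTau g (γ.mat • τ))) τ := by
  have h0 := jfac_ne_zero γ.mat τ
  have hr0 := γ.root_ne_zero τ
  have hr := (hasDerivAt_zpow (-κ) _ (Or.inl (by rwa [UpperHalfPlane.ofComplex_apply]))).comp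
    (τ : ℂ) (hasDerivAt_root γ τ)
  have hj := (hasDerivAt_zpow m _ (Or.inl (by rwa [UpperHalfPlane.ofComplex_apply]))).comp
    (τ : ℂ) (hasDerivAt_jfac γ.mat τ)
  have hg' : HasDerivAt (fun z : ℂ => g (γ.mat • UpperHalfPlane.ofComplex z))
      (jfac γ.mat τ ^ (-2 : ℤ) • derivTau g (γ.mat • τ)) τ := by
    have h1 := hg.hasDerivAt (γ.mat • τ)
    have h2 := HasDerivAt.scomp_of_eq (τ : ℂ) h1 (hasDerivAt_smul_coe γ.mat τ)
      (by rw [UpperHalfPlane.ofComplex_apply])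
    refine h2.congr_of_eventuallyEq (Filter.Eventually.of_forall fun z => ?_)
    simp only [Function.comp]
    rw [UpperHalfPlane.ofComplex_apply]
  refine ((hr.mul hj).smul hg').congr_deriv ?_
  simp only [Function.comp, Pi.mul_apply, UpperHalfPlane.ofComplex_apply]
  rw [smul_add, smul_smul, smul_smul, smul_smul, add_comm]
  congr 2
  · have hsq := γ.root_sq τ
    rw [zpow_sub_one₀ h0, zpow_sub_one₀ hr0]
    have : (γ.root τ)⁻¹ * (1 / (2 * γ.root τ)) = (jfac γ.mat τ)⁻¹ / 2 := by
      rw [← hsq]; field_simp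
    rw [div_eq_mul_one_div ((γ.mat 1 0 : ℤ) : ℂ)]
    push_cast
    linear_combination (-(κ : ℂ) * γ.root τ ^ (-κ) * jfac γ.mat τ ^ m * ((γ.mat 1 0 : ℤ) : ℂ)) * this
  · rw [mul_assoc, ← zpow_add₀ h0]
    rfl

end Deriv

/-! ### The slash operator on formal series -/

namespace FormalSeries

variable {n : ℕ}

section Quad

variable {U : Type*} [AddCommGroup U] [Module ℂ U]

/-- Multiplication of a formal series by `∑ a_{ij} T_i T_j`. -/
def quad (A : Matrix (Fin n) (Fin n) ℝ) (h : (Fin n → ℤ) → U) : (Fin n → ℤ) → U :=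
  fun p => ∑ i, ∑ j, (A i j : ℂ) • h (p - Pi.single i 1 - Pi.single j 1)

variable (A : Matrix (Fin n) (Fin n) ℝ)

theorem sum_sub_single_sub_single (p : Fin n → ℤ) (i j : Fin n) :
    ∑ l, (p - Pi.single i 1 - Pi.single j 1 : Fin n → ℤ) l = ∑ l, p l - 2 := by
  simp [Finset.sum_sub_distrib]
  ring

theorem quad_sum {ι : Type*} (s : Finset ι) (f : ι → (Fin n → ℤ) → U) (p : Fin n → ℤ) :
    quad A (fun q => ∑ l ∈ s, f l q) p = ∑ l ∈ s, quad A (f l) p := by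
  simp only [quad, Finset.smul_sum]
  rw [Finset.sum_comm (s := s) (t := Finset.univ)]
  exact Finset.sum_congr rfl fun i _ => Finset.sum_comm

theorem quad_add (h g : (Fin n → ℤ) → U) (p : Fin n → ℤ) :
    quad A (fun q => h q + g q) p = quad A h p + quad A g p := by
  simp only [quad, smul_add, Finset.sum_add_distrib]

theorem quad_smul (c : ℂ) (h : (Fin n → ℤ) → U) (p : Fin n → ℤ) :
    quad A (fun q => c • h q) p = c • quad A h p := by
  simp only [quad, Finset.smul_sum, smul_comm c]

/-- Multiplication by the l-th power of the quadratic form reads only the coefficients of total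
degree s(p) - 2l. Thus degree-dependent scalars can be treated as constants. -/
theorem quad_iterate_congr {h g : (Fin n → ℤ) → U} {s : ℤ} (hs : ∀ q, ∑ i, q i = s → h q = g q)
    (l : ℕ) : ∀ p : Fin n → ℤ, ∑ i, p i = s + 2 * l → (quad A)^[l] h p = (quad A)^[l] g p := by
  induction l with
  | zero => intro p hp; exact hs p (by simpa using hp)
  | succ l ih =>
    intro p hp
    simp only [Function.iterate_succ_apply', quad]
    refine Finset.sum_congr rfl fun i _ => Finset.sum_congr rfl fun j _ => ?_
    rw [ih _ (by rw [sum_sub_single_sub_single, hp]; push_cast; ring)]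

theorem quad_iterate_smul (c : ℂ) (h : (Fin n → ℤ) → U) (l : ℕ) :
    (quad A)^[l] (c • h) = c • (quad A)^[l] h := by
  induction l with
  | zero => rfl
  | succ l ih =>
    rw [Function.iterate_succ_apply', Function.iterate_succ_apply', ih]
    funext p
    simp only [quad, Pi.smul_apply, Finset.smul_sum, smul_comm c]

theorem quad_iterate_zero (l : ℕ) : (quad A)^[l] (0 : (Fin n → ℤ) → U) = 0 := by
  simpa using quad_iterate_smul A 0 (0 : (Fin n → ℤ) → U) l

theorem quad_iterate_sub (h g : (Fin n → ℤ) → U) (l : ℕ) :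
    (quad A)^[l] (h - g) = (quad A)^[l] h - (quad A)^[l] g := by
  induction l with
  | zero => rfl
  | succ l ih =>
    rw [Function.iterate_succ_apply', Function.iterate_succ_apply', Function.iterate_succ_apply', ih]
    funext p
    simp only [quad, Pi.sub_apply, smul_sub, Finset.sum_sub_distrib]

theorem quad_iterate_eq_zero {h : (Fin n → ℤ) → U} (h0 : ∀ q, ∑ i, q i < 0 → h q = 0) {l : ℕ}
    {p : Fin n → ℤ} (hp : ∑ i, p i < 2 * l) : (quad A)^[l] h p = 0 := by
  rw [quad_iterate_congr A (g := 0) (s := ∑ i, p i - 2 * l) (fun q hq => h0 q (by omega)) l p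
    (by ring), quad_iterate_zero]
  rfl

theorem quad_iterate_degree_smul (c : ℤ → ℂ) (h : (Fin n → ℤ) → U) (l : ℕ) (p : Fin n → ℤ) :
    (quad A)^[l] (fun q => c (∑ i, q i) • h q) p = c (∑ i, p i - 2 * l) • (quad A)^[l] h p := by
  rw [quad_iterate_congr A (g := c (∑ i, p i - 2 * l) • h) (s := ∑ i, p i - 2 * l)
    (fun q hq => by simp [hq]) l p (by ring), quad_iterate_smul]
  rfl

theorem quad_iterate_map {U' : Type*} [AddCommGroup U'] [Module ℂ U'] (f : U →ₗ[ℂ] U')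
    (h : (Fin n → ℤ) → U) (l : ℕ) (p : Fin n → ℤ) :
    (quad A)^[l] (fun q => f (h q)) p = f ((quad A)^[l] h p) := by
  induction l generalizing p with
  | zero => rfl
  | succ l ih =>
    simp only [Function.iterate_succ_apply', quad, map_sum, map_smul, ih]

theorem quad_iterate_shift (r : Fin n → ℤ) (h : (Fin n → ℤ) → U) (l : ℕ) (p : Fin n → ℤ) :
    (quad A)^[l] (fun q => h (q - r)) p = (quad A)^[l] h (p - r) := by
  induction l generalizing p with
  | zero => rfl
  | succ l ih =>
    simp only [Function.iterate_succ_apply', quad, ih]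
    refine Finset.sum_congr rfl fun i _ => Finset.sum_congr rfl fun j _ => ?_
    rw [show p - Pi.single i 1 - Pi.single j 1 - r = p - r - Pi.single i 1 - Pi.single j 1 by abel]

end Quad

variable {W : Type*} [NormedAddCommGroup W] [NormedSpace ℂ W] (A : Matrix (Fin n) (Fin n) ℝ)

theorem isHolMod_quad_iterate {h : FormalSeries n W} (hh : ∀ p, IsHolMod (h p)) (l : ℕ)
    (p : Fin n → ℤ) : IsHolMod ((quad A)^[l] h p) := by
  induction l generalizing p with
  | zero => exact hh p
  | succ l ih =>
    rw [Function.iterate_succ_apply']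
    have h1 : (fun z : ℂ => quad A ((quad A)^[l] h) p (UpperHalfPlane.ofComplex z)) = fun z =>
        ∑ i, ∑ j, (A i j : ℂ) •
          (quad A)^[l] h (p - Pi.single i 1 - Pi.single j 1) (UpperHalfPlane.ofComplex z) := by
      funext z
      simp [quad, Finset.sum_apply]
    rw [IsHolMod, h1]
    exact DifferentiableOn.fun_sum fun i _ => DifferentiableOn.fun_sum fun j _ =>
      (ih _).const_smul _

theorem derivTau_quad {h : FormalSeries n W} (hh : ∀ p, IsHolMod (h p)) (p : Fin n → ℤ) :
    derivTau (quad A h p) = quad A (fun q => derivTau (h q)) p := by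
  funext τ
  have h1 : HasDerivAt (fun z : ℂ => ∑ i, ∑ j, (A i j : ℂ) •
      h (p - Pi.single i 1 - Pi.single j 1) (UpperHalfPlane.ofComplex z))
      (∑ i, ∑ j, (A i j : ℂ) • derivTau (h (p - Pi.single i 1 - Pi.single j 1)) τ) τ :=
    HasDerivAt.fun_sum fun i _ => HasDerivAt.fun_sum fun j _ =>
      ((hh _).hasDerivAt τ).const_smul _
  rw [derivTau]
  simp only [quad, Finset.sum_apply, Pi.smul_apply]
  exact h1.deriv

theorem derivTau_quad_iterate {h : FormalSeries n W} (hh : ∀ p, IsHolMod (h p)) (l : ℕ)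
    (p : Fin n → ℤ) :
    derivTau ((quad A)^[l] h p) = (quad A)^[l] (fun q => derivTau (h q)) p := by
  induction l generalizing p with
  | zero => rfl
  | succ l ih =>
    rw [Function.iterate_succ_apply', Function.iterate_succ_apply',
      derivTau_quad A fun q => isHolMod_quad_iterate A hh l q]
    congr 1
    funext q
    exact ih q

theorem heat_eq (κ : ℤ) (h : FormalSeries n W) :
    heat A κ h = (fun p => (((∑ i, p i) * ((∑ i, p i) + κ - 2) : ℤ) : ℂ) • h p) -
      (4 * Real.pi * Complex.I : ℂ) • quad A fun q => derivTau (h q) := by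
  funext p τ
  simp [heat, quad, Finset.sum_apply]

/-- The constant `w` in the exponential `exp (w (c τ + d)⁻¹ ∑ a_{ij} T_i T_j)`. -/
def slashConst (γ : Mp2Z) : ℂ := -(Real.pi * Complex.I * ((γ.mat 1 0 : ℤ) : ℂ))

/-- The `l`-th term in the `p`-th coefficient of the series `h|_k γ`. -/
def slashTerm (κ : ℤ) (γ : Mp2Z) (h : FormalSeries n W) (p : Fin n → ℤ) (l : ℕ) (τ : ℍ) : W :=
  (slashConst γ ^ l / l.factorial : ℂ) • (γ.root τ ^ (-κ) * jfac γ.mat τ ^ ((l : ℤ) - ∑ i, p i)) •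
    (quad A)^[l] h p (γ.mat • τ)

/-- The slash operator of weight `κ / 2` on formal series, modelled on the action on Taylor
series of Jacobi forms. -/
def fslash (κ : ℤ) (γ : Mp2Z) (h : FormalSeries n W) : FormalSeries n W :=
  fun p τ => ∑ l ∈ Finset.range ((∑ i, p i).toNat + 1), slashTerm A κ γ h p l τ

theorem slashTerm_eq_zero (κ : ℤ) (γ : Mp2Z) {h : FormalSeries n W}
    (h0 : ∀ q, ∑ i, q i < 0 → h q = 0) {p : Fin n → ℤ} {l : ℕ} (hl : ∑ i, p i < 2 * l) (τ : ℍ) :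
    slashTerm A κ γ h p l τ = 0 := by
  rw [slashTerm, quad_iterate_eq_zero A h0 hl]
  simp

/-- The cut-off in the definition is immaterial: for a series without terms of negative degree, all
terms with 2l > s(p) vanish. Any sufficiently long range can be used when two series are compared.
-/
theorem fslash_eq_sum (κ : ℤ) (γ : Mp2Z) {h : FormalSeries n W}
    (h0 : ∀ q, ∑ i, q i < 0 → h q = 0) {p : Fin n → ℤ} {N : ℕ} (hN : ∑ i, p i < 2 * N) (τ : ℍ) :
    fslash A κ γ h p τ = ∑ l ∈ Finset.range N, slashTerm A κ γ h p l τ := by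
  have key : ∀ {M N : ℕ}, M ≤ N → ∑ i, p i < 2 * M →
      ∑ l ∈ Finset.range M, slashTerm A κ γ h p l τ =
        ∑ l ∈ Finset.range N, slashTerm A κ γ h p l τ := fun hMN hM =>
    Finset.sum_subset (Finset.range_mono hMN) fun l _ hl =>
      slashTerm_eq_zero A κ γ h0 (by rw [Finset.mem_range] at hl; omega) τ
  rw [fslash]
  rcases le_total ((∑ i, p i).toNat + 1) N with hle | hle
  · exact key hle (by omega)
  · exact (key hle hN).symm

theorem slashTerm_sub_smul (κ : ℤ) (γ : Mp2Z) (e : ℤ → ℂ) (c : ℂ) (h g : FormalSeries n W)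
    (p : Fin n → ℤ) (l : ℕ) (τ : ℍ) :
    slashTerm A κ γ ((fun q => e (∑ i, q i) • h q) - c • quad A g) p l τ =
      e (∑ i, p i - 2 * l) • slashTerm A κ γ h p l τ -
      c • (slashConst γ ^ l / l.factorial : ℂ) •
        (γ.root τ ^ (-κ) * jfac γ.mat τ ^ ((l : ℤ) - ∑ i, p i)) •
          (quad A)^[l + 1] g p (γ.mat • τ) := by
  rw [slashTerm, quad_iterate_sub, quad_iterate_smul, Pi.sub_apply, quad_iterate_degree_smul,
    slashTerm, Function.iterate_succ_apply]
  simp only [Pi.sub_apply, Pi.smul_apply, smul_sub, smul_smul]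
  congr 2 <;> ring

theorem hasDerivAt_slashTerm (κ : ℤ) (γ : Mp2Z) {h : FormalSeries n W}
    (hh : ∀ p, IsHolMod (h p)) (p : Fin n → ℤ) (l : ℕ) (τ : ℍ) :
    HasDerivAt (fun z : ℂ => slashTerm A κ γ h p l (UpperHalfPlane.ofComplex z))
      ((slashConst γ ^ l / l.factorial : ℂ) • γ.root τ ^ (-κ) •
        ((((l : ℤ) - ∑ i, p i : ℤ) - κ / 2 : ℂ) * ((γ.mat 1 0 : ℤ) : ℂ) *
          jfac γ.mat τ ^ ((l : ℤ) - ∑ i, p i - 1)) • (quad A)^[l] h p (γ.mat • τ) +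
      (slashConst γ ^ l / l.factorial : ℂ) • γ.root τ ^ (-κ) •
        jfac γ.mat τ ^ ((l : ℤ) - ∑ i, p i - 2) •
          (quad A)^[l] (fun q => derivTau (h q)) p (γ.mat • τ)) τ := by
  have := (hasDerivAt_modSlash κ ((l : ℤ) - ∑ i, p i) γ
    (isHolMod_quad_iterate A hh l p) τ).const_smul (slashConst γ ^ l / l.factorial : ℂ)
  rw [derivTau_quad_iterate A hh, smul_add, smul_add] at this
  exact this

/-- Differentiating the automorphy factors gives terms with one more power of the quadratic form,
while the eigenvalue s(s+κ-2) changes when the degree drops by 2l. The two discrepancies are the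
same sequence `G` with index shifted by one, so they cancel after summation over l. -/
theorem heat_fslash (κ : ℤ) (γ : Mp2Z) {h : FormalSeries n W} (hh : ∀ p, IsHolMod (h p))
    (h0 : ∀ q, ∑ i, q i < 0 → h q = 0) :
    heat A κ (fslash A κ γ h) = fslash A κ γ (heat A κ h) := by
  funext p τ
  set s : ℤ := ∑ i, p i with hs
  set N : ℕ := s.toNat + 1 with hN
  set j := jfac γ.mat τ with hj
  have hj0 : j ≠ 0 := jfac_ne_zero _ _
  set D : FormalSeries n W := fun q => derivTau (h q) with hD
  set X : ℕ → W := fun l => γ.root τ ^ (-κ) • (quad A)^[l] h p (γ.mat • τ) with hX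
  set Y : ℕ → W := fun l => γ.root τ ^ (-κ) • (quad A)^[l + 1] D p (γ.mat • τ) with hY
  -- Only degree s - 2 is needed, since the heat operator differentiates the coefficients at p - e_i
  -- - e_j.
  have hder : ∀ q : Fin n → ℤ, ∑ i, q i = s - 2 → derivTau (fslash A κ γ h q) τ =
      ∑ l ∈ Finset.range N,
        ((slashConst γ ^ l / l.factorial : ℂ) • γ.root τ ^ (-κ) •
        ((((l : ℤ) - (s - 2) : ℤ) - κ / 2 : ℂ) * ((γ.mat 1 0 : ℤ) : ℂ) *
          j ^ ((l : ℤ) - (s - 2) - 1)) • (quad A)^[l] h q (γ.mat • τ) +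
        (slashConst γ ^ l / l.factorial : ℂ) • γ.root τ ^ (-κ) •
          j ^ ((l : ℤ) - (s - 2) - 2) • (quad A)^[l] D q (γ.mat • τ)) := by
    intro q hq
    have h1 : fslash A κ γ h q = fun τ => ∑ l ∈ Finset.range N, slashTerm A κ γ h q l τ := by
      funext τ
      exact fslash_eq_sum A κ γ h0 (by omega) τ
    rw [h1, derivTau, ← hq]
    exact (HasDerivAt.fun_sum fun l _ => hasDerivAt_slashTerm A κ γ hh q l τ).deriv
  have hquad : (quad A fun q => derivTau (fslash A κ γ h q)) p τ =
      ∑ l ∈ Finset.range N, (slashConst γ ^ l / l.factorial : ℂ) •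
        (((((l : ℤ) - (s - 2) : ℤ) - κ / 2 : ℂ) * ((γ.mat 1 0 : ℤ) : ℂ) *
          j ^ ((l : ℤ) - (s - 2) - 1)) • X (l + 1) + j ^ ((l : ℤ) - s) • Y l) := by
    have h1 : (quad A fun q => derivTau (fslash A κ γ h q)) p τ =
        quad A (fun q => derivTau (fslash A κ γ h q) τ) p := by
      simp [quad, Finset.sum_apply]
    have heval : ∀ (g : FormalSeries n W) (l : ℕ), quad A (fun q => (quad A)^[l] g q (γ.mat • τ)) p
        = (quad A)^[l + 1] g p (γ.mat • τ) := fun g l => by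
      rw [Function.iterate_succ_apply']
      simp [quad, Finset.sum_apply]
    rw [h1, ← Function.iterate_one (f := quad A), quad_iterate_congr A hder 1 p (by simp [hs]),
      Function.iterate_one, quad_sum]
    refine Finset.sum_congr rfl fun l _ => ?_
    simp only [quad_add, quad_smul, heval, hX, hY, smul_add]
    congr 1
    · simp only [smul_comm (γ.root τ ^ (-κ))]
    · rw [show (l : ℤ) - (s - 2) - 2 = l - s by ring, smul_comm (γ.root τ ^ (-κ))]
  rw [fslash_eq_sum A κ γ (N := N) (h := heat A κ h) ?_ (by omega), heat_eq, heat_eq]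
  · have hterm : ∀ l, slashTerm A κ γ ((fun q => (((∑ i, q i) * ((∑ i, q i) + κ - 2) : ℤ) : ℂ) • h q)
        - (4 * Real.pi * Complex.I : ℂ) • quad A D) p l τ =
        (slashConst γ ^ l / l.factorial : ℂ) •
          (((((s - 2 * l) * (s - 2 * l + κ - 2) : ℤ) : ℂ) * j ^ ((l : ℤ) - s)) • X l -
            ((4 * Real.pi * Complex.I : ℂ) * j ^ ((l : ℤ) - s)) • Y l) := by
      intro l
      rw [slashTerm_sub_smul A κ γ (fun s => ((s * (s + κ - 2) : ℤ) : ℂ)), slashTerm]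
      simp only [hX, hY, smul_sub, smul_smul]
      congr 2 <;> ring
    rw [← hD, Finset.sum_congr rfl fun l _ => hterm l]
    simp only [Pi.sub_apply, Pi.smul_apply]
    rw [hquad, fslash_eq_sum A κ γ (N := N) h0 (by omega)]
    -- The factor is s(s+κ-2) - (s-2l)(s-2l+κ-2) = -4l(l+1-s-κ/2).
    set G : ℕ → W := fun l => (-(4 * l * (l + 1 - s - κ / 2)) *
      (slashConst γ ^ l / l.factorial * j ^ ((l : ℤ) - s)) : ℂ) • X l with hG
    -- The shift of index costs nothing: `G 0` has the factor l = 0, and `G N` lies in degree s - 2N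
    -- < 0.
    have hsum : ∑ l ∈ Finset.range N, G (l + 1) = ∑ l ∈ Finset.range N, G l := by
      have hG0 : G 0 = 0 := by simp [hG]
      have hGN : G N = 0 := by
        simp only [hG, hX]
        rw [quad_iterate_eq_zero A h0 (by omega)]
        simp
      have h1 := Finset.sum_range_succ' G N
      rw [Finset.sum_range_succ, hG0, hGN, add_zero, add_zero] at h1
      exact h1.symm
    -- Here 4πi·c = -4·`slashConst`, which supplies the missing power of `slashConst`; the factor l
    -- + 1 turns 1/l! into (l+1)/(l+1)!.
    have hG1 : ∀ l : ℕ, (4 * Real.pi * Complex.I : ℂ) • (slashConst γ ^ l / l.factorial : ℂ) •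
        (((((l : ℤ) - (s - 2) : ℤ) - κ / 2 : ℂ) * ((γ.mat 1 0 : ℤ) : ℂ) *
          j ^ ((l : ℤ) - (s - 2) - 1)) • X (l + 1)) = G (l + 1) := by
      intro l
      simp only [hG, smul_smul]
      congr 1
      have hl : ((l : ℂ) + 1) ≠ 0 := Nat.cast_add_one_ne_zero l
      rw [Nat.factorial_succ, pow_succ,
        show (l : ℤ) - (s - 2) - 1 = ((l + 1 : ℕ) : ℤ) - s by push_cast; ring]
      push_cast
      rw [slashConst]
      field_simp
      ring
    have hG0 : ∀ l : ℕ, (((s * (s + κ - 2) : ℤ) : ℂ)) • slashTerm A κ γ h p l τ -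
        (slashConst γ ^ l / l.factorial : ℂ) •
          (((((s - 2 * l) * (s - 2 * l + κ - 2) : ℤ) : ℂ) * j ^ ((l : ℤ) - s)) • X l) = G l := by
      intro l
      simp only [slashTerm, hG, hX, smul_smul, ← sub_smul]
      congr 1
      push_cast
      ring
    rw [Finset.sum_congr rfl fun l _ => (hG1 l).symm,
      Finset.sum_congr rfl fun l _ => (hG0 l).symm, Finset.sum_sub_distrib] at hsum
    simp only [← hs, smul_sub, smul_add, Finset.sum_sub_distrib, Finset.sum_add_distrib, Finset.smul_sum]
    have hYY : ∀ l : ℕ, (4 * Real.pi * Complex.I : ℂ) • (slashConst γ ^ l / l.factorial : ℂ) •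
        j ^ ((l : ℤ) - s) • Y l = (slashConst γ ^ l / l.factorial : ℂ) •
          ((4 * Real.pi * Complex.I : ℂ) * j ^ ((l : ℤ) - s)) • Y l := by
      intro l
      simp only [smul_smul]
      congr 1
      ring
    simp only [hYY]
    rw [hsum]
    abel
  · intro q hq
    rw [heat_eq]
    have h1 : (quad A)^[1] (fun q => derivTau (h q)) q = 0 :=
      quad_iterate_eq_zero A (fun r hr => by
        rw [h0 r hr]
        funext τ
        simp [derivTau]) (by push_cast; omega)
    rw [Function.iterate_one] at h1
    simp [h0 q hq, h1]

end FormalSeries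

/-! ### Equivariance of the composite operators 𝒟_{k,p} -/

namespace FormalSeries

variable {n : ℕ} {W : Type*} [NormedAddCommGroup W] [NormedSpace ℂ W]
  (A : Matrix (Fin n) (Fin n) ℝ)

/-- The series has only terms of even nonnegative total degree. -/
def EvenSupp (h : FormalSeries n W) : Prop :=
  ∀ p : Fin n → ℤ, (∀ m : ℕ, ∑ i, p i ≠ 2 * m) → h p = 0

theorem EvenSupp.eq_zero_of_neg {h : FormalSeries n W} (H : EvenSupp h) (p : Fin n → ℤ)
    (hp : ∑ i, p i < 0) : h p = 0 :=
  H p fun m hm => by omega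

theorem sum_sub_neg (p r : Fin n → ℤ) : ∑ i, (p - -r) i = ∑ i, p i + ∑ i, r i := by
  simp [Finset.sum_add_distrib]

/-- The degree of p enters the action only through (cτ+d)^{-s(p)}. Moving the degree by s(r) is
absorbed in the weight because the square of the root is cτ+d. -/
theorem shift_fslash (κ : ℤ) (γ : Mp2Z) (r : Fin n → ℤ) {h : FormalSeries n W}
    (h0 : ∀ q, ∑ i, q i < 0 → h q = 0) (h0' : ∀ q, ∑ i, q i < 0 → shift (-r) h q = 0) :
    shift (-r) (fslash A κ γ h) = fslash A (κ + 2 * ∑ i, r i) γ (shift (-r) h) := by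
  funext p τ
  have hs := sum_sub_neg p r
  -- A bound that is long enough both for the degree of p and for the degree of p + r.
  set N : ℕ := (∑ i, p i).toNat + (∑ i, p i + ∑ i, r i).toNat + 1 with hN
  rw [shift, fslash_eq_sum A κ γ h0 (N := N) (by rw [hs]; omega),
    fslash_eq_sum A _ γ h0' (N := N) (by omega)]
  refine Finset.sum_congr rfl fun l _ => ?_
  rw [slashTerm, slashTerm, hs]
  have h1 : (quad A)^[l] (shift (-r) h) p = (quad A)^[l] h (p - -r) :=
    quad_iterate_shift A (-r) h l p
  rw [h1]
  congr 2
  have hr := γ.root_ne_zero τ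
  have hj := jfac_ne_zero γ.mat τ
  rw [← γ.root_sq, ← zpow_natCast, ← zpow_mul, ← zpow_mul, ← zpow_add₀ hr, ← zpow_add₀ hr]
  congr 1
  push_cast
  ring

theorem isHolMod_derivTau {g : ℍ → W} [CompleteSpace W] (hg : IsHolMod g) :
    IsHolMod (derivTau g) := by
  have h := DifferentiableOn.deriv hg UpperHalfPlane.isOpen_upperHalfPlaneSet
  refine h.congr fun z hz => ?_
  rw [derivTau, UpperHalfPlane.ofComplex_apply_of_im_pos hz]

theorem isHolMod_heat [CompleteSpace W] (κ : ℤ) {h : FormalSeries n W} (hh : ∀ p, IsHolMod (h p))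
    (p : Fin n → ℤ) : IsHolMod (heat A κ h p) := by
  rw [heat_eq]
  exact ((hh p).const_smul _).sub
    ((isHolMod_quad_iterate A (fun q => isHolMod_derivTau (hh q)) 1 p).const_smul _)

theorem derivTau_zero : derivTau (0 : ℍ → W) = 0 := by
  funext τ
  simp [derivTau]

/-- After T^{-r} the only coefficients that could land in negative degree have degree 0 before the
shift, and the factor s(p) in the heat operator kills them. -/
theorem EvenSupp.shift_heat {h : FormalSeries n W} (H : EvenSupp h) (κ : ℤ) {r : Fin n → ℤ}
    (hr : ∑ i, r i = 2) : EvenSupp (shift (-r) (heat A κ h)) := by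
  intro p hp
  have hs := sum_sub_neg p r
  funext τ
  have hd : ∀ i j, derivTau (h (p - -r - Pi.single i 1 - Pi.single j 1)) τ = 0 := by
    intro i j
    rw [H, derivTau_zero]
    · rfl
    · intro m
      rw [sum_sub_single_sub_single, hs, hr]
      exact fun h' => hp m (by omega)
  simp only [shift, heat, hd, hs, hr]
  -- In this case the eigenvalue vanishes, whatever the coefficient is. Otherwise the coefficient
  -- itself vanishes.
  by_cases h0 : ∑ i, p i + 2 = 0
  · simp [h0]
  · rw [H]
    · simp
    · intro m hm
      rw [hs, hr] at hm
      exact hp (m - 1) (by omega)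

/-- Each factor T^{-r} L with s(r) = 2 commutes with the action and raises κ by 4, as does the
weight in the recursion. Even support is carried along because `shift_fslash` needs it at every
step. -/
theorem raise_fslash [CompleteSpace W] (γ : Mp2Z) :
    ∀ (ps : List (Fin n → ℤ)) (κ : ℤ) (h : FormalSeries n W), (∀ q ∈ ps, ∑ i, q i = 2) →
      (∀ p, IsHolMod (h p)) → EvenSupp h →
      raise A κ ps (fslash A κ γ h) = fslash A (κ + 4 * ps.length) γ (raise A κ ps h) ∧
        EvenSupp (raise A κ ps h) := by
  intro ps
  induction ps with
  | nil => intro κ h _ _ H; simpa [raise] using H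
  | cons r ps ih =>
    intro κ h hps hh H
    have hr := hps r (by simp)
    have H' := H.shift_heat A κ hr
    have h1 : ∀ q : Fin n → ℤ, ∑ i, q i < 0 → heat A κ h q = 0 := by
      intro q hq
      have := H' (q - r) fun m => by simp only [Pi.sub_apply, Finset.sum_sub_distrib]; omega
      simpa [shift] using this
    obtain ⟨h2, h3⟩ := ih (κ + 4) (shift (-r) (heat A κ h)) (fun q hq => hps q (by simp [hq]))
      (fun p => isHolMod_heat A κ hh _) H'
    refine ⟨?_, h3⟩
    simp only [raise]
    rw [heat_fslash A κ γ hh H.eq_zero_of_neg, shift_fslash A κ γ r h1 H'.eq_zero_of_neg, hr,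
      show κ + 2 * 2 = κ + 4 by ring, h2]
    congr 1
    push_cast [List.length_cons]
    ring

theorem parityPart_fslash (s κ : ℤ) (γ : Mp2Z) (h : FormalSeries n W) :
    parityPart s (fslash A κ γ h) = fslash A κ γ (parityPart s h) := by
  funext p τ
  have key : ∀ l, (quad A)^[l] (parityPart s h) p =
      if (∑ i, p i) ≡ s [ZMOD 2] then (quad A)^[l] h p else 0 := by
    intro l
    have h1 := quad_iterate_degree_smul A (fun t => if t ≡ s [ZMOD 2] then 1 else 0) h l p
    have h2 : (parityPart s h) =
        (fun q => (if (∑ i, q i) ≡ s [ZMOD 2] then (1 : ℂ) else 0) • h q) := by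
      funext q
      simp [parityPart]
    have h3 : (∑ i, p i - 2 * (l : ℤ) ≡ s [ZMOD 2]) ↔ (∑ i, p i ≡ s [ZMOD 2]) := by
      simp only [Int.ModEq]
      omega
    rw [h2, h1]
    simp [h3]
  simp only [parityPart, fslash, slashTerm] at key ⊢
  simp only [key]
  split_ifs <;> simp [fslash, slashTerm]

/-- In degree 0 only the term l = 0 survives, so the constant term transforms without correction. -/
theorem fslash_apply_zero (κ : ℤ) (γ : Mp2Z) {h : FormalSeries n W}
    (h0 : ∀ q, ∑ i, q i < 0 → h q = 0) : fslash A κ γ h 0 = modSlash κ γ (h 0) := by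
  funext τ
  rw [fslash_eq_sum A κ γ h0 (N := 1) (by simp)]
  simp [slashTerm, modSlash]

theorem raiseOp_fslash [CompleteSpace W] (κ : ℤ) (γ : Mp2Z) (p : Fin n → ℕ)
    {h : FormalSeries n W} (hh : ∀ q, IsHolMod (h q)) (h0 : ∀ q, ∑ i, q i < 0 → h q = 0) :
    raiseOp A κ p (parityPart (∑ i, (p i : ℤ)) (fslash A κ γ h)) 0 =
      modSlash (κ + 2 * ∑ i, (p i : ℤ)) γ
        (raiseOp A κ p (parityPart (∑ i, (p i : ℤ)) h) 0) := by
  rw [parityPart_fslash]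
  set g := parityPart (∑ i, (p i : ℤ)) h with hg
  have hcast : ((∑ i, p i : ℕ) : ℤ) = ∑ i, (p i : ℤ) := by push_cast; rfl
  have g0 : ∀ q, ∑ i, q i < 0 → g q = 0 := fun q hq => by simp [hg, parityPart, h0 q hq]
  have gmod : ∀ q, ¬ (∑ i, q i ≡ ∑ i, (p i : ℤ) [ZMOD 2]) → g q = 0 := fun q hq => by
    simp [hg, parityPart, hq]
  have ghol : ∀ q, IsHolMod (g q) := fun q => by
    simp only [hg, parityPart]
    split_ifs
    · exact hh q
    · exact differentiableOn_const _
  -- A series of fixed parity in degrees ≥ 0 becomes even after division by T^r with s(r) ≤ 1 of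
  -- that parity: the new degrees are even and at least -1, hence at least 0.
  have hsupp : ∀ r : Fin n → ℤ, ∑ i, r i ≡ ∑ i, (p i : ℤ) [ZMOD 2] → ∑ i, r i ≤ 1 →
      EvenSupp (shift (-r) g) := by
    intro r hr hr1 q hq
    have hs := sum_sub_neg q r
    rw [shift]
    by_cases hneg : ∑ i, (q - -r) i < 0
    · exact g0 _ hneg
    · refine gmod _ fun hmod => hq ((∑ i, q i) / 2).toNat ?_
      rw [hs] at hmod hneg
      simp only [Int.ModEq] at hmod hr
      omega
  simp only [raiseOp]
  split_ifs with h1 h2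
  · have H := hsupp (fun i => (p i : ℤ)) rfl (by omega)
    rw [shift_fslash A κ γ _ g0 H.eq_zero_of_neg, fslash_apply_zero A _ γ H.eq_zero_of_neg]
  · have hn : 0 < n := by
      rcases Nat.eq_zero_or_pos n with rfl | hn
      · simp at h1
      · exact hn
    obtain ⟨l, hl⟩ := h2
    have hl2 : (∑ i, p i) / 2 = l := by omega
    have H : EvenSupp g := by
      have := hsupp 0 (by simp only [Int.ModEq]; simp; omega) (by simp)
      have he : shift (-0) g = g := by
        funext q
        simp [shift]
      rwa [he] at this
    obtain ⟨h3, h4⟩ := raise_fslash A γ (splitting (fun i => (p i : ℤ)) l) κ g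
      (splitting_mem hn _ (by omega) (by omega)) ghol H
    rw [hl2, h3, fslash_apply_zero A _ γ h4.eq_zero_of_neg]
    congr 1
    simp [splitting]
    omega
  · have hn : 0 < n := by
      rcases Nat.eq_zero_or_pos n with rfl | hn
      · simp at h1
      · exact hn
    have hodd : (∑ i, p i) % 2 = 1 := by rwa [Nat.not_even_iff] at h2
    have hf := sum_firstVec hn
    have H := hsupp (firstVec n) (by rw [hf]; simp only [Int.ModEq]; omega) (by rw [hf])
    obtain ⟨h3, h4⟩ := raise_fslash A γ
      (splitting ((fun i => (p i : ℤ)) - firstVec n) ((∑ i, p i) / 2)) (κ + 2)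
      (shift (-firstVec n) g)
      (splitting_mem hn _ (by omega)
        (by simp only [Pi.sub_apply, Finset.sum_sub_distrib, hf]; omega)) (fun q => ghol _) H
    rw [shift_fslash A κ γ _ g0 H.eq_zero_of_neg, hf, mul_one, h3,
      fslash_apply_zero A _ γ h4.eq_zero_of_neg]
    congr 1
    simp [splitting]
    omega

/-! ### Leading coefficients -/

theorem heat_apply_of_derivTau_eq_zero (κ : ℤ) {h : FormalSeries n W} {p : Fin n → ℤ}
    (hp : ∀ i j, h (p - Pi.single i 1 - Pi.single j 1) = 0) :
    heat A κ h p = (((∑ i, p i) * ((∑ i, p i) + κ - 2) : ℤ) : ℂ) • h p := by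
  funext τ
  simp [heat, hp, derivTau_zero]

theorem sum_list_sum : ∀ ps : List (Fin n → ℤ), (∀ q ∈ ps, ∑ i, q i = 2) →
    ∑ i, ps.sum i = 2 * ps.length := by
  intro ps
  induction ps with
  | nil => simp
  | cons r ps ih =>
    intro h
    simp only [List.sum_cons, Pi.add_apply, Finset.sum_add_distrib, h r (by simp),
      ih fun q hq => h q (by simp [hq]), List.length_cons]
    push_cast
    ring

/-- The operators are triangular for the componentwise order. If everything of even degree strictly
below the total exponent vanishes, the derivative terms drop out and each heat operator acts as the
scalar s(s+κ-2). The hypothesis on κ keeps these scalars nonzero. -/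
theorem apply_sum_eq_zero_of_raise : ∀ (ps : List (Fin n → ℤ)) (κ : ℤ) (h : FormalSeries n W),
    (∀ q ∈ ps, ∑ i, q i = 2) → (∀ m : ℕ, κ ≠ -(2 * m)) →
    (∀ q : Fin n → ℤ, q ≤ ps.sum → q ≠ ps.sum → ∑ i, q i ≡ 0 [ZMOD 2] → h q = 0) →
    raise A κ ps h 0 = 0 → h ps.sum = 0 := by
  intro ps
  induction ps with
  | nil => intro κ h _ _ _ h0; exact h0
  | cons r ps ih =>
    intro κ h hps hκ hlow h0
    have hr := hps r (by simp)
    have hps' : ∀ q ∈ ps, ∑ i, q i = 2 := fun q hq => hps q (by simp [hq])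
    have hlen := sum_list_sum _ hps
    rw [List.sum_cons] at hlow hlen ⊢
    have hder : ∀ q : Fin n → ℤ, q ≤ r + ps.sum → ∑ i, q i ≡ 0 [ZMOD 2] →
        ∀ i j, h (q - Pi.single i 1 - Pi.single j 1) = 0 := by
      intro q hq hq2 i j
      have hs := sum_sub_single_sub_single q i j
      have hle : q - Pi.single i 1 - Pi.single j 1 ≤ q := by
        intro l
        have h1 : (0 : Fin n → ℤ) ≤ Pi.single i 1 := Pi.single_nonneg.2 (by norm_num)
        have h2 : (0 : Fin n → ℤ) ≤ Pi.single j 1 := Pi.single_nonneg.2 (by norm_num)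
        have h3 := h1 l
        have h4 := h2 l
        simp only [Pi.sub_apply, Pi.zero_apply] at h3 h4 ⊢
        omega
      refine hlow _ (hle.trans hq) (fun heq => ?_) ?_
      · have h1 : ∑ l, q l ≤ ∑ l, (r + ps.sum) l := Finset.sum_le_sum fun l _ => hq l
        rw [← heq, hs] at h1
        omega
      · rw [hs]
        simp only [Int.ModEq] at hq2 ⊢
        omega
    have h1 := ih (κ + 4) (shift (-r) (heat A κ h)) hps' (fun m hm => hκ (m + 2) (by push_cast; omega))
      (fun q hq hne hq2 => ?_) h0
    · have hP : ps.sum - -r = r + ps.sum := by abel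
      rw [shift, hP, heat_apply_of_derivTau_eq_zero A κ (hder _ le_rfl
        (by rw [hlen]; simp [Int.ModEq])), hlen] at h1
      refine (smul_eq_zero.1 h1).resolve_left ?_
      rw [← ne_eq, Int.cast_ne_zero]
      -- With ℓ remaining vectors the degree is s = 2(ℓ+1), and s(s+κ-2) = 2(ℓ+1)(2ℓ+κ). It could
      -- vanish only for κ = -2ℓ.
      refine mul_ne_zero (by simp; omega) fun h2 => hκ ps.length ?_
      simp only [List.length_cons] at h2
      push_cast at h2
      linarith
    · have hle : q - -r ≤ r + ps.sum := by
        rw [sub_neg_eq_add, add_comm]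
        exact add_le_add_right hq r
      have hpar : ∑ i, (q - -r) i ≡ 0 [ZMOD 2] := by
        rw [sum_sub_neg, hr]
        simp only [Int.ModEq] at hq2 ⊢
        omega
      rw [shift, heat_apply_of_derivTau_eq_zero A κ (hder _ hle hpar),
        hlow _ hle (fun heq => hne ?_) hpar, smul_zero]
      have : q - -r = ps.sum - -r := by rw [heq]; abel
      exact sub_left_injective this

theorem apply_eq_zero_of_raiseOp {κ : ℤ} (hκ : ∀ m : ℕ, κ ≠ -(2 * m)) (p : Fin n → ℕ)
    {h : FormalSeries n W}
    (hlow : ∀ q : Fin n → ℤ, (∀ i, q i ≤ p i) → (q ≠ fun i => (p i : ℤ)) →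
      ∑ i, q i ≡ ∑ i, (p i : ℤ) [ZMOD 2] → h q = 0)
    (h0 : raiseOp A κ p (parityPart (∑ i, (p i : ℤ)) h) 0 = 0) : h (fun i => (p i : ℤ)) = 0 := by
  have hcast : ((∑ i, p i : ℕ) : ℤ) = ∑ i, (p i : ℤ) := by push_cast; rfl
  have hpar : ∀ q : Fin n → ℤ, ∑ i, q i ≡ ∑ i, (p i : ℤ) [ZMOD 2] →
      parityPart (∑ i, (p i : ℤ)) h q = h q := fun q hq => by simp [parityPart, hq]
  simp only [raiseOp] at h0
  split_ifs at h0 with h1 h2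
  · rw [shift, zero_sub, neg_neg, hpar _ rfl] at h0
    exact h0
  · have hn : 0 < n := by
      rcases Nat.eq_zero_or_pos n with rfl | hn
      · simp at h1
      · exact hn
    obtain ⟨l, hl⟩ := h2
    have hl2 : (∑ i, p i) / 2 = l := by omega
    rw [hl2] at h0
    have hsum := splitting_sum (fun i => (p i : ℤ)) (l := l) (by omega)
    have h3 := apply_sum_eq_zero_of_raise A _ κ _
      (splitting_mem hn (fun i => (p i : ℤ)) (l := l) (by omega) (by omega)) hκ ?_ h0
    · rwa [hsum, hpar _ rfl] at h3
    · intro q hq hne hq2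
      rw [hsum] at hq hne
      have : ∑ i, q i ≡ ∑ i, (p i : ℤ) [ZMOD 2] := by
        simp only [Int.ModEq] at hq2 ⊢
        omega
      rw [hpar _ this]
      exact hlow q hq hne this
  · have hn : 0 < n := by
      rcases Nat.eq_zero_or_pos n with rfl | hn
      · simp at h1
      · exact hn
    have hodd : (∑ i, p i) % 2 = 1 := by rwa [Nat.not_even_iff] at h2
    have hf := sum_firstVec hn
    have hsum := splitting_sum ((fun i => (p i : ℤ)) - firstVec n) (l := (∑ i, p i) / 2) (by omega)
    have h3 := apply_sum_eq_zero_of_raise A _ (κ + 2) _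
      (splitting_mem hn ((fun i => (p i : ℤ)) - firstVec n) (l := (∑ i, p i) / 2) (by omega)
        (by simp only [Pi.sub_apply, Finset.sum_sub_distrib, hf]; omega))
      (fun m hm => hκ (m + 1) (by push_cast; omega)) ?_ h0
    · rw [hsum, shift, sub_neg_eq_add, sub_add_cancel, hpar _ rfl] at h3
      exact h3
    · intro q hq hne hq2
      rw [hsum] at hq hne
      have : ∑ i, (q - -firstVec n) i ≡ ∑ i, (p i : ℤ) [ZMOD 2] := by
        rw [sum_sub_neg, hf]
        simp only [Int.ModEq] at hq2 ⊢
        omega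
      rw [shift, hpar _ this]
      refine hlow _ (fun i => ?_) (fun heq => hne ?_) this
      · have := hq i
        simp only [Pi.sub_apply, Pi.neg_apply] at this ⊢
        omega
      · rw [← heq]
        abel

/-! ### Series of exponential sums -/

variable [FiniteDimensional ℂ W] {X : Type*}

/-- The effect of `heat` on coefficients of `e(ντ)`. -/
def symHeat (κ : ℤ) (ν : ℝ) (S : (Fin n → ℤ) → ℂ) : (Fin n → ℤ) → ℂ := fun p =>
  (((∑ i, p i) * ((∑ i, p i) + κ - 2) : ℤ) : ℂ) * S p -
    (4 * Real.pi * Complex.I) * ∑ i, ∑ j, (A i j : ℂ) *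
      ((2 * Real.pi * Complex.I * ν) * S (p - Pi.single i 1 - Pi.single j 1))

/-- The effect of `raise` on coefficients of `e(ντ)`. -/
def symRaise (ν : ℝ) : ℤ → List (Fin n → ℤ) → ((Fin n → ℤ) → ℂ) → (Fin n → ℤ) → ℂ
  | _, [], S => S
  | κ, p :: ps, S => symRaise ν (κ + 4) ps fun q => symHeat A κ ν S (q - -p)

/-- The effect of `raiseOp` on coefficients of `e(ντ)`. -/
def symRaiseOp (κ : ℤ) (ν : ℝ) (p : Fin n → ℕ) (S : (Fin n → ℤ) → ℂ) : (Fin n → ℤ) → ℂ :=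
  let q : Fin n → ℤ := fun i => (p i : ℤ)
  let s : ℕ := ∑ i, p i
  if s ≤ 1 then fun r => S (r - -q)
  else if Even s then symRaise A ν κ (splitting q (s / 2)) S
  else symRaise A ν (κ + 2) (splitting (q - firstVec n) (s / 2)) fun r => S (r - -firstVec n)

theorem tauSum_heat (κ : ℤ) {ν : X → ℝ} {c : X → W} {S : X → (Fin n → ℤ) → ℂ}
    {h : FormalSeries n W} (H : ∀ p, TauSum ν (fun x => S x p • c x) (h p)) (p : Fin n → ℤ) :
    TauSum ν (fun x => symHeat A κ (ν x) (S x) p • c x) (heat A κ h p) := by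
  intro τ
  have h1 := (H p τ).const_smul (((∑ i, p i) * ((∑ i, p i) + κ - 2) : ℤ) : ℂ)
  have h2 := (hasSum_sum (s := Finset.univ) fun i _ => hasSum_sum (s := Finset.univ) fun j _ =>
    ((H (p - Pi.single i 1 - Pi.single j 1)).derivTau τ).const_smul (A i j : ℂ)).const_smul
      (4 * Real.pi * Complex.I : ℂ)
  refine (h1.sub h2).congr_fun fun x => ?_
  simp only [symHeat, smul_smul, ← Finset.sum_smul, ← sub_smul]
  congr 1
  rw [mul_sub, Finset.mul_sum, Finset.mul_sum, Finset.mul_sum]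
  congr 1
  · ring
  · refine Finset.sum_congr rfl fun i _ => ?_
    rw [Finset.mul_sum, Finset.mul_sum, Finset.mul_sum]
    refine Finset.sum_congr rfl fun j _ => ?_
    ring

theorem tauSum_raise {ν : X → ℝ} {c : X → W} :
    ∀ (ps : List (Fin n → ℤ)) (κ : ℤ) (S : X → (Fin n → ℤ) → ℂ)
    (h : FormalSeries n W), (∀ p, TauSum ν (fun x => S x p • c x) (h p)) → ∀ p : Fin n → ℤ,
    TauSum ν (fun x => symRaise A (ν x) κ ps (S x) p • c x) (raise A κ ps h p) := by
  intro ps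
  induction ps with
  | nil => intro κ S h H p; exact H p
  | cons r ps ih =>
    intro κ S h H p
    exact ih (κ + 4) (fun x q => symHeat A κ (ν x) (S x) (q - -r)) (shift (-r) (heat A κ h))
      (fun q => tauSum_heat A κ H (q - -r)) p

theorem tauSum_raiseOp (κ : ℤ) (p : Fin n → ℕ) {ν : X → ℝ} {c : X → W} {S : X → (Fin n → ℤ) → ℂ}
    {h : FormalSeries n W} (H : ∀ p, TauSum ν (fun x => S x p • c x) (h p)) (q : Fin n → ℤ) :
    TauSum ν (fun x => symRaiseOp A κ (ν x) p (S x) q • c x) (raiseOp A κ p h q) := by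
  simp only [symRaiseOp, raiseOp]
  split_ifs
  · exact H _
  · exact tauSum_raise A _ _ _ _ H q
  · exact tauSum_raise A _ _ (fun x r => S x (r - -firstVec n)) (shift (-firstVec n) h)
      (fun r => H _) q

/-- For a constant function the derivative is zero, and in degree 0 the eigenvalue is zero as well.
-/
theorem symHeat_zero {κ : ℤ} {S : (Fin n → ℤ) → ℂ} (hS : ∀ q ≠ 0, S q = 0) :
    symHeat A κ 0 S = 0 := by
  funext p
  simp only [symHeat]
  by_cases hp : p = 0
  · simp [hp]
  · simp [hS p hp]

theorem symRaise_zero : ∀ (ps : List (Fin n → ℤ)) (κ : ℤ) (S : (Fin n → ℤ) → ℂ),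
    -- The second condition excludes the empty composition; a single heat operator already
    -- annihilates a constant.
    (∀ q ≠ 0, S q = 0) → (ps = [] → S = 0) → symRaise A 0 κ ps S = 0 := by
  intro ps
  induction ps with
  | nil => intro κ S _ h; exact h rfl
  | cons r ps ih =>
    intro κ S hS _
    have : (fun q => symHeat A κ 0 S (q - -r)) = 0 := by
      rw [symHeat_zero A hS]; rfl
    simp only [symRaise]
    exact ih _ _ (fun q _ => congrFun this q) fun _ => this

theorem symRaiseOp_zero (κ : ℤ) {p : Fin n → ℕ} (hp : p ≠ 0) {S : (Fin n → ℤ) → ℂ}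
    (hS : ∀ q ≠ 0, S q = 0) (hS' : Odd (∑ i, p i) → S = 0) : symRaiseOp A κ 0 p S 0 = 0 := by
  simp only [symRaiseOp]
  split_ifs with h1 h2
  · refine hS _ fun h => hp ?_
    funext i
    have := congrFun h i
    simpa using this
  · rw [symRaise_zero A _ _ _ hS (by simp [splitting])]
    rfl
  · rw [hS' (Nat.not_even_iff_odd.1 h2)]
    exact congrFun (symRaise_zero A _ _ (fun r => (0 : (Fin n → ℤ) → ℂ) (r - -firstVec n))
      (fun _ _ => rfl) fun _ => rfl) 0

end FormalSeries

/-! ### Multiple power series -/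

theorem hasSum_pi_prod {𝕜 β : Type*} [NormedField 𝕜] [CompleteSpace 𝕜] :
    ∀ {n : ℕ} {f : Fin n → β → 𝕜} {a : Fin n → 𝕜}, (∀ i, HasSum (f i) (a i)) →
      (∀ i, Summable fun q => ‖f i q‖) →
      HasSum (fun q : Fin n → β => ∏ i, f i (q i)) (∏ i, a i) ∧
        Summable fun q : Fin n → β => ‖∏ i, f i (q i)‖ := by
  intro n
  induction n with
  | zero =>
    intro f a _ _
    refine ⟨?_, (hasSum_unique _).summable⟩
    have := hasSum_unique (fun q : Fin 0 → β => ∏ i, f i (q i))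
    simp only [Finset.univ_eq_empty, Finset.prod_empty] at this ⊢
    exact this
  | succ n ih =>
    intro f a hf hs
    obtain ⟨h1, h2⟩ := ih (fun i => hf i.succ) fun i => hs i.succ
    have hn : Summable fun x : β × (Fin n → β) => ‖f 0 x.1 * ∏ i, f i.succ (x.2 i)‖ :=
      Summable.mul_norm (f := f 0) (g := fun q : Fin n → β => ∏ i : Fin n, f i.succ (q i)) (hs 0) h2
    have he : ∀ x : β × (Fin n → β), ∏ i, f i (Fin.consEquiv (fun _ => β) x i) =
        f 0 x.1 * ∏ i, f i.succ (x.2 i) := fun x => by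
      rw [Fin.prod_univ_succ]
      rfl
    have h3 : HasSum (fun x : β × (Fin n → β) => ∏ i, f i (Fin.consEquiv (fun _ => β) x i))
        (a 0 * ∏ i : Fin n, a i.succ) := ((hf 0).mul h1 hn.of_norm).congr_fun he
    have h4 : Summable (fun x : β × (Fin n → β) => ‖∏ i, f i (Fin.consEquiv (fun _ => β) x i)‖) :=
      hn.congr fun x => by rw [he]
    rw [Fin.prod_univ_succ]
    exact ⟨(Fin.consEquiv fun _ => β).hasSum_iff.1 h3, (Fin.consEquiv fun _ => β).summable_iff.1 h4⟩

theorem hasSum_prod_pow_div_factorial {n : ℕ} (w : Fin n → ℂ) :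
    HasSum (fun q : Fin n → ℕ => ∏ i, w i ^ q i / (q i).factorial) (∏ i, Complex.exp (w i)) ∧
      HasSum (fun q : Fin n → ℕ => ‖∏ i, w i ^ q i / ((q i).factorial : ℂ)‖)
        (∏ i, Real.exp ‖w i‖) := by
  have h1 : ∀ z : ℂ, HasSum (fun m : ℕ => z ^ m / m.factorial) (Complex.exp z) := fun z => by
    rw [Complex.exp_eq_exp_ℂ]; exact NormedSpace.expSeries_div_hasSum_exp z
  have h2 : ∀ x : ℝ, HasSum (fun m : ℕ => x ^ m / m.factorial) (Real.exp x) := fun x => by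
    rw [Real.exp_eq_exp_ℝ]; exact NormedSpace.expSeries_div_hasSum_exp x
  have h3 : ∀ z : ℂ, HasSum (fun m : ℕ => ‖z ^ m / (m.factorial : ℂ)‖) (Real.exp ‖z‖) := fun z => by
    simpa using h2 ‖z‖
  refine ⟨(hasSum_pi_prod (fun i => h1 (w i)) fun i => (h3 (w i)).summable).1, ?_⟩
  simp only [norm_prod]
  exact (hasSum_pi_prod (fun i => h3 (w i)) fun i => by simpa using (h3 (w i)).summable).1

section PowerSeries

variable {W : Type*} [NormedAddCommGroup W] [NormedSpace ℂ W] [FiniteDimensional ℂ W]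
variable {V : Type*} [AddCommGroup V] [Module ℝ V] {n : ℕ} {Λ : IntegralLattice V}

/-- The absolute values are removed by choosing signs: each product is at most the sum over all ε ∈
{±1}ⁿ of the norms of the exponential at the imaginary point with coordinates -iε_jR_j. At each of
these points the given expansion converges absolutely. -/
theorem ZSum.summable_prod_exp {X : Type*} {t : X → V} {a : X → W} {F : Cplx V → W}
    (H : ZSum Λ t a F) (b : Basis (Fin n) ℝ V) (R : Fin n → ℝ) :
    Summable fun x => (∏ i, Real.exp (2 * Real.pi * |Λ.form (t x) (b i)| * R i)) * ‖a x‖ := by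
  have hpos : ∀ x : X, 0 ≤ (∏ i, Real.exp (2 * Real.pi * |Λ.form (t x) (b i)| * R i)) * ‖a x‖ :=
    fun x => mul_nonneg (Finset.prod_nonneg fun i _ => (Real.exp_pos _).le) (norm_nonneg _)
  have h1 : Summable fun x => ∑ ε : Fin n → ℤˣ,
      ‖eexp (Λ.formC ((1 : ℂ) ⊗ₜ[ℝ] t x)
        (∑ i, (-(((ε i : ℤ) : ℂ) * R i * Complex.I)) ⊗ₜ[ℝ] b i)) • a x‖ :=
    summable_sum fun ε _ => (H _).summable.norm_of_finiteDimensional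
  refine Summable.of_nonneg_of_le hpos (fun x => ?_) h1
  simp only [norm_smul, ← Finset.sum_mul]
  refine mul_le_mul_of_nonneg_right ?_ (norm_nonneg _)
  have h2 : ∀ ε : Fin n → ℤˣ, ‖eexp (Λ.formC ((1 : ℂ) ⊗ₜ[ℝ] t x)
        (∑ i, (-(((ε i : ℤ) : ℂ) * R i * Complex.I)) ⊗ₜ[ℝ] b i))‖ =
      ∏ i, Real.exp (2 * Real.pi * ((ε i : ℤ) * Λ.form (t x) (b i)) * R i) := by
    intro ε
    rw [norm_eexp, ← Real.exp_sum]
    congr 1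
    simp only [map_sum, formC_tmul, Complex.im_sum, Finset.mul_sum, ← Finset.sum_neg_distrib]
    refine Finset.sum_congr rfl fun i _ => ?_
    simp
    ring
  simp only [h2]
  have h3 := Finset.prod_univ_sum (fun _ : Fin n => (Finset.univ : Finset ℤˣ))
    fun i (e : ℤˣ) => Real.exp (2 * Real.pi * ((e : ℤ) * Λ.form (t x) (b i)) * R i)
  rw [Fintype.piFinset_univ] at h3
  rw [← h3]
  refine Finset.prod_le_prod (fun i _ => (Real.exp_pos _).le) fun i _ => ?_
  rcases abs_cases (Λ.form (t x) (b i)) with ⟨h, _⟩ | ⟨h, _⟩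
  · rw [h]
    refine le_trans (le_of_eq ?_) (Finset.single_le_sum (fun e _ => (Real.exp_pos _).le)
      (Finset.mem_univ (1 : ℤˣ)))
    simp
  · rw [h]
    refine le_trans (le_of_eq ?_) (Finset.single_le_sum (fun e _ => (Real.exp_pos _).le)
      (Finset.mem_univ (-1 : ℤˣ)))
    simp

/-- Expanding every exponential gives a double series over X × ℕⁿ. It is absolutely convergent by
`ZSum.summable_prod_exp`, so it may be summed over X first. -/
theorem ZSum.hasSum_pow {X : Type*} {t : X → V} {a : X → W} {F : Cplx V → W}
    (H : ZSum Λ t a F) (b : Basis (Fin n) ℝ V) (z : Fin n → ℂ) :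
    HasSum (fun q : Fin n → ℕ => (∏ i, z i ^ q i) •
      ((∏ i, (q i).factorial : ℕ) : ℂ)⁻¹ • _root_.partialPow b q F 0)
      (F (∑ i, z i ⊗ₜ[ℝ] b i)) := by
  have := FiniteDimensional.complete ℂ W
  set w : X → Fin n → ℂ := fun x i => 2 * Real.pi * Complex.I * Λ.form (t x) (b i) * z i with hw
  set g : X × (Fin n → ℕ) → W := fun y => (∏ i, w y.1 i ^ y.2 i / ((y.2 i).factorial : ℂ)) • a y.1
    with hg
  have hx : ∀ x, HasSum (fun q => g (x, q))
      (eexp (Λ.formC ((1 : ℂ) ⊗ₜ[ℝ] t x) (∑ i, z i ⊗ₜ[ℝ] b i)) • a x) := by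
    intro x
    have h1 := (hasSum_prod_pow_div_factorial (w x)).1.smul_const (a x)
    convert h1 using 2
    rw [map_sum, eexp_sum]
    refine Finset.prod_congr rfl fun i _ => ?_
    rw [formC_tmul, eexp]
    congr 1
    simp only [hw]
    ring
  have hxn : ∀ x, HasSum (fun q => ‖g (x, q)‖) ((∏ i, Real.exp ‖w x i‖) * ‖a x‖) := by
    intro x
    simpa only [hg, norm_smul] using (hasSum_prod_pow_div_factorial (w x)).2.mul_right ‖a x‖
  have hsum : Summable g := by
    refine Summable.of_norm ((summable_prod_of_nonneg fun _ => norm_nonneg _).2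
      ⟨fun x => (hxn x).summable, ?_⟩)
    simp only [fun x => (hxn x).tsum_eq]
    convert H.summable_prod_exp b (fun i => ‖z i‖) using 6 with x i
    simp only [hw, norm_mul, Complex.norm_I, Complex.norm_real, Complex.norm_ofNat,
      Real.norm_eq_abs, abs_of_pos Real.pi_pos]
    ring
  have htot : HasSum g (F (∑ i, z i ⊗ₜ[ℝ] b i)) := by
    have h1 := hsum.hasSum.prod_fiberwise hx
    rw [← h1.unique (H _)]
    exact hsum.hasSum
  have hq : ∀ q : Fin n → ℕ, HasSum (fun x => g (x, q)) ((∏ i, z i ^ q i) •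
      ((∏ i, (q i).factorial : ℕ) : ℂ)⁻¹ • _root_.partialPow b q F 0) := by
    intro q
    have h1 := ((H.partialPow_zero b q).const_smul ((∏ i, (q i).factorial : ℕ) : ℂ)⁻¹).const_smul
      (∏ i, z i ^ q i)
    refine h1.congr_fun fun x => ?_
    simp only [hg, hw, smul_smul]
    congr 1
    rw [Finset.prod_div_distrib]
    simp only [mul_pow (_ * _) (z _), Finset.prod_mul_distrib]
    push_cast
    ring
  exact HasSum.prod_fiberwise ((Equiv.prodComm _ _).hasSum_iff.2 htot) hq

theorem hasSum_taylorSeries {X : Type*} {t : X → V} {a : X → W} {φ : ℍ → Cplx V → W} {τ : ℍ}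
    (H : ZSum Λ t a (φ τ)) (b : Basis (Fin n) ℝ V) (z : Fin n → ℂ) :
    HasSum (fun p : Fin n → ℤ => (∏ i, z i ^ p i) • taylorSeries b φ p τ)
      (φ τ (∑ i, z i ⊗ₜ[ℝ] b i)) := by
  have hinj : Function.Injective fun (q : Fin n → ℕ) (i : Fin n) => (q i : ℤ) := fun q r h => by
    funext i
    exact Int.ofNat_injective (congrFun h i)
  rw [← hinj.hasSum_iff]
  · refine (H.hasSum_pow b z).congr_fun fun q => ?_
    simp [taylorSeries]
  · intro p hp
    have : ¬ ∀ i, 0 ≤ p i := fun h => hp ⟨fun i => (p i).toNat, by funext i; simp [h i]⟩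
    simp [taylorSeries, this]

theorem taylorSeries_eq_zero_of_neg (b : Basis (Fin n) ℝ V) (φ : ℍ → Cplx V → W) {p : Fin n → ℤ}
    (hp : ∑ i, p i < 0) : taylorSeries b φ p = 0 := by
  have : ¬ ∀ i, 0 ≤ p i := fun h => absurd (Finset.sum_nonneg fun i _ => h i) (not_le.2 hp)
  funext τ
  simp [taylorSeries, this]

end PowerSeries

/-! ### Multiplication of convergent series by the exponential of a quadratic form -/

namespace FormalSeries

variable {n : ℕ} {W : Type*} [NormedAddCommGroup W] [NormedSpace ℂ W] [FiniteDimensional ℂ W]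
  (A : Matrix (Fin n) (Fin n) ℝ)

theorem prod_zpow_sub_single {z : Fin n → ℂ} (hz : ∀ i, z i ≠ 0) (p : Fin n → ℤ) (i : Fin n) :
    ∏ l, z l ^ p l = z i * ∏ l, z l ^ (p - Pi.single i 1 : Fin n → ℤ) l := by
  have h1 : ∀ l, z l ^ p l =
      (if l = i then z l else 1) * z l ^ (p - Pi.single i 1 : Fin n → ℤ) l := by
    intro l
    rcases eq_or_ne l i with rfl | hl
    · simp only [Pi.sub_apply, Pi.single_eq_same, if_true]
      rw [← zpow_one_add₀ (hz l)]
      congr 1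
      ring
    · simp [hl]
  rw [Finset.prod_congr rfl fun l _ => h1 l, Finset.prod_mul_distrib]
  simp

section

variable {U : Type*} [NormedAddCommGroup U] [NormedSpace ℂ U]

theorem hasSum_quad {z : Fin n → ℂ} (hz : ∀ i, z i ≠ 0) {K : (Fin n → ℤ) → U} {F : U}
    (hK : HasSum (fun p => (∏ i, z i ^ p i) • K p) F) :
    HasSum (fun p => (∏ i, z i ^ p i) • quad A K p) ((∑ i, ∑ j, (A i j : ℂ) * (z i * z j)) • F) := by
  have h1 : ∀ i j, HasSum (fun p : Fin n → ℤ => (∏ i, z i ^ p i) •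
      K (p - Pi.single i 1 - Pi.single j 1)) ((z i * z j) • F) := by
    intro i j
    have h2 := ((Equiv.subRight (Pi.single i 1 + Pi.single j 1 : Fin n → ℤ)).hasSum_iff.2
      hK).const_smul (z i * z j)
    refine h2.congr_fun fun p => ?_
    rw [prod_zpow_sub_single hz p i, prod_zpow_sub_single hz _ j, Function.comp, smul_smul,
      Equiv.subRight_apply, sub_sub, mul_assoc]
  have h3 := hasSum_sum (s := Finset.univ) fun i _ => hasSum_sum (s := Finset.univ) fun j _ =>
    (h1 i j).const_smul (A i j : ℂ)
  simp only [smul_smul, ← Finset.sum_smul] at h3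
  refine h3.congr_fun fun p => ?_
  simp only [quad, Finset.smul_sum, smul_smul, mul_comm]

theorem hasSum_quad_iterate {z : Fin n → ℂ} (hz : ∀ i, z i ≠ 0) {K : (Fin n → ℤ) → U} {F : U}
    (hK : HasSum (fun p => (∏ i, z i ^ p i) • K p) F) (l : ℕ) :
    HasSum (fun p => (∏ i, z i ^ p i) • (quad A)^[l] K p)
      ((∑ i, ∑ j, (A i j : ℂ) * (z i * z j)) ^ l • F) := by
  induction l with
  | zero => simpa using hK
  | succ l ih =>
    rw [Function.iterate_succ_apply', pow_succ', mul_smul]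
    exact hasSum_quad A hz ih

/-- On ℓ¹ multiplication by the quadratic form has norm at most ∑ |a_{ij}|, so its exponential
series converges there. -/
theorem hasSum_norm_quad {K : (Fin n → ℤ) → U} (hK : Summable fun p => ‖K p‖) :
    Summable (fun p => ‖quad A K p‖) ∧
      ∑' p, ‖quad A K p‖ ≤ (∑ i, ∑ j, |A i j|) * ∑' p, ‖K p‖ := by
  have h1 : ∀ i j, HasSum (fun p : Fin n → ℤ => ‖K (p - Pi.single i 1 - Pi.single j 1)‖)
      (∑' p, ‖K p‖) := by
    intro i j
    have h2 := (Equiv.subRight (Pi.single i 1 + Pi.single j 1 : Fin n → ℤ)).hasSum_iff.2 hK.hasSum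
    refine h2.congr_fun fun p => ?_
    rw [Function.comp, Equiv.subRight_apply, sub_sub]
  have h3 := hasSum_sum (s := Finset.univ) fun i _ => hasSum_sum (s := Finset.univ) fun j _ =>
    (h1 i j).mul_left |A i j|
  simp only [← Finset.sum_mul] at h3
  have h4 : ∀ p, ‖quad A K p‖ ≤
      ∑ i, ∑ j, |A i j| * ‖K (p - Pi.single i 1 - Pi.single j 1)‖ := fun p =>
    (norm_sum_le _ _).trans (Finset.sum_le_sum fun i _ => (norm_sum_le _ _).trans
      (Finset.sum_le_sum fun j _ => by rw [norm_smul, Complex.norm_real, Real.norm_eq_abs]))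
  have h5 := Summable.of_nonneg_of_le (fun _ => norm_nonneg _) h4 h3.summable
  exact ⟨h5, hasSum_le h4 h5.hasSum h3⟩

theorem hasSum_norm_quad_iterate {K : (Fin n → ℤ) → U} (hK : Summable fun p => ‖K p‖) (l : ℕ) :
    Summable (fun p => ‖(quad A)^[l] K p‖) ∧
      ∑' p, ‖(quad A)^[l] K p‖ ≤ (∑ i, ∑ j, |A i j|) ^ l * ∑' p, ‖K p‖ := by
  induction l with
  | zero => simpa using hK
  | succ l ih =>
    obtain ⟨h1, h2⟩ := hasSum_norm_quad A ih.1
    rw [Function.iterate_succ_apply']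
    refine ⟨h1, h2.trans ?_⟩
    rw [pow_succ', mul_assoc]
    exact mul_le_mul_of_nonneg_left ih.2
      (Finset.sum_nonneg fun i _ => Finset.sum_nonneg fun j _ => abs_nonneg _)

/-- The coefficients of the product of a series with `exp (w ∑ a_{ij} z_i z_j)`. -/
theorem hasSum_exp_quad [FiniteDimensional ℂ U] {z : Fin n → ℂ} (hz : ∀ i, ‖z i‖ = 1)
    {K : (Fin n → ℤ) → U} {F : U}
    (hK : HasSum (fun p => (∏ i, z i ^ p i) • K p) F) (h0 : ∀ q, ∑ i, q i < 0 → K q = 0) (w : ℂ) :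
    HasSum (fun p : Fin n → ℤ => (∏ i, z i ^ p i) •
        ∑ l ∈ Finset.range ((∑ i, p i).toNat + 1), (w ^ l / l.factorial) • (quad A)^[l] K p)
      (Complex.exp (w * ∑ i, ∑ j, (A i j : ℂ) * (z i * z j)) • F) := by
  have := FiniteDimensional.complete ℂ U
  have hz0 : ∀ i, z i ≠ 0 := fun i h => by simpa [h] using hz i
  have hz1 : ∀ p : Fin n → ℤ, ‖∏ i, z i ^ p i‖ = 1 := fun p => by simp [norm_prod, hz]
  have hKn : Summable fun p => ‖K p‖ := by
    simpa [norm_smul, hz1] using hK.summable.norm_of_finiteDimensional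
  set B := ∑ i, ∑ j, (A i j : ℂ) * (z i * z j) with hB
  set C := ∑ i, ∑ j, |A i j| with hC
  set g : ℕ × (Fin n → ℤ) → U := fun x =>
    (w ^ x.1 / x.1.factorial) • (∏ i, z i ^ x.2 i) • (quad A)^[x.1] K x.2 with hg
  have hl : ∀ l, HasSum (fun p => g (l, p)) (((w * B) ^ l / l.factorial) • F) := by
    intro l
    have h1 := (hasSum_quad_iterate A hz0 hK l).const_smul (w ^ l / l.factorial : ℂ)
    rw [smul_smul] at h1
    convert h1 using 2
    rw [mul_pow]
    ring
  have hn : ∀ x, ‖g x‖ = ‖w‖ ^ x.1 / x.1.factorial * ‖(quad A)^[x.1] K x.2‖ := by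
    intro x
    simp [hg, norm_smul, hz, norm_prod]
  have hsum : Summable g := by
    refine Summable.of_norm ((summable_prod_of_nonneg fun _ => norm_nonneg _).2 ⟨fun l => ?_, ?_⟩)
    · simp only [hn]
      exact (hasSum_norm_quad_iterate A hKn l).1.mul_left _
    · simp only [hn, tsum_mul_left]
      refine Summable.of_nonneg_of_le
        (fun l => mul_nonneg (by positivity) (tsum_nonneg fun p => norm_nonneg _)) (fun l => ?_)
        ((Real.summable_pow_div_factorial (‖w‖ * C)).mul_right (∑' p, ‖K p‖))
      calc _ ≤ ‖w‖ ^ l / l.factorial * (C ^ l * ∑' p, ‖K p‖) :=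
            mul_le_mul_of_nonneg_left (hasSum_norm_quad_iterate A hKn l).2 (by positivity)
        _ = _ := by rw [mul_pow]; ring
  have hexp : HasSum (fun l : ℕ => ((w * B) ^ l / l.factorial) • F) (Complex.exp (w * B) • F) := by
    rw [Complex.exp_eq_exp_ℂ]
    exact (NormedSpace.expSeries_div_hasSum_exp (w * B)).smul_const F
  have htot : HasSum g (Complex.exp (w * B) • F) := by
    rw [← (hsum.hasSum.prod_fiberwise hl).unique hexp]
    exact hsum.hasSum
  -- The double series is now summed by p. For each p only finitely many l contribute, because K has
  -- no terms of negative degree.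
  refine HasSum.prod_fiberwise ((Equiv.prodComm _ _).hasSum_iff.2 htot) fun p => ?_
  rw [Finset.smul_sum]
  simp only [smul_comm (∏ i, z i ^ p i)]
  refine hasSum_sum_of_ne_finset_zero fun l hl => ?_
  rw [Finset.mem_range] at hl
  change (w ^ l / l.factorial) • (∏ i, z i ^ p i) • (quad A)^[l] K p = 0
  rw [quad_iterate_eq_zero A h0 (by omega), smul_zero, smul_zero]

end

end FormalSeries

/-! ### The slash action on Taylor series -/

section Slash

variable {W : Type*} [NormedAddCommGroup W] [NormedSpace ℂ W] [FiniteDimensional ℂ W]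
variable {V : Type*} [AddCommGroup V] [Module ℝ V] {n : ℕ} {Λ : IntegralLattice V}

theorem prod_zpow_eq_zpow_sum {ι : Type*} {a : ℂ} (ha : a ≠ 0) (s : Finset ι) (f : ι → ℤ) :
    ∏ i ∈ s, a ^ f i = a ^ ∑ i ∈ s, f i := by
  classical
  induction s using Finset.induction_on with
  | empty => simp
  | insert i s hi ih => rw [Finset.prod_insert hi, Finset.sum_insert hi, ih, zpow_add₀ ha]

theorem eexp_zpow_prod (y : Fin n → ℝ) (p : Fin n → ℤ) :
    ∏ i, eexp (y i) ^ p i = ∏ i, eexp (p i * y i) := by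
  refine Finset.prod_congr rfl fun i _ => ?_
  rw [eexp, ← Complex.exp_int_mul, eexp]
  congr 1
  ring

/-- The element `(γ, [0, 0], 1)` of the Jacobi group. -/
def JacobiGroup.ofMp (Λ : IntegralLattice V) (γ : Mp2Z) : JacobiGroup Λ := ⟨γ, 1⟩

theorem QC_sum (b : Basis (Fin n) ℝ V) (z : Fin n → ℂ) :
    Λ.QC (∑ i, z i ⊗ₜ[ℝ] b i) = (∑ i, ∑ j, (Λ.form (b i) (b j) : ℂ) * (z i * z j)) / 2 := by
  rw [IntegralLattice.QC]
  congr 1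
  simp only [map_sum, LinearMap.sum_apply, formC_tmul]
  rw [Finset.sum_comm]
  refine Finset.sum_congr rfl fun i _ => Finset.sum_congr rfl fun j _ => ?_
  ring

theorem jacobiSlash_ofMp (κ : ℤ) (γ : Mp2Z) (φ : ℍ → Cplx V → W) (τ : ℍ) (z : Cplx V) :
    jacobiSlash κ (JacobiGroup.ofMp Λ γ) φ τ z =
      (γ.root τ ^ (-κ) * eexp (-(((γ.mat 1 0 : ℤ) : ℂ) / jfac γ.mat τ) * Λ.QC z)) •
        φ (γ.mat • τ) ((jfac γ.mat τ)⁻¹ • z) := by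
  have h1 : heisTranslate ((0 : V), (0 : V)) τ z = z := by simp [heisTranslate]
  simp [jacobiSlash, jacobiFactor, JacobiGroup.ofMp, h1, IntegralLattice.Q]

/-- Both sides are coefficients of series with the same sum at every z on the torus |z_i| = 1, so
they agree by uniqueness of Fourier coefficients. The factor e(-c Q(z)/(cτ+d)) becomes the
exponential of the quadratic form. -/
theorem taylorSeries_jacobiSlash (b : Basis (Fin n) ℝ V) (κ : ℤ) (γ : Mp2Z)
    {φ : ℍ → Cplx V → W} {X X' : Type*} {t : X → V} {t' : X' → V}
    (hφ : ∀ τ, ∃ a : X → W, ZSum Λ t a (φ τ))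
    (hφ' : ∀ τ, ∃ a : X' → W, ZSum Λ t' a (jacobiSlash κ (JacobiGroup.ofMp Λ γ) φ τ)) :
    taylorSeries b (jacobiSlash κ (JacobiGroup.ofMp Λ γ) φ) =
      FormalSeries.fslash (Matrix.of fun i j => Λ.form (b i) (b j)) κ γ (taylorSeries b φ) := by
  set A : Matrix (Fin n) (Fin n) ℝ := Matrix.of fun i j => Λ.form (b i) (b j) with hA
  suffices h : ∀ τ, (fun p => taylorSeries b (jacobiSlash κ (JacobiGroup.ofMp Λ γ) φ) p τ -
      FormalSeries.fslash A κ γ (taylorSeries b φ) p τ) = 0 by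
    funext p τ
    exact sub_eq_zero.1 (congrFun (h τ) p)
  intro τ
  have hj0 := jfac_ne_zero γ.mat τ
  set j := jfac γ.mat τ with hj
  obtain ⟨a, ha⟩ := hφ (γ.mat • τ)
  obtain ⟨a', ha'⟩ := hφ' τ
  refine eq_zero_of_hasSum_prod_eexp (m := fun p : Fin n → ℤ => p) Function.injective_id fun y => ?_
  set z : Fin n → ℂ := fun i => eexp (y i) with hz
  have hz1 : ∀ i, ‖z i‖ = 1 := fun i => by simp [hz, norm_eexp]
  have h1 := hasSum_taylorSeries ha' b z
  -- These are the coefficients after the substitution z ↦ z/(cτ+d). The substitution contributes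
  -- (cτ+d)^{-s(q)}, and (cτ+d)^{l-s(p)} results in the l-th term, where s(q) = s(p) - 2l.
  set K : (Fin n → ℤ) → W := fun p => j ^ (-∑ i, p i) • taylorSeries b φ p (γ.mat • τ) with hK
  have h2 : HasSum (fun p : Fin n → ℤ => (∏ i, z i ^ p i) • K p)
      (φ (γ.mat • τ) (j⁻¹ • ∑ i, z i ⊗ₜ[ℝ] b i)) := by
    have h3 := hasSum_taylorSeries ha b fun i => j⁻¹ * z i
    rw [Finset.smul_sum]
    simp only [TensorProduct.smul_tmul', smul_eq_mul]
    refine h3.congr_fun fun p => ?_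
    rw [hK, smul_smul]
    congr 1
    simp only [mul_zpow, Finset.prod_mul_distrib, inv_zpow', mul_comm]
    congr 1
    rw [← Finset.sum_neg_distrib]
    exact (prod_zpow_eq_zpow_sum hj0 _ fun i => -p i).symm
  have hK0 : ∀ q : Fin n → ℤ, ∑ i, q i < 0 → K q = 0 := fun q hq => by
    simp [hK, taylorSeries_eq_zero_of_neg b φ hq]
  have h4 := (FormalSeries.hasSum_exp_quad A hz1 h2 hK0
    (FormalSeries.slashConst γ / j)).const_smul (γ.root τ ^ (-κ))
  have h5 : γ.root τ ^ (-κ) • Complex.exp (FormalSeries.slashConst γ / j *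
      ∑ i, ∑ k, (A i k : ℂ) * (z i * z k)) • φ (γ.mat • τ) (j⁻¹ • ∑ i, z i ⊗ₜ[ℝ] b i) =
      jacobiSlash κ (JacobiGroup.ofMp Λ γ) φ τ (∑ i, z i ⊗ₜ[ℝ] b i) := by
    rw [jacobiSlash_ofMp, smul_smul, QC_sum, eexp]
    congr 3
    simp only [hA, Matrix.of_apply, FormalSeries.slashConst]
    ring
  rw [h5] at h4
  have h6 := h1.sub h4
  rw [sub_self] at h6
  refine h6.congr_fun fun p => ?_
  rw [← eexp_zpow_prod, smul_sub, smul_comm (γ.root τ ^ (-κ))]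
  congr 2
  rw [FormalSeries.fslash, Finset.smul_sum]
  refine Finset.sum_congr rfl fun l _ => ?_
  have h7 := FormalSeries.quad_iterate_degree_smul A (fun s => j ^ (-s))
    (fun q => taylorSeries b φ q (γ.mat • τ)) l p
  have h8 : (FormalSeries.quad A)^[l] (fun q => taylorSeries b φ q (γ.mat • τ)) p =
      (FormalSeries.quad A)^[l] (taylorSeries b φ) p (γ.mat • τ) :=
    FormalSeries.quad_iterate_map A (LinearMap.proj (γ.mat • τ)) (taylorSeries b φ) l p
  rw [hK, h7, h8, FormalSeries.slashTerm]
  simp only [smul_smul]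
  congr 1
  rw [div_pow, show (l : ℤ) - ∑ i, p i = -(∑ i, p i - 2 * l) - l by ring, zpow_sub₀ hj0,
    zpow_natCast]
  ring

end Slash

/-! ### The operators `D_{k,p}` on sums of exponentials -/

section TaylorD

variable {W : Type*} [NormedAddCommGroup W] [NormedSpace ℂ W] [FiniteDimensional ℂ W]
variable {V : Type*} [AddCommGroup V] [Module ℝ V] {n : ℕ} {Λ : IntegralLattice V}

/-- `φ(τ, z) = ∑ c_x e(ν_x τ + B(t_x, z))`. -/
def JacobiSum (Λ : IntegralLattice V) {X : Type*} (ν : X → ℝ) (t : X → V) (c : X → W)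
    (φ : ℍ → Cplx V → W) : Prop :=
  ∀ (τ : ℍ) (z : Cplx V),
    HasSum (fun x => eexp (ν x * τ + Λ.formC ((1 : ℂ) ⊗ₜ[ℝ] t x) z) • c x) (φ τ z)

variable {X : Type*} {ν : X → ℝ} {t : X → V} {c c' : X → W} {φ ψ : ℍ → Cplx V → W}

theorem JacobiSum.zSum (H : JacobiSum Λ ν t c φ) (τ : ℍ) :
    ZSum Λ t (fun x => eexp (ν x * τ) • c x) (φ τ) := fun z =>
  (H τ z).congr_fun fun x => by rw [smul_smul, ← eexp_add, add_comm]

theorem JacobiSum.add (H : JacobiSum Λ ν t c φ) (H' : JacobiSum Λ ν t c' ψ) :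
    JacobiSum Λ ν t (c + c') (φ + ψ) := fun τ z =>
  ((H τ z).add (H' τ z)).congr_fun fun x => by rw [Pi.add_apply, smul_add]

theorem JacobiSum.map {W' : Type*} [NormedAddCommGroup W'] [NormedSpace ℂ W'] (T : W →ₗ[ℂ] W')
    (H : JacobiSum Λ ν t c φ) :
    JacobiSum Λ ν t (fun x => T (c x)) (fun τ z => T (φ τ z)) := fun τ z =>
  ((LinearMap.toContinuousLinearMap T).hasSum (H τ z)).congr_fun fun x => by simp

theorem JacobiSum.tauSum_partialPow (H : JacobiSum Λ ν t c φ) (b : Basis (Fin n) ℝ V)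
    (p : Fin n → ℕ) :
    TauSum ν (fun x => (∏ i, (2 * Real.pi * Complex.I * Λ.form (t x) (b i) : ℂ) ^ p i) • c x)
      (fun τ => partialPow b p (φ τ) 0) := fun τ =>
  ((H.zSum τ).partialPow_zero b p).congr_fun fun _ => smul_comm _ _ _

/-- The `p`-th Taylor coefficient of `e(B(t, z))`. -/
def expCoeff (Λ : IntegralLattice V) (b : Basis (Fin n) ℝ V) (t : V) (p : Fin n → ℤ) : ℂ :=
  if ∀ i, 0 ≤ p i then ((∏ i, (p i).toNat.factorial : ℕ) : ℂ)⁻¹ *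
    ∏ i, (2 * Real.pi * Complex.I * Λ.form t (b i) : ℂ) ^ (p i).toNat else 0

theorem JacobiSum.tauSum_taylorSeries (H : JacobiSum Λ ν t c φ) (b : Basis (Fin n) ℝ V)
    (p : Fin n → ℤ) :
    TauSum ν (fun x => expCoeff Λ b (t x) p • c x) (taylorSeries b φ p) := by
  intro τ
  simp only [expCoeff, taylorSeries]
  split_ifs
  · refine ((H.tauSum_partialPow b (fun i => (p i).toNat) τ).const_smul _).congr_fun fun x => ?_
    simp only [smul_smul]
    congr 1
    ring
  · simp

/-- The coefficient of `e(ντ)` in the image under `D_{k,p}` of `e(ντ + B(t, z))`. -/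
def taylorDCoeff (Λ : IntegralLattice V) (b : Basis (Fin n) ℝ V) (κ : ℤ) (p : Fin n → ℕ)
    (ν : ℝ) (t : V) : ℂ :=
  FormalSeries.symRaiseOp (Matrix.of fun i j => Λ.form (b i) (b j)) κ ν p
    (fun q => if (∑ i, q i) ≡ ∑ i, (p i : ℤ) [ZMOD 2] then expCoeff Λ b t q else 0) 0

/-- The term n = 0, t = 0 is constant in both variables, so its Taylor series is concentrated at
exponent 0. For odd s(p) the parity condition removes it; for even s(p) > 0 the first heat operator
does. This is the source of the cusp condition. -/
theorem taylorDCoeff_zero (b : Basis (Fin n) ℝ V) (κ : ℤ) {p : Fin n → ℕ} (hp : p ≠ 0) :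
    taylorDCoeff Λ b κ p 0 0 = 0 := by
  have h1 : ∀ q : Fin n → ℤ, q ≠ 0 → expCoeff Λ b 0 q = 0 := by
    intro q hq
    rw [expCoeff]
    split_ifs with h
    · obtain ⟨i, hi⟩ := Function.ne_iff.1 hq
      have : (q i).toNat ≠ 0 := by
        have := h i
        simp only [Pi.zero_apply] at hi
        omega
      exact mul_eq_zero_of_right _ (Finset.prod_eq_zero (Finset.mem_univ i) (by simp [this]))
    · rfl
  refine FormalSeries.symRaiseOp_zero _ κ hp (fun q hq => ?_) fun hodd => ?_
  · simp [h1 q hq]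
  · funext q
    by_cases hq : q = 0
    · have : ¬ ((∑ i, q i) ≡ ∑ i, (p i : ℤ) [ZMOD 2]) := by
        obtain ⟨m, hm⟩ := hodd
        have hm' : ∑ i, (p i : ℤ) = 2 * m + 1 := by exact_mod_cast hm
        rw [hm', hq]
        simp only [Pi.zero_apply, Finset.sum_const_zero, Int.ModEq]
        omega
      simp [this]
    · simp [h1 q hq]

/-- The operator is diagonal on exponentials, with eigenvalues independent of the coefficients.
Additivity, compatibility with linear maps of W, holomorphy and the Fourier expansion of the image
are all read off from this. -/
theorem JacobiSum.tauSum_taylorD (H : JacobiSum Λ ν t c φ) (b : Basis (Fin n) ℝ V) (κ : ℤ)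
    (p : Fin n → ℕ) :
    TauSum ν (fun x => taylorDCoeff Λ b κ p (ν x) (t x) • c x) (taylorD Λ b κ p φ) := by
  refine FormalSeries.tauSum_raiseOp _ κ p (fun q => ?_) 0
  simp only [FormalSeries.parityPart]
  split_ifs
  · exact H.tauSum_taylorSeries b q
  · intro τ
    simp

theorem TauSum.unique {h h' : ℍ → W} (H : TauSum ν c h) (H' : TauSum ν c h') : h = h' :=
  funext fun τ => (H τ).unique (H' τ)

theorem JacobiSum.taylorD_add (H : JacobiSum Λ ν t c φ) (H' : JacobiSum Λ ν t c' ψ)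
    (b : Basis (Fin n) ℝ V) (κ : ℤ) (p : Fin n → ℕ) :
    taylorD Λ b κ p (φ + ψ) = taylorD Λ b κ p φ + taylorD Λ b κ p ψ := by
  refine ((H.add H').tauSum_taylorD b κ p).unique fun τ => ?_
  refine ((H.tauSum_taylorD b κ p τ).add (H'.tauSum_taylorD b κ p τ)).congr_fun fun x => ?_
  simp [smul_add]

theorem JacobiSum.taylorD_map (H : JacobiSum Λ ν t c φ) (T : W →ₗ[ℂ] W)
    (b : Basis (Fin n) ℝ V) (κ : ℤ) (p : Fin n → ℕ) :
    taylorD Λ b κ p (fun τ z => T (φ τ z)) = fun τ => T (taylorD Λ b κ p φ τ) := by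
  refine ((H.map T).tauSum_taylorD b κ p).unique fun τ => ?_
  refine ((LinearMap.toContinuousLinearMap T).hasSum (H.tauSum_taylorD b κ p τ)).congr_fun
    fun x => ?_
  simp

theorem JacobiSum.taylorD_jacobiSlash {X' : Type*} {ν' : X' → ℝ} {t' : X' → V} {c' : X' → W}
    {κ : ℤ} {γ : Mp2Z} (H : JacobiSum Λ ν t c φ)
    (H' : JacobiSum Λ ν' t' c' (jacobiSlash κ (JacobiGroup.ofMp Λ γ) φ))
    (b : Basis (Fin n) ℝ V) (p : Fin n → ℕ) :
    taylorD Λ b κ p (jacobiSlash κ (JacobiGroup.ofMp Λ γ) φ) =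
      modSlash (κ + 2 * ∑ i, (p i : ℤ)) γ (taylorD Λ b κ p φ) := by
  have := FiniteDimensional.complete ℂ W
  rw [taylorD, taylorSeries_jacobiSlash b κ γ (fun τ => ⟨_, H.zSum τ⟩) fun τ => ⟨_, H'.zSum τ⟩]
  exact FormalSeries.raiseOp_fslash _ κ γ p (fun q => (H.tauSum_taylorSeries b q).isHolMod)
    fun q hq => taylorSeries_eq_zero_of_neg b φ hq

theorem HasJacobiExpansion.exists_jacobiSum {P : ℚ → V → Prop} (H : HasJacobiExpansion Λ P φ) :
    ∃ c : ℚ × V → W, JacobiSum Λ (fun x => (x.1 : ℝ)) Prod.snd c φ := by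
  obtain ⟨c, _, _, h⟩ := H
  exact ⟨fun x => c x.1 x.2, fun τ z => by simpa using h τ z⟩

/-- Terms with equal n are collected over t, so every exponent of the image comes from some (n, t)
in the original expansion. For p ≠ 0 the pair (0, 0) does not count, its factor being zero. -/
theorem HasJacobiExpansion.hasModExpansion_taylorD {P : ℚ → V → Prop}
    (H : HasJacobiExpansion Λ P φ) (b : Basis (Fin n) ℝ V) (κ : ℤ) (p : Fin n → ℕ) :
    HasModExpansion (fun m => ∃ t, P m t ∧ (p ≠ 0 → m = 0 → t ≠ 0)) (taylorD Λ b κ p φ) := by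
  have := FiniteDimensional.complete ℂ W
  obtain ⟨c, ⟨N, hN, hc⟩, hP, h⟩ := H
  have hJ : JacobiSum Λ (fun x : ℚ × V => (x.1 : ℝ)) Prod.snd (fun x => c x.1 x.2) φ :=
    fun τ z => by simpa using h τ z
  have hT := hJ.tauSum_taylorD b κ p
  set r : ℚ → V → W := fun m t => taylorDCoeff Λ b κ p m t • c m t with hr
  have hr0 : ∀ m, (∑' t, r m t) ≠ 0 → ∃ t, r m t ≠ 0 := by
    intro m hm
    by_contra! h0
    exact hm (by simp [h0])
  have hrc : ∀ {m t}, r m t ≠ 0 → c m t ≠ 0 := fun h h' => h (by simp [hr, h'])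
  refine ⟨fun m => ∑' t, r m t, ⟨N, hN, fun m hm => ?_⟩, fun m hm => ?_, fun τ => ?_⟩
  · obtain ⟨t, ht⟩ := hr0 m hm
    exact (hc m t (hrc ht)).1
  · obtain ⟨t, ht⟩ := hr0 m hm
    refine ⟨t, hP m t (hrc ht), fun hp hm0 ht0 => ht ?_⟩
    subst hm0 ht0
    simp only [hr, Rat.cast_zero, taylorDCoeff_zero b κ hp, zero_smul]
  · have h1 := hT τ
    refine h1.prod_fiberwise fun m => ?_
    have h2 := h1.summable.prod_factor m
    -- The common nonzero factor e(mτ) is divided out, so the coefficient series converges and does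
    -- not depend on τ.
    have h3 : Summable (r m) := by
      refine (h2.const_smul (eexp (((m : ℝ) : ℂ) * τ))⁻¹).congr fun t => ?_
      rw [smul_smul, inv_mul_cancel₀ (eexp_ne_zero _), one_smul]
    have h4 := h3.hasSum.const_smul (eexp ((m : ℂ) * τ))
    refine h4.congr_fun fun t => ?_
    simp [hr]

theorem HasModExpansion.mono {P P' : ℚ → Prop} {h : ℍ → W} (H : HasModExpansion P h)
    (hP : ∀ m, P m → P' m) : HasModExpansion P' h := by
  obtain ⟨c, h1, h2, h3⟩ := H
  exact ⟨c, h1, fun m hm => hP m (h2 m hm), h3⟩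

/-! ### Images of Jacobi forms -/

theorem JacobiGroup.ofMp_mem_sub (γ : Mp2Z) : JacobiGroup.ofMp Λ γ ∈ JacobiGroup.sub Λ ⊤ :=
  ⟨Subgroup.mem_top _, ⟨Λ.lattice.zero_mem, Λ.lattice.zero_mem⟩, by simp [JacobiGroup.ofMp]⟩

theorem jacobiSlash_one (κ : ℤ) (φ : ℍ → Cplx V → W) :
    jacobiSlash κ (JacobiGroup.ofMp Λ 1) φ = φ := by
  funext τ z
  simp [jacobiSlash_ofMp, jfac_one]

variable {G : Subgroup SL(2, ℤ)} {ρ : JacobiGroup.sub Λ G →* (W ≃ₗ[ℂ] W)} {κ : ℤ}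

/-- φ|γ = ρ(γ) ∘ φ, and the operator commutes both with slashing by γ and with the constant linear
map ρ(γ). -/
theorem taylorD_mem_modHol (hφ : φ ∈ jacobiHol κ Λ G ρ)
    (hE : ∀ γ, ∃ c : ℚ × V → W, JacobiSum Λ (fun x => (x.1 : ℝ)) Prod.snd c
      (jacobiSlash κ (JacobiGroup.ofMp Λ γ) φ))
    (b : Basis (Fin n) ℝ V) (p : Fin n → ℕ) :
    taylorD Λ b κ p φ ∈ modHol (κ + 2 * ∑ i, (p i : ℤ)) G (ρ.comp (JacobiGroup.ofCover Λ G)) := by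
  obtain ⟨c, hc⟩ := hE 1
  rw [jacobiSlash_one] at hc
  refine ⟨(hc.tauSum_taylorD b κ p).isHolMod, fun γ => ?_⟩
  obtain ⟨c', hc'⟩ := hE γ
  rw [← hc.taylorD_jacobiSlash hc' b p]
  have h1 : jacobiSlash κ (JacobiGroup.ofMp Λ (γ : Mp2Z)) φ =
      fun τ z => ρ (JacobiGroup.ofCover Λ G γ) (φ τ z) := hφ.2 (JacobiGroup.ofCover Λ G γ)
  rw [h1]
  exact hc.taylorD_map (ρ (JacobiGroup.ofCover Λ G γ)).toLinearMap b κ p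

theorem taylorD_smul (hc : JacobiSum Λ ν t c φ) (b : Basis (Fin n) ℝ V) (p : Fin n → ℕ) (a : ℂ) :
    taylorD Λ b κ p (a • φ) = a • taylorD Λ b κ p φ := by
  have h := hc.taylorD_map (a • LinearMap.id) b κ p
  simp only [LinearMap.smul_apply, LinearMap.id_apply] at h
  rw [← Pi.smul_def] at h
  exact h

theorem exists_jacobiSum_of_mem_jacobiWHol (hφ : φ ∈ jacobiWHol κ Λ G ρ) (γ : Mp2Z) :
    ∃ c : ℚ × V → W, JacobiSum Λ (fun x => (x.1 : ℝ)) Prod.snd c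
      (jacobiSlash κ (JacobiGroup.ofMp Λ γ) φ) :=
  (hφ.2 _ (JacobiGroup.ofMp_mem_sub γ)).choose_spec.exists_jacobiSum

theorem jacobiWith_le_jacobiWHol {P : ℚ → V → Prop} (hP : ∀ m t, P m t → 0 ≤ m) :
    jacobiWith P κ Λ G ρ ≤ jacobiWHol κ Λ G ρ := by
  rintro φ ⟨h1, h2⟩
  refine ⟨h1, fun x hx => ⟨0, ?_⟩⟩
  obtain ⟨c, h3, h4, h5⟩ := h2 x hx
  exact ⟨c, h3, fun m t h => hP m t (h4 m t h), h5⟩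

theorem taylorD_mem_modWHol (hφ : φ ∈ jacobiWHol κ Λ G ρ) (b : Basis (Fin n) ℝ V)
    (p : Fin n → ℕ) :
    taylorD Λ b κ p φ ∈ modWHol (κ + 2 * ∑ i, (p i : ℤ)) G (ρ.comp (JacobiGroup.ofCover Λ G)) := by
  have hE := exists_jacobiSum_of_mem_jacobiWHol hφ
  refine ⟨taylorD_mem_modHol hφ.1 hE b p, fun γ => ?_⟩
  obtain ⟨N₀, hN⟩ := hφ.2 _ (JacobiGroup.ofMp_mem_sub γ)
  obtain ⟨c, hc⟩ := hE 1
  rw [jacobiSlash_one] at hc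
  refine ⟨N₀, ?_⟩
  rw [← hc.taylorD_jacobiSlash (hE γ).choose_spec b p]
  exact (hN.hasModExpansion_taylorD b κ p).mono fun m ⟨t, h, _⟩ => h

theorem taylorD_mem_modWith {P : ℚ → V → Prop} {P' : ℚ → Prop} (hP0 : ∀ m t, P m t → 0 ≤ m)
    {p : Fin n → ℕ} (hP : ∀ m t, P m t → (p ≠ 0 → m = 0 → t ≠ 0) → P' m)
    (hφ : φ ∈ jacobiWith P κ Λ G ρ) (b : Basis (Fin n) ℝ V) :
    taylorD Λ b κ p φ ∈
      modWith P' (κ + 2 * ∑ i, (p i : ℤ)) G (ρ.comp (JacobiGroup.ofCover Λ G)) := by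
  have hE := exists_jacobiSum_of_mem_jacobiWHol (jacobiWith_le_jacobiWHol hP0 hφ)
  refine ⟨taylorD_mem_modHol hφ.1 hE b p, fun γ => ?_⟩
  have hN := hφ.2 _ (JacobiGroup.ofMp_mem_sub γ)
  obtain ⟨c, hc⟩ := hE 1
  rw [jacobiSlash_one] at hc
  rw [← hc.taylorD_jacobiSlash (hE γ).choose_spec b p]
  exact (hN.hasModExpansion_taylorD b κ p).mono fun m ⟨t, h, h'⟩ => hP m t h h'

/-- `D_{k,p}` as a linear map on weakly holomorphic Jacobi forms. -/
def taylorDLinear (Λ : IntegralLattice V) (κ : ℤ) (G : Subgroup SL(2, ℤ))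
    (ρ : JacobiGroup.sub Λ G →* (W ≃ₗ[ℂ] W)) (b : Basis (Fin n) ℝ V) (p : Fin n → ℕ) :
    jacobiWHol κ Λ G ρ →ₗ[ℂ] (ℍ → W) where
  toFun φ := taylorD Λ b κ p φ.1
  map_add' φ ψ := by
    obtain ⟨c, hc⟩ := exists_jacobiSum_of_mem_jacobiWHol φ.2 1
    obtain ⟨c', hc'⟩ := exists_jacobiSum_of_mem_jacobiWHol ψ.2 1
    rw [jacobiSlash_one] at hc hc'
    exact hc.taylorD_add hc' b κ p
  map_smul' a φ := by
    obtain ⟨c, hc⟩ := exists_jacobiSum_of_mem_jacobiWHol φ.2 1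
    rw [jacobiSlash_one] at hc
    exact taylorD_smul hc b p a

end TaylorD

/-! ### Convergence of theta series -/

section ThetaConvergence

/-- Up to a constant factor, each term is the absolute value of a term of the Jacobi theta function
with Im τ = α/π and Im z = (β+2αs)/(2π). -/
theorem summable_exp_neg_quadratic {α : ℝ} (hα : 0 < α) (β s : ℝ) :
    Summable fun m : ℤ => Real.exp (-α * (s + m) ^ 2 - β * (s + m)) := by
  set z : ℂ := ((β + 2 * α * s) / (2 * Real.pi) : ℝ) * Complex.I with hz
  set τ : ℂ := (α / Real.pi : ℝ) * Complex.I with hτ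
  have hτ0 : 0 < τ.im := by simpa [hτ] using div_pos hα Real.pi_pos
  have h := ((summable_jacobiTheta₂_term_iff z τ).2 hτ0).norm.mul_left
    (Real.exp (-α * s ^ 2 - β * s))
  refine h.congr fun m => ?_
  rw [norm_jacobiTheta₂_term, ← Real.exp_add]
  congr 1
  have h1 : z.im = (β + 2 * α * s) / (2 * Real.pi) := by
    rw [hz, Complex.mul_I_im, Complex.ofReal_re]
  have h2 : τ.im = α / Real.pi := by rw [hτ, Complex.mul_I_im, Complex.ofReal_re]
  rw [h1, h2]
  have := Real.pi_ne_zero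
  field_simp
  ring

variable {V : Type*} [AddCommGroup V] [Module ℝ V] {n : ℕ} {Λ : IntegralLattice V}

theorem one_tmul_smul (r : ℝ) (x : V) :
    (1 : ℂ) ⊗ₜ[ℝ] (r • x) = (r : ℂ) • ((1 : ℂ) ⊗ₜ[ℝ] x : Cplx V) := by
  rw [← TensorProduct.smul_tmul, TensorProduct.smul_tmul']
  simp

/-- The positive continuous function Q has a positive lower bound on the compact unit sphere of the
coordinates; homogeneity gives the rest. -/
theorem exists_pos_le_Q (v : Basis (Fin n) ℝ V) :
    ∃ ε > 0, ∀ x : V, ε * ∑ i, v.repr x i ^ 2 ≤ Λ.Q x := by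
  set f : (Fin n → ℝ) → ℝ := fun c => Λ.Q (∑ i, c i • v i) with hf
  have hfc : Continuous f := by
    have : f = fun c => (∑ i, ∑ j, c i * (c j * Λ.form (v j) (v i))) / 2 := by
      funext c
      simp [hf, IntegralLattice.Q, Finset.mul_sum]
    rw [this]
    fun_prop
  have hcomp : IsCompact {c : Fin n → ℝ | ∑ i, c i ^ 2 = 1} := by
    refine Metric.isCompact_of_isClosed_isBounded
      (isClosed_eq (by fun_prop) continuous_const) ?_
    refine (Metric.isBounded_closedBall (x := (0 : Fin n → ℝ)) (r := 1)).subset fun c hc => ?_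
    rw [mem_closedBall_zero_iff, pi_norm_le_iff_of_nonneg zero_le_one]
    intro i
    have h1 : c i ^ 2 ≤ 1 := by
      rw [← (show ∑ i, c i ^ 2 = 1 from hc)]
      exact Finset.single_le_sum (f := fun i => c i ^ 2) (fun i _ => sq_nonneg _)
        (Finset.mem_univ i)
    rw [Real.norm_eq_abs]
    exact abs_le_one_iff_mul_self_le_one.2 (by nlinarith)
  have hne : ∀ c : Fin n → ℝ, c ≠ 0 → ∑ i, c i • v i ≠ 0 := by
    intro c hc h
    have h1 := congrArg v.equivFun h
    rw [map_zero, ← v.equivFun_symm_apply, LinearEquiv.apply_symm_apply] at h1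
    exact hc h1
  obtain ⟨ε, hε, hle⟩ := hcomp.exists_forall_le' hfc.continuousOn (a := 0) fun c hc => by
    refine half_pos (Λ.posDef _ (hne c fun h => ?_))
    rw [Set.mem_ofPred_eq, h] at hc
    simp at hc
  refine ⟨ε, hε, fun x => ?_⟩
  rcases eq_or_ne x 0 with rfl | hx
  · simp [IntegralLattice.Q]
  · set s := ∑ i, v.repr x i ^ 2 with hs
    have hs0 : 0 < s := by
      refine lt_of_le_of_ne (Finset.sum_nonneg fun i _ => sq_nonneg _) fun h => hx ?_
      have h1 := (Finset.sum_eq_zero_iff_of_nonneg fun i _ => sq_nonneg (v.repr x i)).1 h.symm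
      refine v.repr.map_eq_zero_iff.1 (Finsupp.ext fun i => ?_)
      simpa using h1 i (Finset.mem_univ i)
    have hr := Real.sqrt_pos.2 hs0
    have h1 := hle (fun i => (Real.sqrt s)⁻¹ * v.repr x i) (by
      simp only [Set.mem_ofPred_eq, mul_pow, ← Finset.mul_sum, inv_pow, Real.sq_sqrt hs0.le]
      exact inv_mul_cancel₀ hs0.ne')
    have h2 : f (fun i => (Real.sqrt s)⁻¹ * v.repr x i) = s⁻¹ * Λ.Q x := by
      simp only [hf, mul_smul, ← Finset.smul_sum, v.sum_repr, IntegralLattice.Q, map_smul,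
        LinearMap.smul_apply, smul_eq_mul]
      rw [← mul_assoc, ← mul_inv, Real.mul_self_sqrt hs0.le]
      ring
    rw [h2, ← div_eq_inv_mul, le_div_iff₀ hs0] at h1
    exact h1

/-- In coordinates of a lattice basis Q is bounded below by ε times the sum of squares and the
linear term is a sum over coordinates. The norms are therefore dominated by a product of
one-dimensional Gaussian series. -/
theorem summable_latticeTheta (t : V) (τ : ℍ) (z : Cplx V) :
    Summable fun v : Λ.lattice =>
      eexp (τ * (Λ.Q (t + v) : ℂ) + Λ.formC ((1 : ℂ) ⊗ₜ[ℝ] (t + v)) z) := by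
  obtain ⟨n, v, hv⟩ := Λ.exists_basis
  obtain ⟨ε, hε, hQ⟩ := exists_pos_le_Q (Λ := Λ) v
  have hm : ∀ u : Λ.lattice, ∃ m : Fin n → ℤ, ∑ i, m i • v i = (u : V) := fun u =>
    (Submodule.mem_span_range_iff_exists_fun ℤ).1 (hv ▸ u.2)
  choose m hm using hm
  have hinj : Function.Injective m := fun u w h => Subtype.ext (by rw [← hm, ← hm, h])
  have hrepr : ∀ (u : Λ.lattice) i, v.repr (t + (u : V)) i = v.repr t i + m u i := by
    intro u i
    have : (u : V) = ∑ i, (m u i : ℝ) • v i := by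
      rw [← hm]
      exact Finset.sum_congr rfl fun i _ => (Int.cast_smul_eq_zsmul ℝ _ _).symm
    rw [map_add, Finsupp.add_apply, this, v.repr_sum_self]
  set α := 2 * Real.pi * τ.im * ε with hα
  have hα0 : 0 < α := by have := τ.im_pos; have := Real.pi_pos; positivity
  set β : Fin n → ℝ := fun i => 2 * Real.pi * (Λ.formC ((1 : ℂ) ⊗ₜ[ℝ] v i) z).im with hβ
  have h1 := (hasSum_pi_prod (𝕜 := ℝ)
    (f := fun i (k : ℤ) => Real.exp (-α * (v.repr t i + k) ^ 2 - β i * (v.repr t i + k)))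
    (fun i => (summable_exp_neg_quadratic hα0 (β i) (v.repr t i)).hasSum)
    fun i => (summable_exp_neg_quadratic hα0 (β i) (v.repr t i)).norm).2.of_norm
  refine Summable.of_norm_bounded (h1.comp_injective hinj) fun u => ?_
  rw [norm_eexp, Function.comp, ← Real.exp_sum]
  refine Real.exp_le_exp.2 ?_
  have h2 : (Λ.formC ((1 : ℂ) ⊗ₜ[ℝ] (t + (u : V))) z).im =
      ∑ i, (v.repr t i + m u i) * (Λ.formC ((1 : ℂ) ⊗ₜ[ℝ] v i) z).im := by
    conv_lhs => rw [← v.sum_repr (t + (u : V))]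
    simp only [TensorProduct.tmul_sum, one_tmul_smul, map_sum, LinearMap.sum_apply, map_smul,
      LinearMap.smul_apply, smul_eq_mul, Complex.im_sum, Complex.im_ofReal_mul, hrepr]
  have h3 := hQ (t + (u : V))
  simp only [hrepr] at h3
  have h4 : (τ * (Λ.Q (t + (u : V)) : ℂ) : ℂ).im = τ.im * Λ.Q (t + (u : V)) := by
    simp [Complex.mul_im]
  rw [Complex.add_im, h4, h2, Finset.sum_sub_distrib, ← Finset.mul_sum]
  have h5 : ∑ i, β i * (v.repr t i + m u i) =
      2 * Real.pi * ∑ i, (v.repr t i + m u i) * (Λ.formC ((1 : ℂ) ⊗ₜ[ℝ] v i) z).im := by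
    rw [Finset.mul_sum]
    exact Finset.sum_congr rfl fun i _ => by simp only [hβ]; ring
  rw [h5, hα]
  have h6 := mul_le_mul_of_nonneg_left h3
    (mul_nonneg (mul_nonneg zero_le_two Real.pi_pos.le) τ.im_pos.le)
  linarith

theorem jacobiSum_latticeTheta (t : V) :
    JacobiSum Λ (fun v : Λ.lattice => Λ.Q (t + v)) (fun v => t + v) (fun _ => (1 : ℂ))
      (latticeTheta Λ t) := fun τ z => by
  have := (summable_latticeTheta (Λ := Λ) t τ z).hasSum
  simpa [latticeTheta, mul_comm] using this

theorem IsHolMod.continuous {W : Type*} [NormedAddCommGroup W] [NormedSpace ℂ W] {h : ℍ → W}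
    (hh : IsHolMod h) : Continuous h := by
  have h1 : h = fun τ : ℍ => h (UpperHalfPlane.ofComplex (τ : ℂ)) := by
    funext τ
    rw [UpperHalfPlane.ofComplex_apply]
  rw [h1]
  exact hh.continuousOn.comp_continuous UpperHalfPlane.continuous_coe fun τ => τ.im_pos

theorem continuous_thetaDet {d : ℕ} (b : Basis (Fin n) ℝ V) (p : Fin d → Fin n → ℕ)
    (t : Fin d → Λ.dual) : Continuous (thetaDet Λ b p t) := by
  refine Continuous.matrix_det (continuous_matrix fun i j => continuous_const.mul ?_)
  exact ((jacobiSum_latticeTheta (t j : V)).tauSum_partialPow b (p i)).isHolMod.continuous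

end ThetaConvergence

/-! ### Theta decomposition and injectivity -/

section Injectivity

variable {W : Type*} [NormedAddCommGroup W] [NormedSpace ℂ W]
variable {V : Type*} [AddCommGroup V] [Module ℝ V] {n : ℕ} {Λ : IntegralLattice V}

theorem lattice_le_dual {v : V} (hv : v ∈ Λ.lattice) : v ∈ Λ.dual :=
  mem_dual_iff.2 fun y hy => Λ.integral v hv y hy

theorem precClosure_mono_mem {P : Set (Fin n → ℕ)} {q q' : Fin n → ℕ} (hq : q ∈ precClosure P)
    (hle : q' ≤ q) (hs : (∑ i, q' i) ≡ (∑ i, q i) [MOD 2]) : q' ∈ precClosure P := by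
  obtain ⟨r, hr, h1, h2⟩ := hq
  exact ⟨r, hr, hle.trans h1, hs.trans h2⟩

/-- By strong induction on s(q): the closure contains every lower exponent of the same parity, so
those coefficients already vanish and triangularity isolates h_q. -/
theorem taylorSeries_eq_zero_of_taylorD [FiniteDimensional ℂ W] {κ : ℤ} (hκ : ∀ m : ℕ, κ ≠ -(2 * m))
    {φ : ℍ → Cplx V → W} (b : Basis (Fin n) ℝ V) {P : Set (Fin n → ℕ)}
    (h : ∀ q ∈ precClosure P, taylorD Λ b κ q φ = 0) :
    ∀ q ∈ precClosure P, taylorSeries b φ (fun i => (q i : ℤ)) = 0 := by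
  intro q
  induction hs : ∑ i, q i using Nat.strong_induction_on generalizing q with
  | _ s ih =>
    intro hq
    refine FormalSeries.apply_eq_zero_of_raiseOp _ hκ q (fun r hr hne hmod => ?_) (h q hq)
    -- Exponents with a negative entry also lie below q; there the Taylor coefficient is zero by
    -- definition.
    by_cases hr0 : ∀ i, 0 ≤ r i
    · lift r to Fin n → ℕ using hr0
      have hle : r ≤ q := fun i => Int.ofNat_le.1 (hr i)
      have hne' : r ≠ q := fun h => hne (by rw [h])
      have hlt : ∑ i, r i < ∑ i, q i := by
        obtain ⟨_, i, hi⟩ := Pi.lt_def.1 (lt_of_le_of_ne hle hne')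
        exact Finset.sum_lt_sum (fun i _ => hle i) ⟨i, Finset.mem_univ i, hi⟩
      refine ih _ (hs ▸ hlt) r rfl (precClosure_mono_mem hq hle ?_)
      rw [← Int.natCast_modEq_iff]
      push_cast
      exact hmod
    · funext τ
      simp only [taylorSeries, if_neg hr0, Pi.zero_apply]

theorem partialPow_eq_zero_of_taylorD [FiniteDimensional ℂ W] {κ : ℤ} (hκ : ∀ m : ℕ, κ ≠ -(2 * m))
    {φ : ℍ → Cplx V → W} (b : Basis (Fin n) ℝ V) {P : Set (Fin n → ℕ)}
    (h : ∀ q ∈ precClosure P, taylorD Λ b κ q φ = 0) (τ : ℍ) {q : Fin n → ℕ} (hq : q ∈ P) :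
    partialPow b q (φ τ) 0 = 0 := by
  have h1 := congrFun (taylorSeries_eq_zero_of_taylorD hκ b h q ⟨q, hq, le_rfl, rfl⟩) τ
  simp only [taylorSeries, Nat.cast_nonneg, implies_true, if_true, Int.toNat_natCast,
    Pi.zero_apply, smul_eq_zero, inv_eq_zero, Nat.cast_eq_zero] at h1
  exact h1.resolve_left (Finset.prod_ne_zero_iff.2 fun i _ => Nat.factorial_ne_zero _)

theorem ZSum.unique {N : ℕ} (hN : 0 < N) {a a' : V → W} {f : Cplx V → W}
    (ha : ∀ x, a x ≠ 0 → N • x ∈ Λ.dual) (ha' : ∀ x, a' x ≠ 0 → N • x ∈ Λ.dual)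
    (H : ZSum Λ id a f) (H' : ZSum Λ id a' f) : a = a' := by
  refine sub_eq_zero.1 (eq_zero_of_zsum_zero hN Function.injective_id (t := id) (Λ := Λ)
    (fun x hx => ?_) fun z => ?_)
  · by_cases h : a x = 0
    · exact ha' x fun h' => hx (by simp [h, h'])
    · exact ha x h
  · simpa [smul_sub] using (H z).sub (H' z)

theorem Q_add (x y : V) : Λ.Q (x + y) = Λ.Q x + Λ.form x y + Λ.Q y := by
  simp only [IntegralLattice.Q, map_add, LinearMap.add_apply, Λ.symm y x]
  ring

/-- Comparing Fourier coefficients at fixed τ: translation by v ∈ L forces e(B(s,v)) = 1 on the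
support, so s ∈ L♯. Translation by τv gives a(s+v) = e(τQ(v) + τB(s,v)) a(s), which says that
e(-τQ(s)) a(s) is L-periodic. -/
theorem ZSum.exists_periodic {τ : ℍ} {N : ℕ} (hN : 0 < N) {a : V → W} {f : Cplx V → W}
    (ha : ∀ x, a x ≠ 0 → N • x ∈ Λ.dual) (H : ZSum Λ id a f)
    (h1 : ∀ v ∈ Λ.lattice, ∀ z, f (z + (1 : ℂ) ⊗ₜ[ℝ] v) = f z)
    (h2 : ∀ v ∈ Λ.lattice, ∀ z,
      eexp (τ * (Λ.Q v : ℂ) + Λ.formC ((1 : ℂ) ⊗ₜ[ℝ] v) z) • f (z + (τ : ℂ) ⊗ₜ[ℝ] v) = f z) :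
    ∃ β : V → W, (∀ s, β s ≠ 0 → s ∈ Λ.dual) ∧ (∀ v ∈ Λ.lattice, ∀ s, β (s + v) = β s) ∧
      ZSum Λ id (fun s => eexp (τ * (Λ.Q s : ℂ)) • β s) f := by
  have hmul : ∀ s, eexp (τ * (Λ.Q s : ℂ)) * eexp (-(τ * (Λ.Q s : ℂ))) = 1 := fun s => by
    rw [← eexp_add, add_neg_cancel, eexp_zero]
  refine ⟨fun s => eexp (-(τ * (Λ.Q s : ℂ))) • a s, fun s hs => ?_, fun v hv s => ?_, ?_⟩
  · have hs' : a s ≠ 0 := fun h => hs (by simp [h])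
    refine mem_dual_iff.2 fun v hv => (eexp_eq_one_iff _).1 ?_
    have h3 : ZSum Λ id (fun x => eexp (Λ.form x v) • a x) f := fun z => by
      have h4 := H (z + (1 : ℂ) ⊗ₜ[ℝ] v)
      rw [h1 v hv] at h4
      refine h4.congr_fun fun x => ?_
      simp [smul_smul, ← eexp_add]
    have h4 := congrFun (H.unique hN ha (fun x hx => ha x fun h => hx (by simp [h])) h3) s
    have h5 : (1 - eexp (Λ.form s v)) • a s = 0 := by
      rw [sub_smul, one_smul, ← h4, sub_self]
    exact (sub_eq_zero.1 ((smul_eq_zero.1 h5).resolve_right hs')).symm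
  · have h3 : ZSum Λ id
        (fun x => eexp (τ * (Λ.Q v : ℂ) + τ * (Λ.form (x - v) v : ℂ)) • a (x - v)) f := fun z => by
      have h4 := (H (z + (τ : ℂ) ⊗ₜ[ℝ] v)).const_smul
        (eexp (τ * (Λ.Q v : ℂ) + Λ.formC ((1 : ℂ) ⊗ₜ[ℝ] v) z))
      rw [h2 v hv] at h4
      rw [← (Equiv.addRight v).hasSum_iff]
      refine h4.congr_fun fun x => ?_
      simp only [Function.comp, Equiv.coe_addRight, id, add_sub_cancel_right, smul_smul, ← eexp_add,
        map_add, TensorProduct.tmul_add, LinearMap.add_apply, formC_tmul]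
      congr 2
      ring
    have h4 := congrFun (H.unique hN ha (fun x hx => ?_) h3) (s + v)
    · simp only [add_sub_cancel_right] at h4
      simp only [h4, smul_smul, ← eexp_add, Q_add]
      congr 2
      push_cast
      ring
    · have h5 : a (x - v) ≠ 0 := fun h => hx (by simp [h])
      have h6 := add_mem (ha _ h5) (nsmul_mem (lattice_le_dual hv) N)
      rwa [← smul_add, sub_add_cancel] at h6
  · simpa only [smul_smul, hmul, one_smul] using H

/-- Every point of L♯ is uniquely a chosen representative plus a lattice vector, and nothing outside
L♯ contributes. -/
theorem hasSum_cosets {d : ℕ} {t : Fin d → Λ.dual}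
    (ht : Function.Bijective fun i => (Submodule.Quotient.mk (t i) : Λ.Discriminant))
    {E : Type*} [AddCommMonoid E] [TopologicalSpace E] {g : V → E} {e : E}
    (hg : ∀ s, g s ≠ 0 → s ∈ Λ.dual) (H : HasSum g e) :
    HasSum (fun x : Fin d × Λ.lattice => g (t x.1 + x.2)) e := by
  have hmk : ∀ x y : Λ.dual, (Submodule.Quotient.mk x : Λ.Discriminant) = Submodule.Quotient.mk y ↔
      (x : V) - y ∈ Λ.lattice := fun x y => by
    rw [Submodule.Quotient.eq]
    rfl
  refine (Function.Injective.hasSum_iff (g := fun x : Fin d × Λ.lattice => (t x.1 + x.2 : V))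
    ?_ ?_).2 H
  · rintro ⟨i, x⟩ ⟨j, y⟩ h
    have hij : i = j := ht.1 ((hmk _ _).2 (by
      have : (t i : V) - t j = y - x := by
        rw [sub_eq_sub_iff_add_eq_add, add_comm (y : V)]
        exact h
      rw [this]
      exact sub_mem y.2 x.2))
    subst hij
    exact Prod.ext rfl (Subtype.ext (add_left_cancel h))
  · intro s hs
    by_contra h
    obtain ⟨i, hi⟩ := ht.2 (Submodule.Quotient.mk ⟨s, hg s h⟩)
    exact hs ⟨(i, ⟨s - t i, (hmk _ _).1 hi.symm⟩), by simp⟩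

variable {d : ℕ} {t : Fin d → Λ.dual}

/-- Differentiating term by term and collecting each coset gives the derivative of the theta
decomposition; the absolute convergence needed is part of the `ZSum` machinery. -/
theorem partialPow_eq_sum_latticeTheta [FiniteDimensional ℂ W] {τ : ℍ} {f : Cplx V → W}
    {α : Fin d → W}
    (H : ZSum Λ (fun x : Fin d × Λ.lattice => (t x.1 + x.2 : V))
      (fun x => eexp (τ * (Λ.Q (t x.1 + x.2) : ℂ)) • α x.1) f)
    (b : Basis (Fin n) ℝ V) (p : Fin n → ℕ) :
    partialPow b p f 0 = ∑ j, partialPow b p (latticeTheta Λ (t j) τ) 0 • α j := by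
  have := FiniteDimensional.complete ℂ W
  refine (H.partialPow_zero b p).unique ?_
  have h1 := (H.partialPow_zero b p).summable.hasSum.prod_fiberwise fun j => by
    have h2 := ((jacobiSum_latticeTheta (Λ := Λ) (t j : V)).zSum τ).partialPow_zero b p
    refine (h2.smul_const (α j)).congr_fun fun x => ?_
    simp only [smul_smul, smul_eq_mul, mul_one]
    rw [mul_comm (τ : ℂ)]
  have h2 := (H.partialPow_zero b p).summable.hasSum
  rwa [h1.unique (hasSum_fintype _)] at h2

theorem eq_zero_of_thetaDet_ne_zero [FiniteDimensional ℂ W]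
    (ht : Function.Bijective fun i => (Submodule.Quotient.mk (t i) : Λ.Discriminant))
    (b : Basis (Fin n) ℝ V) {p : Fin d → Fin n → ℕ} {τ : ℍ} (hτ : thetaDet Λ b p t τ ≠ 0)
    {N : ℕ} (hN : 0 < N) {a : V → W} {f : Cplx V → W}
    (ha : ∀ x, a x ≠ 0 → N • x ∈ Λ.dual) (H : ZSum Λ id a f)
    (h1 : ∀ v ∈ Λ.lattice, ∀ z, f (z + (1 : ℂ) ⊗ₜ[ℝ] v) = f z)
    (h2 : ∀ v ∈ Λ.lattice, ∀ z,
      eexp (τ * (Λ.Q v : ℂ) + Λ.formC ((1 : ℂ) ⊗ₜ[ℝ] v) z) • f (z + (τ : ℂ) ⊗ₜ[ℝ] v) = f z)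
    (h0 : ∀ i, partialPow b (p i) f 0 = 0) : f = 0 := by
  obtain ⟨β, hβ, hper, Hβ⟩ := H.exists_periodic hN ha h1 h2
  have H' : ZSum Λ (fun x : Fin d × Λ.lattice => (t x.1 + x.2 : V))
      (fun x => eexp (τ * (Λ.Q (t x.1 + x.2) : ℂ)) • β (t x.1)) f := fun z => by
    refine (hasSum_cosets ht (fun s hs => hβ s fun h => hs (by simp [h])) (Hβ z)).congr_fun
      fun x => ?_
    simp only [id, hper _ x.2.2]
  have hα : ∀ j, β (t j) = 0 := by
    intro j
    -- Linear functionals on W reduce to a scalar system with an invertible matrix; its rows carry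
    -- the harmless factors (2πi)^{-s(p_i)}.
    refine SeparatingDual.eq_zero_of_forall_dual_eq_zero (R := ℂ) fun ℓ => ?_
    refine congrFun (Matrix.eq_zero_of_mulVec_eq_zero hτ
      (v := fun j => ℓ (β (t j))) (funext fun i => ?_)) j
    have h3 := congrArg ℓ ((partialPow_eq_sum_latticeTheta (α := fun j => β (t j)) H' b
      (p i)).symm.trans (h0 i))
    simp only [map_sum, map_smul, map_zero, smul_eq_mul] at h3
    simp only [Matrix.mulVec, dotProduct, Matrix.of_apply, mul_assoc, ← Finset.mul_sum, h3,
      mul_zero, Pi.zero_apply]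
  funext z
  refine (H' z).unique ?_
  simp [hα, hasSum_zero]

/-- For fixed τ the terms are collected by t instead, giving the expansion in z alone, whose
coefficients depend on τ. -/
theorem HasJacobiExpansion.exists_zSum [FiniteDimensional ℂ W] {P : ℚ → V → Prop}
    {φ : ℍ → Cplx V → W} (H : HasJacobiExpansion Λ P φ) (τ : ℍ) :
    ∃ N : ℕ, 0 < N ∧ ∃ a : V → W, (∀ x, a x ≠ 0 → N • x ∈ Λ.dual) ∧ ZSum Λ id a (φ τ) := by
  have := FiniteDimensional.complete ℂ W
  obtain ⟨c, ⟨N, hN, hc⟩, -, h⟩ := H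
  refine ⟨N, hN, fun s => ∑' m : ℚ, eexp ((m : ℂ) * τ) • c m s, fun s hs => ?_, fun z => ?_⟩
  · have : ∃ m, c m s ≠ 0 := by
      by_contra! h0
      exact hs (by simp [h0])
    obtain ⟨m, hm⟩ := this
    exact (hc m s hm).2
  · have h1 := (Equiv.prodComm V ℚ).hasSum_iff.2 (h τ z)
    refine h1.prod_fiberwise fun s => ?_
    have h2 : Summable fun m : ℚ => eexp ((m : ℂ) * τ) • c m s := by
      refine ((h1.summable.prod_factor s).const_smul
        (eexp (Λ.formC ((1 : ℂ) ⊗ₜ[ℝ] s) z))⁻¹).congr fun m => ?_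
      simp only [Function.comp, Equiv.prodComm_apply, Prod.swap, eexp_add, mul_smul]
      rw [smul_comm (eexp ((m : ℂ) * τ)), inv_smul_smul₀ (eexp_ne_zero _)]
    refine (h2.hasSum.const_smul (eexp (Λ.formC ((1 : ℂ) ⊗ₜ[ℝ] s) z))).congr_fun fun m => ?_
    simp [smul_smul, ← eexp_add, add_comm]

theorem IsHolMod.eq_zero_of_eventually {W : Type*} [NormedAddCommGroup W] [NormedSpace ℂ W]
    [CompleteSpace W] {h : ℍ → W} (hh : IsHolMod h) {τ₀ : ℍ}
    (h0 : ∀ᶠ τ in nhds τ₀, h τ = 0) : h = 0 := by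
  have hopen : IsOpen {z : ℂ | 0 < z.im} := isOpen_lt continuous_const Complex.continuous_im
  have h1 : AnalyticOnNhd ℂ (fun z : ℂ => h (UpperHalfPlane.ofComplex z)) {z | 0 < z.im} :=
    hh.analyticOnNhd hopen
  have h2 : (fun z : ℂ => h (UpperHalfPlane.ofComplex z)) =ᶠ[nhds (τ₀ : ℂ)] 0 := by
    have h3 : Filter.Tendsto UpperHalfPlane.ofComplex (nhds (τ₀ : ℂ)) (nhds τ₀) := by
      have := UpperHalfPlane.contMDiffAt_ofComplex (n := 0) τ₀.im_pos |>.continuousAt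
      rwa [ContinuousAt, UpperHalfPlane.ofComplex_apply] at this
    exact h3.eventually h0
  have h4 := h1.eqOn_zero_of_preconnected_of_eventuallyEq_zero
    (convex_halfSpace_im_gt 0).isPreconnected τ₀.im_pos h2
  funext τ
  simpa using h4 τ.im_pos

variable {G : Subgroup SL(2, ℤ)} {ρ : JacobiGroup.sub Λ G →* (W ≃ₗ[ℂ] W)} {κ : ℤ}

/-- The theta decomposition is used only pointwise in τ, so no holomorphy of its coefficients is
required. The remaining τ, where the determinant vanishes, are reached through the identity theorem.
-/
theorem eq_zero_of_taylorD_eq_zero [FiniteDimensional ℂ W] (hκ : ∀ m : ℕ, κ ≠ -(2 * m))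
    (hρ₁ : ∀ v : Λ.lattice, ρ (JacobiGroup.ofHeis G v 0 1 (by simp)) = 1)
    (hρ₂ : ∀ v : Λ.lattice, ρ (JacobiGroup.ofHeis G 0 v 1 (by simp)) = 1)
    (b : Basis (Fin n) ℝ V) (p : Fin d → Fin n → ℕ)
    (ht : Function.Bijective fun i => (Submodule.Quotient.mk (t i) : Λ.Discriminant))
    (hF : ∃ τ, thetaDet Λ b p t τ ≠ 0) {φ : ℍ → Cplx V → W} (hφ : φ ∈ jacobiWHol κ Λ G ρ)
    (h : ∀ q ∈ precClosure (Set.range p), taylorD Λ b κ q φ = 0) : φ = 0 := by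
  have := FiniteDimensional.complete ℂ W
  obtain ⟨τ₀, hτ₀⟩ := hF
  have h0 : ∀ τ, thetaDet Λ b p t τ ≠ 0 → φ τ = 0 := by
    intro τ hτ
    obtain ⟨N₀, hE⟩ := hφ.2 _ (JacobiGroup.ofMp_mem_sub 1)
    rw [jacobiSlash_one] at hE
    obtain ⟨N, hN, a, ha, H⟩ := hE.exists_zSum τ
    refine eq_zero_of_thetaDet_ne_zero ht b hτ hN ha H (fun v hv z => ?_) (fun v hv z => ?_)
      fun i => partialPow_eq_zero_of_taylorD hκ b h τ ⟨i, rfl⟩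
    · have h1 := congrFun (congrFun (hφ.1.2 (JacobiGroup.ofHeis G 0 ⟨v, hv⟩ 1 (by simp))) τ) z
      rw [hρ₂] at h1
      simpa [jacobiSlash, jacobiFactor, JacobiGroup.ofHeis, jfac_one, heisTranslate,
        IntegralLattice.Q] using h1
    · have h1 := congrFun (congrFun (hφ.1.2 (JacobiGroup.ofHeis G ⟨v, hv⟩ 0 1 (by simp))) τ) z
      rw [hρ₁] at h1
      simpa [jacobiSlash, jacobiFactor, JacobiGroup.ofHeis, jfac_one, heisTranslate] using h1
  obtain ⟨c, hc⟩ := exists_jacobiSum_of_mem_jacobiWHol hφ 1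
  rw [jacobiSlash_one] at hc
  -- For each fixed z this is a holomorphic function of τ that vanishes near τ₀, since the
  -- determinant is continuous and nonzero at τ₀.
  have h1 : ∀ z, (fun τ => φ τ z) = 0 := fun z => by
    have h2 : TauSum (fun x : ℚ × V => (x.1 : ℝ))
        (fun x => eexp (Λ.formC ((1 : ℂ) ⊗ₜ[ℝ] x.2) z) • c x) (fun τ => φ τ z) := fun τ =>
      (hc τ z).congr_fun fun x => by rw [smul_smul, ← eexp_add]
    refine h2.isHolMod.eq_zero_of_eventually (τ₀ := τ₀) ?_
    filter_upwards [(continuous_thetaDet b p t).continuousAt.eventually_ne hτ₀] with τ hτ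
    rw [h0 τ hτ, Pi.zero_apply]
  funext τ z
  exact congrFun (h1 z) τ

end Injectivity

end

/-! ### The three injective maps -/

theorem mainTheorem1 {V : Type*} [AddCommGroup V] [Module ℝ V]
    {W : Type*} [NormedAddCommGroup W] [NormedSpace ℂ W] [FiniteDimensional ℂ W]
    {n d : ℕ} (Λ : IntegralLattice V)
    (κ : ℤ) (hκ : ∀ m : ℕ, κ ≠ -(2 * m))
    (G : Subgroup SL(2, ℤ)) (hG : G.FiniteIndex)
    (ρ : JacobiGroup.sub Λ G →* (W ≃ₗ[ℂ] W)) (hker : ρ.ker.FiniteIndex)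
    (hneg : ∀ w : W, ρ (JacobiGroup.ofHeis G 0 0 (-1) (by simp)) w = -w)
    (hρ₁ : ∀ v : Λ.lattice, ρ (JacobiGroup.ofHeis G v 0 1 (by simp)) = 1)
    (hρ₂ : ∀ v : Λ.lattice, ρ (JacobiGroup.ofHeis G 0 v 1 (by simp)) = 1)
    (b : Module.Basis (Fin n) ℝ V)
    (p : Fin d → Fin n → ℕ) (hp : Function.Injective p)
    (t : Fin d → Λ.dual)
    (ht : Function.Bijective fun i => (Submodule.Quotient.mk (t i) : Λ.Discriminant))
    (hF : ∃ τ, thetaDet Λ b p t τ ≠ 0) :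
    (∃ Φ : jacobiWHol κ Λ G ρ →ₗ[ℂ]
        ((q : precClosure (Set.range p)) →
          modWHol (κ + 2 * ∑ i, (q.1 i : ℤ)) G (ρ.comp (JacobiGroup.ofCover Λ G))),
      (∀ φ q, (Φ φ q : ℍ → W) = taylorD Λ b κ q.1 φ.1) ∧ Function.Injective Φ) ∧
    (∃ Φ : jacobiWeak κ Λ G ρ →ₗ[ℂ]
        ((q : precClosure (Set.range p)) →
          modForm (κ + 2 * ∑ i, (q.1 i : ℤ)) G (ρ.comp (JacobiGroup.ofCover Λ G))),
      (∀ φ q, (Φ φ q : ℍ → W) = taylorD Λ b κ q.1 φ.1) ∧ Function.Injective Φ) ∧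
    (0 ∈ precClosure (Set.range p) →
      ∃ Φ : jacobiForm κ Λ G ρ →ₗ[ℂ]
        modForm κ G (ρ.comp (JacobiGroup.ofCover Λ G)) ×
        ((q : {q : precClosure (Set.range p) // q.1 ≠ 0}) →
          cuspForm (κ + 2 * ∑ i, (q.1.1 i : ℤ)) G (ρ.comp (JacobiGroup.ofCover Λ G))),
      (∀ φ, ((Φ φ).1 : ℍ → W) = taylorD Λ b κ 0 φ.1) ∧
      (∀ φ q, ((Φ φ).2 q : ℍ → W) = taylorD Λ b κ q.1.1 φ.1) ∧
      Function.Injective Φ) := by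
  have inj : ∀ φ ∈ jacobiWHol κ Λ G ρ,
      (∀ q ∈ precClosure (Set.range p), taylorD Λ b κ q φ = 0) → φ = 0 := fun φ hφ h =>
    eq_zero_of_taylorD_eq_zero hκ hρ₁ hρ₂ b p ht hF hφ h
  have hweak : ∀ (m : ℚ) (_ : V), 0 ≤ m → 0 ≤ m := fun _ _ h => h
  have hQ : ∀ x : V, 0 ≤ Λ.Q x := fun x => by
    rcases eq_or_ne x 0 with rfl | hx
    · simp [IntegralLattice.Q]
    · exact (half_pos (Λ.posDef x hx)).le
  have hform : ∀ (m : ℚ) (t : V), 0 ≤ (m : ℝ) - Λ.Q t → 0 ≤ m := fun m t h => by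
    have := hQ t
    have h1 : (0 : ℝ) ≤ m := by linarith
    exact_mod_cast h1
  refine ⟨?_, ?_, fun hzero => ?_⟩
  · refine ⟨LinearMap.pi fun q => LinearMap.codRestrict _ (taylorDLinear Λ κ G ρ b q.1)
      fun φ => taylorD_mem_modWHol φ.2 b q.1, fun φ q => rfl, ?_⟩
    refine (injective_iff_map_eq_zero _).2 fun φ h => Subtype.ext (inj φ.1 φ.2 fun q hq => ?_)
    exact congrArg Subtype.val (congrFun h ⟨q, hq⟩)
  · have hle : jacobiWeak κ Λ G ρ ≤ jacobiWHol κ Λ G ρ := jacobiWith_le_jacobiWHol hweak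
    refine ⟨LinearMap.pi fun q => LinearMap.codRestrict _
      (taylorDLinear Λ κ G ρ b q.1 ∘ₗ Submodule.inclusion hle)
      fun φ => taylorD_mem_modWith hweak (fun m t h _ => h) φ.2 b, fun φ q => rfl, ?_⟩
    refine (injective_iff_map_eq_zero _).2 fun φ h =>
      Subtype.ext (inj φ.1 (hle φ.2) fun q hq => ?_)
    exact congrArg Subtype.val (congrFun h ⟨q, hq⟩)
  · have hle : jacobiForm κ Λ G ρ ≤ jacobiWHol κ Λ G ρ := jacobiWith_le_jacobiWHol hform
    have h0 : ∀ φ ∈ jacobiForm κ Λ G ρ,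
        taylorD Λ b κ 0 φ ∈ modForm κ G (ρ.comp (JacobiGroup.ofCover Λ G)) := fun φ hφ => by
      have := taylorD_mem_modWith (P' := fun m => 0 ≤ m) (p := 0) hform
        (fun m t h _ => hform m t h) hφ b
      simpa [modForm] using this
    -- If n = 0, then -Q(t) ≥ 0, and positive definiteness forces t = 0. The pair (0, 0) was
    -- excluded for q ≠ 0, so only n > 0 remains.
    have hcusp : ∀ (q : Fin n → ℕ), q ≠ 0 → ∀ φ ∈ jacobiForm κ Λ G ρ, taylorD Λ b κ q φ ∈
        cuspForm (κ + 2 * ∑ i, (q i : ℤ)) G (ρ.comp (JacobiGroup.ofCover Λ G)) :=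
      fun q hq φ hφ => taylorD_mem_modWith hform (fun m t h h' => by
        refine lt_of_le_of_ne (hform m t h) fun hm => h' hq hm.symm ?_
        rw [← hm, Rat.cast_zero, zero_sub, Left.nonneg_neg_iff] at h
        refine (form_eq_zero_iff (Λ := Λ)).1 ?_
        have h1 := le_antisymm h (hQ t)
        rw [IntegralLattice.Q] at h1
        linarith) hφ b
    let D := fun q => taylorDLinear Λ κ G ρ b q ∘ₗ Submodule.inclusion hle
    refine ⟨LinearMap.prod (LinearMap.codRestrict _ (D 0) fun φ => h0 φ.1 φ.2)
      (LinearMap.pi fun q => LinearMap.codRestrict _ (D q.1.1) fun φ => hcusp _ q.2 φ.1 φ.2),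
      fun φ => rfl, fun φ q => rfl, ?_⟩
    refine (injective_iff_map_eq_zero _).2 fun φ h =>
      Subtype.ext (inj φ.1 (hle φ.2) fun q hq => ?_)
    rcases eq_or_ne q 0 with rfl | hq0
    · exact congrArg Subtype.val (congrArg Prod.fst h)
    · exact congrArg Subtype.val (congrFun (congrArg Prod.snd h) ⟨⟨q, hq⟩, hq0⟩)
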